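/- Let $X$ be a finite dimensional real vector space, equipped with a Euclidean structure (used only to fix Lebesgue measure and to identify the dual group $X^*$ with $X$). For a bounded continuous function $\varphi$ on $X$ let $\varphi(Q)$ be the operator of multiplication by $\varphi$ on $L^2(X)$, for $\psi\in C_0(X^*)$ let $\psi(P)=\mathcal F^*M_\psi\mathcal F$, where $\mathcal F$ is the Fourier transformation and $M_\psi$ is multiplication by $\psi$, and let $(U_xf)(y)=f(x+y)$. For a linear subspace $Y\subset X$ embed $C_0(X/Y)$ in the bounded continuous functions on $X$ by composition with the canonical map $X\to X/Y$. Let $\mathcal G(X)$ be the norm closure of $\sum_Y C_0(X/Y)$, where $Y$ runs over all linear subspaces of $X$; the quantum Grassmann algebra $\mathscr G(X)=\mathcal G(X)\rtimes X\subset B(L^2(X))$ is the norm closed linear span of the operators $\varphi(Q)\psi(P)$ with $\varphi\in\mathcal G(X)$, $\psi\in C_0(X^*)$. The Grassmann filter of a finite dimensional real vector space $E$ is the filter generated by the sets $E\setminus(L+\Lambda)$ with $L$ a finite union of strict linear subspaces of $E$ and $\Lambda\subset E$ compact. For a linear subspace $Y$ of $X$ let $\mathfrak g_Y$ be the filter on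 $X$ generated by the Grassmann filter of $Y$, and set $\tau_YT=\lim_{y\to\mathfrak g_Y}U_yTU_y^*$, the limit being taken with respect to the seminorms $\|S\|_\theta=\|S\theta(Q)\|+\|\theta(Q)S\|$, $\theta\in C_0(X)$. Let $\mathbb P(X)$ be the set of lines (one dimensional linear subspaces) of $X$; for $Y\in\mathbb P(X)$, $y\to\mathfrak g_Y$ just means $y\to\infty$ in $Y$. An observable on $L^2(X)$ is a (possibly not densely defined) self-adjoint operator $H$, described by its functional calculus, a $*$-morphism $C_0(\mathbb R)\ni\varphi\mapsto\varphi(H)\in B(L^2(X))$. It is affiliated to $\mathscr G(X)$ if $\varphi(H)\in\mathscr G(X)$ for all $\varphi\in C_0(\mathbb R)$. Its spectrum $\sigma(H)$ (respectively essential spectrum $\sigma_{\rm ess}(H)$) is the set of $\lambda\in\mathbb R$ such that $\varphi(H)\neq0$ (respectively $\varphi(H)$ is not compact) for every $\varphi\in C_0(\mathbb R)$ with $\varphi(\lambda)\ne0$. For a bounded operator $T$, $\sigma(T)\subset\mathbb C$ is the usual spectrum and $\sigma_{\rm ess}(T)$ is the set of $z\in\mathbb C$ such that $T-z$ is not invertible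 modulo the compact operators. **Theorem.** (1) Let $T\in\mathscr G(X)$. For each $Y\in\mathbb P(X)$ the limit $\tau_YT$ exists and belongs to $\mathscr G(X)$, the set $\{\tau_YT\mid Y\in\mathbb P(X)\}$ is norm compact, and $$\sigma_{\rm ess}(T)=\bigcup_{Y\in\mathbb P(X)}\sigma(\tau_YT).$$ (2) Let $H$ be an observable affiliated to $\mathscr G(X)$. For each $Y\in\mathbb P(X)$ there is an observable $\tau_YH$ affiliated to $\mathscr G(X)$ such that $\varphi(\tau_YH)=\tau_Y(\varphi(H))$ for all $\varphi\in C_0(\mathbb R)$, and $$\sigma_{\rm ess}(H)=\bigcup_{Y\in\mathbb P(X)}\sigma(\tau_YH).$$ In both cases no closure of the union is needed. -/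

import Mathlib

open MeasureTheory Filter Topology
open scoped ZeroAtInfty BoundedContinuousFunction ENNReal

noncomputable section

namespace QuantumGrassmann

/-! ### Operators on `L²(X)` -/

section Operators

variable (X : Type*) [NormedAddCommGroup X] [InnerProductSpace ℝ X] [FiniteDimensional ℝ X]
  [MeasurableSpace X] [BorelSpace X]

/-- The Hilbert space `L²(X)` (Lebesgue measure, complex-valued functions). -/
abbrev L2 : Type _ := Lp ℂ 2 (volume : Measure X)

/-- The `C⋆`-algebra `B(L²(X))`. -/
abbrev BL2 : Type _ := L2 X →L[ℂ] L2 X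

variable {X}

/-- The unitary translation operator `(U_x f)(y) = f (x + y)`. -/
def translation (x : X) : BL2 X :=
  (Lp.compMeasurePreservingₗᵢ ℂ (fun y : X => x + y)
    (measurePreserving_add_left volume x)).toContinuousLinearMap

/-- `x.T = U_x T U_x⋆`. -/
def conjTranslation (x : X) (T : BL2 X) : BL2 X :=
  translation x * T * star (translation x)

lemma memLp_top_of_bcf (φ : X →ᵇ ℂ) : MemLp φ ∞ (volume : Measure X) :=
  memLp_top_of_bound φ.continuous.aestronglyMeasurable ‖φ‖
    (ae_of_all _ fun x => φ.norm_coe_le_norm x)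

/-- `φ(Q)`: multiplication by the bounded continuous function `φ` on `L²(X)`. -/
def mulOp (φ : X →ᵇ ℂ) : BL2 X :=
  (ContinuousLinearMap.mul ℂ ℂ).holderL volume ∞ 2 2 ((memLp_top_of_bcf φ).toLp φ)

/-- `ψ(P) = 𝓕⋆ M_ψ 𝓕`: the Fourier multiplier with symbol `ψ`; the dual group of `X` is
identified with `X` through the inner product. -/
def fourierMul (ψ : X →ᵇ ℂ) : BL2 X :=
  ((Lp.fourierTransformₗᵢ X ℂ).symm : L2 X →L[ℂ] L2 X) ∘L mulOp ψ ∘L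
    ((Lp.fourierTransformₗᵢ X ℂ) : L2 X →L[ℂ] L2 X)

end Operators

/-! ### The classical and the quantum Grassmann algebra -/

section Algebras

variable {X : Type*} [NormedAddCommGroup X] [InnerProductSpace ℝ X]

/-- The pull-back `φ ∘ π_Y` of `φ ∈ C₀(X/Y)` to a bounded continuous function on `X`. -/
def pullback (Y : Submodule ℝ X) (φ : C₀(X ⧸ Y, ℂ)) : X →ᵇ ℂ :=
  φ.toBCF.compContinuous ⟨Y.mkQ, continuous_quot_mk⟩

/-- `C₀(X/Y)`, embedded in the bounded continuous functions on `X`. -/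
def C0Quotient (Y : Submodule ℝ X) : Submodule ℂ (X →ᵇ ℂ) where
  carrier := Set.range (pullback Y)
  add_mem' := by
    rintro _ _ ⟨f, rfl⟩ ⟨g, rfl⟩
    exact ⟨f + g, by ext x; rfl⟩
  zero_mem' := ⟨0, by ext x; rfl⟩
  smul_mem' := by
    rintro c _ ⟨f, rfl⟩
    exact ⟨c • f, by ext x; rfl⟩

variable (X)

/-- The classical Grassmann algebra `𝒢(X)`: the norm closure of `∑_Y C₀(X/Y)`, where `Y` runs over
all linear subspaces of `X`. -/
def classicalGrassmann : Submodule ℂ (X →ᵇ ℂ) :=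
  (⨆ Y : Submodule ℝ X, C0Quotient Y).topologicalClosure

variable [FiniteDimensional ℝ X] [MeasurableSpace X] [BorelSpace X]

/-- The quantum Grassmann algebra `𝒢(X) ⋊ X`: the norm closed linear span in `B(L²(X))` of the
operators `φ(Q) ψ(P)` with `φ ∈ 𝒢(X)` and `ψ ∈ C₀(X*)`. -/
def quantumGrassmann : Submodule ℂ (BL2 X) :=
  (Submodule.span ℂ {T : BL2 X | ∃ φ ∈ classicalGrassmann X, ∃ ψ : C₀(X, ℂ),
    T = mulOp φ * fourierMul ψ.toBCF}).topologicalClosure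

end Algebras

/-! ### Localization along the Grassmann filters -/

section Localization

open scoped Pointwise in
/-- The Grassmann filter of a vector space `E`: it is generated by the complements of the sets
`L + Λ`, with `L` a finite union of strict subspaces of `E` and `Λ` compact. -/
def grassmannFilter (E : Type*) [NormedAddCommGroup E] [NormedSpace ℝ E] : Filter E :=
  Filter.generate {S : Set E | ∃ 𝔽 : Set (Submodule ℝ E), 𝔽.Finite ∧ ⊤ ∉ 𝔽 ∧
    ∃ Λ : Set E, IsCompact Λ ∧ S = ((⋃ Y ∈ 𝔽, (Y : Set E)) + Λ)ᶜ}

variable {X : Type*} [NormedAddCommGroup X] [InnerProductSpace ℝ X]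

/-- The filter `𝔤_Y` on `X` generated by the Grassmann filter of the subspace `Y`. -/
def grassmannFilterOf (Y : Submodule ℝ X) : Filter X :=
  (grassmannFilter Y).map ((↑) : Y → X)

variable [FiniteDimensional ℝ X] [MeasurableSpace X] [BorelSpace X]

/-- `S = lim_{y → 𝔤_Y} U_y T U_y⋆` for the topology defined by the seminorms
`‖A‖_θ = ‖A θ(Q)‖ + ‖θ(Q) A‖`, `θ ∈ C₀(X)`. -/
def IsTranslationLimit (Y : Submodule ℝ X) (T S : BL2 X) : Prop :=
  ∀ θ : C₀(X, ℂ), Tendsto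
    (fun y : X => ‖(conjTranslation y T - S) * mulOp θ.toBCF‖ +
      ‖mulOp θ.toBCF * (conjTranslation y T - S)‖)
    (grassmannFilterOf Y) (𝓝 0)

open Classical in
/-- The localization `τ_Y T` (with value `0` if the limit does not exist). -/
def tau (Y : Submodule ℝ X) (T : BL2 X) : BL2 X :=
  if h : ∃ S, IsTranslationLimit Y T S then h.choose else 0

end Localization

/-- The projective space `ℙ(X)`: the lines (one dimensional subspaces) of `X`. -/
abbrev Lines (X : Type*) [AddCommGroup X] [Module ℝ X] : Type _ :=
  {Y : Submodule ℝ X // Module.finrank ℝ Y = 1}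

/-! ### Essential spectrum and observables -/

section Spectra

variable {𝓗 : Type*} [NormedAddCommGroup 𝓗] [InnerProductSpace ℂ 𝓗] [CompleteSpace 𝓗]

/-- The essential spectrum of a bounded operator: the complex `z` for which `T - z` is not
invertible modulo the compact operators. -/
def essSpectrum (T : 𝓗 →L[ℂ] 𝓗) : Set ℂ :=
  {z | ¬ ∃ S : 𝓗 →L[ℂ] 𝓗,
    IsCompactOperator (S * (T - z • 1) - 1 : 𝓗 →L[ℂ] 𝓗) ∧
    IsCompactOperator ((T - z • 1) * S - 1 : 𝓗 →L[ℂ] 𝓗)}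

variable (𝓗) in
/-- An observable on `𝓗`, i.e. a possibly not densely defined self-adjoint operator `H`, given by
its functional calculus `φ ↦ φ(H)`: a `⋆`-morphism from `C₀(ℝ)` into the bounded operators. -/
abbrev Observable : Type _ := C₀(ℝ, ℂ) →⋆ₙₐ[ℂ] (𝓗 →L[ℂ] 𝓗)

/-- `H` is affiliated to `𝒞` if `φ(H) ∈ 𝒞` for all `φ ∈ C₀(ℝ)`. -/
def IsAffiliated (H : Observable 𝓗) (𝒞 : Submodule ℂ (𝓗 →L[ℂ] 𝓗)) : Prop :=
  ∀ φ : C₀(ℝ, ℂ), H φ ∈ 𝒞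

/-- The spectrum of an observable. -/
def obsSpectrum (H : Observable 𝓗) : Set ℝ :=
  {t | ∀ φ : C₀(ℝ, ℂ), φ t ≠ 0 → H φ ≠ 0}

/-- The essential spectrum of an observable. -/
def obsEssSpectrum (H : Observable 𝓗) : Set ℝ :=
  {t | ∀ φ : C₀(ℝ, ℂ), φ t ≠ 0 → ¬ IsCompactOperator (H φ)}

end Spectra

end QuantumGrassmann

end

open QuantumGrassmann

/-! Everything is tested on generators φ(Q)ψ(P) with φ ∈ C₀(X/Z). Conjugation by U_a fixes ψ(P) and
shifts φ by the class of a in X/Z. If that class converges, the conjugated generators converge in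
norm; if it goes to infinity, they tend locally to 0, because ψ(P)θ(Q) is compact. Hence τ_Y keeps a
generator when Y ≤ Z and kills it otherwise.

The absence of a closure rests on three facts. An element T involves only countably many subspaces Z
(`exists_countable_of_quantumGrassmann`). An ultrafilter tending to infinity in X converges modulo Z
exactly when Z contains a certain subspace Z₀ ≠ 0 (`isDirected_of_ultrafilter`). Countably many
strict subspaces cannot fill Z₀, so some line Y ≤ Z₀ lies in exactly those of the relevant Z that
contain Z₀ (`exists_line_avoiding`). The limit of T along the ultrafilter is therefore a translate
of τ_Y T (`exists_localLimit_of_ultrafilter`). The same argument for ultrafilters of lines gives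
compactness of the set of localizations (`exists_tendsto_tau`), so pointwise invertibility of the
τ_Y T − z is automatically uniform.

If all τ_Y T − z are invertible and z ≠ 0, then T − z is bounded below on functions supported in a
window of fixed shape placed far away. Wide windows almost commute with T in mean square
(`slowCommutation_of_mem`), and the squared norms of the windowed pieces of f integrate to ‖f‖². The
local bounds thus integrate to a global bound modulo a cutoff θ(Q) (`exists_cutoff_lower_bound`).
Since θ(Q)T is compact and z ≠ 0, the cutoff can be traded for a compact operator; with the same
bound for the adjoint this yields a parametrix. When X ≠ 0, the point z = 0 belongs to every σ(τ_Y
T). Conversely, translated compact operators tend strongly to 0, so a parametrix of T − z forces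
each τ_Y T − z to be invertible.

For observables, τ_Y respects products and adjoints, and a tent function peaking at t reduces the
claim to the bounded case at z = 1 (`norm_observable_lt_one`, `notMem_obsEssSpectrum`). -/

set_option linter.unusedSectionVars false

namespace QuantumGrassmann

/-! ### Multiplication operators, translations and conjugation by translations -/

section MultiplicationOperators

variable {X : Type*} [NormedAddCommGroup X] [InnerProductSpace ℝ X] [FiniteDimensional ℝ X]
  [MeasurableSpace X] [BorelSpace X]

lemma coeFn_mulOp (φ : X →ᵇ ℂ) (f : L2 X) : mulOp φ f =ᵐ[volume] fun x => φ x * f x := by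
  have h1 := (ContinuousLinearMap.mul ℂ ℂ).coeFn_holder (r := 2) ((memLp_top_of_bcf φ).toLp φ) f
  have h2 := (memLp_top_of_bcf φ).coeFn_toLp
  filter_upwards [h1, h2] with x hx hx2
  have : mulOp φ f x = ((ContinuousLinearMap.mul ℂ ℂ).holder 2 ((memLp_top_of_bcf φ).toLp φ) f) x :=
    rfl
  rw [this, hx, hx2]
  simp

lemma norm_mulOp_apply_le (φ : X →ᵇ ℂ) (f : L2 X) : ‖mulOp φ f‖ ≤ ‖φ‖ * ‖f‖ := by
  refine Lp.norm_le_mul_norm_of_ae_le_mul ?_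
  filter_upwards [coeFn_mulOp φ f] with x hx
  rw [hx, norm_mul]
  gcongr
  exact φ.norm_coe_le_norm x

lemma norm_mulOp_le (φ : X →ᵇ ℂ) : ‖mulOp φ‖ ≤ ‖φ‖ :=
  ContinuousLinearMap.opNorm_le_bound _ (norm_nonneg _) (norm_mulOp_apply_le φ)

lemma mulOp_add (φ ψ : X →ᵇ ℂ) : mulOp (φ + ψ) = mulOp φ + mulOp ψ := by
  ext1 f
  apply Lp.ext
  filter_upwards [coeFn_mulOp (φ + ψ) f, coeFn_mulOp φ f, coeFn_mulOp ψ f,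
    Lp.coeFn_add (mulOp φ f) (mulOp ψ f)] with x h1 h2 h3 h4
  rw [add_apply, h4, h1, Pi.add_apply, h2, h3]
  simp [add_mul]

lemma mulOp_smul (c : ℂ) (φ : X →ᵇ ℂ) : mulOp (c • φ) = c • mulOp φ := by
  ext1 f
  apply Lp.ext
  filter_upwards [coeFn_mulOp (c • φ) f, coeFn_mulOp φ f,
    Lp.coeFn_smul c (mulOp φ f)] with x h1 h2 h4
  rw [smul_apply, h4, h1, Pi.smul_apply, h2]
  simp [mul_assoc]

lemma mulOp_mul (φ ψ : X →ᵇ ℂ) : mulOp (φ * ψ) = mulOp φ * mulOp ψ := by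
  ext1 f
  apply Lp.ext
  filter_upwards [coeFn_mulOp (φ * ψ) f, coeFn_mulOp φ (mulOp ψ f), coeFn_mulOp ψ f] with x h1 h2 h3
  rw [mul_apply_eq_comp, h1, h2, h3]
  simp [mul_assoc]

lemma mulOp_one : mulOp (1 : X →ᵇ ℂ) = 1 := by
  ext1 f
  apply Lp.ext
  filter_upwards [coeFn_mulOp 1 f] with x h1
  simp [h1]

lemma star_mulOp (φ : X →ᵇ ℂ) : star (mulOp φ) = mulOp (star φ) := by
  rw [ContinuousLinearMap.star_eq_adjoint]
  symm
  rw [ContinuousLinearMap.eq_adjoint_iff]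
  intro f g
  rw [L2.inner_def, L2.inner_def]
  refine integral_congr_ae ?_
  filter_upwards [coeFn_mulOp (star φ) f, coeFn_mulOp φ g] with x h1 h2
  rw [h1, h2]
  simp
  ring

/-- `φ ↦ φ(Q)` as a continuous linear map. -/
noncomputable def mulOpL : (X →ᵇ ℂ) →L[ℂ] BL2 X :=
  LinearMap.mkContinuous ⟨⟨mulOp, mulOp_add⟩, mulOp_smul⟩ 1 (fun φ => by
    simpa using norm_mulOp_le φ)

lemma mulOp_sub (φ ψ : X →ᵇ ℂ) : mulOp (φ - ψ) = mulOp φ - mulOp ψ := map_sub mulOpL φ ψ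

lemma mulOp_zero : mulOp (0 : X →ᵇ ℂ) = 0 := map_zero mulOpL

/-- `φ ↦ φ(a + ·)` on bounded continuous functions. -/
noncomputable def shift (a : X) (φ : X →ᵇ ℂ) : X →ᵇ ℂ :=
  φ.compContinuous ⟨fun x => a + x, by fun_prop⟩

@[simp] lemma shift_apply (a : X) (φ : X →ᵇ ℂ) (x : X) : shift a φ x = φ (a + x) := rfl

lemma coeFn_translation (a : X) (f : L2 X) : translation a f =ᵐ[volume] fun x => f (a + x) :=
  Lp.coeFn_compMeasurePreserving f (measurePreserving_add_left volume a)

lemma norm_translation_apply (a : X) (f : L2 X) : ‖translation a f‖ = ‖f‖ :=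
  Lp.norm_compMeasurePreserving f (measurePreserving_add_left volume a)

lemma ae_comp_add_left {p : X → Prop} (a : X) (h : ∀ᵐ x, p x) : ∀ᵐ x, p (a + x) :=
  (measurePreserving_add_left volume a).quasiMeasurePreserving.ae h

lemma translation_add (a b : X) : translation (a + b) = translation b * translation a := by
  ext1 f
  apply Lp.ext
  filter_upwards [coeFn_translation (a + b) f, coeFn_translation b (translation a f),
    ae_comp_add_left b (coeFn_translation a f)] with x h1 h2 h3
  rw [mul_apply_eq_comp, h1, h2, h3, add_assoc]

lemma translation_zero : translation (0 : X) = 1 := by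
  ext1 f
  apply Lp.ext
  filter_upwards [coeFn_translation 0 f] with x h1
  simp [h1]

lemma translation_mul_neg (a : X) : translation a * translation (-a) = 1 := by
  rw [← translation_add, neg_add_cancel, translation_zero]

lemma star_translation_mul (a : X) : star (translation a) * translation a = 1 := by
  rw [ContinuousLinearMap.star_eq_adjoint]
  refine ContinuousLinearMap.ext fun f => ext_inner_left ℂ fun g => ?_
  rw [mul_apply_eq_comp, ContinuousLinearMap.adjoint_inner_right]
  exact LinearIsometry.inner_map_map (Lp.compMeasurePreservingₗᵢ ℂ (fun y : X => a + y)
    (measurePreserving_add_left volume a)) g f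

lemma star_translation (a : X) : star (translation a) = translation (-a) := by
  calc star (translation a) = star (translation a) * (translation a * translation (-a)) := by
        rw [translation_mul_neg, mul_one]
    _ = translation (-a) := by rw [← mul_assoc, star_translation_mul, one_mul]

lemma translation_mul_star (a : X) : translation a * star (translation a) = 1 := by
  rw [star_translation, translation_mul_neg]

lemma conjTranslation_add (a : X) (S T : BL2 X) :
    conjTranslation a (S + T) = conjTranslation a S + conjTranslation a T := by
  simp [conjTranslation, mul_add, add_mul]

lemma conjTranslation_sub (a : X) (S T : BL2 X) :
    conjTranslation a (S - T) = conjTranslation a S - conjTranslation a T := by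
  simp [conjTranslation, mul_sub, sub_mul]

lemma conjTranslation_smul (a : X) (c : ℂ) (T : BL2 X) :
    conjTranslation a (c • T) = c • conjTranslation a T := by
  simp [conjTranslation]

lemma conjTranslation_mul (a : X) (S T : BL2 X) :
    conjTranslation a (S * T) = conjTranslation a S * conjTranslation a T := by
  have h : star (translation a) * translation a = 1 := star_translation_mul a
  simp only [conjTranslation]
  calc _ = translation a * S * 1 * T * star (translation a) := by noncomm_ring
    _ = _ := by rw [← h]; noncomm_ring

lemma conjTranslation_one (a : X) : conjTranslation a (1 : BL2 X) = 1 := by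
  simp [conjTranslation, translation_mul_star]

lemma star_conjTranslation (a : X) (T : BL2 X) :
    star (conjTranslation a T) = conjTranslation a (star T) := by
  simp [conjTranslation, mul_assoc]

lemma translation_mul (a : X) (T : BL2 X) :
    translation a * T = conjTranslation a T * translation a := by
  rw [conjTranslation, mul_assoc, star_translation_mul, mul_one]

lemma norm_translation_le (a : X) : ‖translation a‖ ≤ 1 :=
  ContinuousLinearMap.opNorm_le_bound _ zero_le_one fun f => by
    rw [norm_translation_apply, one_mul]

lemma norm_conjTranslation_le (a : X) (T : BL2 X) : ‖conjTranslation a T‖ ≤ ‖T‖ := by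
  calc ‖conjTranslation a T‖ ≤ ‖translation a‖ * ‖T‖ * ‖star (translation a)‖ := by
        refine (norm_mul_le _ _).trans ?_
        gcongr
        exact norm_mul_le _ _
    _ ≤ 1 * ‖T‖ * 1 := by
        rw [star_translation]
        gcongr <;> exact norm_translation_le _
    _ = ‖T‖ := by ring

lemma conjTranslation_mulOp (a : X) (φ : X →ᵇ ℂ) :
    conjTranslation a (mulOp φ) = mulOp (shift a φ) := by
  have : translation a * mulOp φ = mulOp (shift a φ) * translation a := by
    ext1 f
    apply Lp.ext
    filter_upwards [coeFn_translation a (mulOp φ f), coeFn_mulOp (shift a φ) (translation a f),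
      coeFn_translation a f, ae_comp_add_left a (coeFn_mulOp φ f)] with x h1 h2 h3 h4
    rw [mul_apply_eq_comp, mul_apply_eq_comp, h1, h2, h3, h4, shift_apply]
  rw [conjTranslation, this, mul_assoc, translation_mul_star, mul_one]

lemma continuous_translation_apply :
    Continuous fun p : X × L2 X => translation p.1 p.2 := by
  refine continuous_iff_continuousAt.2 fun p => ?_
  have hg : Continuous fun a : X => (⟨fun y => a + y, by fun_prop⟩ : C(X, X)) :=
    ContinuousMap.continuous_of_continuous_uncurry _ (by
      simp only [Function.uncurry_def, ContinuousMap.coe_mk]; fun_prop)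
  exact Filter.Tendsto.compMeasurePreservingLp (μ := (volume : Measure X)) (ν := volume)
    (f := fun p : X × L2 X => p.2) (g := fun p : X × L2 X => ⟨fun y => p.1 + y, by fun_prop⟩)
    continuous_snd.continuousAt (hg.comp continuous_fst).continuousAt
    (fun q => measurePreserving_add_left volume q.1) (measurePreserving_add_left volume p.1)
    ENNReal.ofNat_ne_top

end MultiplicationOperators

end QuantumGrassmann

namespace QuantumGrassmann

/-! ### Fourier multipliers as superpositions of translations -/

section FourierMultipliers

open scoped FourierTransform SchwartzMap

variable {X : Type*} [NormedAddCommGroup X] [InnerProductSpace ℝ X] [FiniteDimensional ℝ X]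
  [MeasurableSpace X] [BorelSpace X]

lemma fourierMul_apply (ψ : X →ᵇ ℂ) (f : L2 X) :
    fourierMul ψ f = (Lp.fourierTransformₗᵢ X ℂ).symm (mulOp ψ (Lp.fourierTransformₗᵢ X ℂ f)) := rfl

lemma norm_fourierMul_le (ψ : X →ᵇ ℂ) : ‖fourierMul ψ‖ ≤ ‖ψ‖ :=
  ContinuousLinearMap.opNorm_le_bound _ (norm_nonneg _) fun f => by
    rw [fourierMul_apply, LinearIsometryEquiv.norm_map]
    simpa using norm_mulOp_apply_le ψ (Lp.fourierTransformₗᵢ X ℂ f)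

lemma fourierMul_add (φ ψ : X →ᵇ ℂ) : fourierMul (φ + ψ) = fourierMul φ + fourierMul ψ := by
  ext1 f
  simp [fourierMul_apply, mulOp_add]

lemma fourierMul_smul (c : ℂ) (φ : X →ᵇ ℂ) : fourierMul (c • φ) = c • fourierMul φ := by
  ext1 f
  simp [fourierMul_apply, mulOp_smul]

lemma fourierMul_mul (φ ψ : X →ᵇ ℂ) : fourierMul (φ * ψ) = fourierMul φ * fourierMul ψ := by
  ext1 f
  simp [fourierMul_apply, mulOp_mul]

lemma fourierMul_one : fourierMul (1 : X →ᵇ ℂ) = 1 := by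
  ext1 f
  simp [fourierMul_apply, mulOp_one]

lemma inner_fourier_symm_left (u v : L2 X) :
    inner ℂ ((Lp.fourierTransformₗᵢ X ℂ).symm u) v =
      inner ℂ u (Lp.fourierTransformₗᵢ X ℂ v) := by
  rw [← (Lp.fourierTransformₗᵢ X ℂ).inner_map_map, LinearIsometryEquiv.apply_symm_apply]

lemma star_fourierMul (ψ : X →ᵇ ℂ) : star (fourierMul ψ) = fourierMul (star ψ) := by
  rw [ContinuousLinearMap.star_eq_adjoint]
  symm
  rw [ContinuousLinearMap.eq_adjoint_iff]
  intro f g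
  rw [fourierMul_apply, fourierMul_apply, inner_fourier_symm_left, ← star_mulOp, ContinuousLinearMap.star_eq_adjoint,
    ContinuousLinearMap.adjoint_inner_left, ← (Lp.fourierTransformₗᵢ X ℂ).inner_map_map f,
    LinearIsometryEquiv.apply_symm_apply]

/-- `ψ ↦ ψ(P)` as a continuous linear map. -/
noncomputable def fourierMulL : (X →ᵇ ℂ) →L[ℂ] BL2 X :=
  LinearMap.mkContinuous ⟨⟨fourierMul, fourierMul_add⟩, fourierMul_smul⟩ 1 (fun φ => by
    simpa using norm_fourierMul_le φ)

lemma fourierMul_sub (φ ψ : X →ᵇ ℂ) : fourierMul (φ - ψ) = fourierMul φ - fourierMul ψ :=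
  map_sub fourierMulL φ ψ

/-- The character `ξ ↦ exp (2πi⟨a, ξ⟩)`. -/
noncomputable def character (a : X) : X →ᵇ ℂ :=
  BoundedContinuousFunction.ofNormedAddCommGroup
    (fun ξ => Complex.exp (↑(2 * Real.pi * inner ℝ a ξ) * Complex.I)) (by fun_prop) 1
    (fun ξ => by rw [Complex.norm_exp_ofReal_mul_I])

lemma character_apply (a ξ : X) :
    character a ξ = Complex.exp (↑(2 * Real.pi * inner ℝ a ξ) * Complex.I) := rfl

lemma norm_character_apply (a ξ : X) : ‖character a ξ‖ = 1 := by
  rw [character_apply, Complex.norm_exp_ofReal_mul_I]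

lemma continuous_uncurry_character : Continuous fun p : X × X => character p.1 p.2 := by
  simp only [character_apply]
  fun_prop

/-- Both sides are continuous in f, so Schwartz functions suffice; there it is a change of variables
in the Fourier integral. -/
lemma fourier_translation (a : X) (f : L2 X) :
    Lp.fourierTransformₗᵢ X ℂ (translation a f) =
      mulOp (character a) (Lp.fourierTransformₗᵢ X ℂ f) := by
  refine (SchwartzMap.denseRange_toLpCLM (E := X) (F := ℂ) (p := 2) (μ := volume)
    ENNReal.ofNat_ne_top).induction_on (p := fun f => Lp.fourierTransformₗᵢ X ℂ (translation a f) =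
      mulOp (character a) (Lp.fourierTransformₗᵢ X ℂ f)) f
    (isClosed_eq (by fun_prop) (by fun_prop)) fun s => ?_
  have h1 : translation a (s.toLp 2) = (s.compSubConstCLM ℂ (-a)).toLp 2 := by
    apply Lp.ext
    filter_upwards [coeFn_translation a (s.toLp 2),
      SchwartzMap.coeFn_toLp (s.compSubConstCLM ℂ (-a)) 2 volume,
      ae_comp_add_left a (s.coeFn_toLp 2 volume)] with x h1 h2 h3
    rw [h1, h2, h3, SchwartzMap.compSubConstCLM_apply, sub_neg_eq_add, add_comm]
  have h2 : ∀ t : 𝓢(X, ℂ), Lp.fourierTransformₗᵢ X ℂ (t.toLp 2) = (𝓕 t).toLp 2 :=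
    fun t => t.toLp_fourier_eq
  rw [SchwartzMap.toLpCLM_apply, h1, h2, h2]
  apply Lp.ext
  filter_upwards [coeFn_mulOp (character a) ((𝓕 s).toLp 2),
      SchwartzMap.coeFn_toLp (𝓕 (s.compSubConstCLM ℂ (-a))) 2 volume,
      (𝓕 s).coeFn_toLp 2 volume] with ξ h1 h2 h3
  rw [h1, h2, h3, SchwartzMap.fourier_coe, SchwartzMap.fourier_coe, Real.fourier_eq',
    Real.fourier_eq', ← integral_add_right_eq_self _ (-a), ← integral_const_mul]
  refine integral_congr_ae (Eventually.of_forall fun x => ?_)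
  simp only [SchwartzMap.compSubConstCLM_apply, smul_eq_mul, character_apply]
  rw [← mul_assoc, ← Complex.exp_add, sub_neg_eq_add, neg_add_cancel_right, inner_add_left,
    inner_neg_left]
  congr 2
  push_cast
  ring

lemma translation_eq_fourierMul (a : X) : translation a = fourierMul (character a) := by
  ext1 f
  rw [fourierMul_apply, ← fourier_translation, LinearIsometryEquiv.symm_apply_apply]

/-- Translations are themselves Fourier multipliers, so they commute with ψ(P). Conjugating a
generator therefore moves only its factor φ(Q). -/
lemma conjTranslation_fourierMul (a : X) (ψ : X →ᵇ ℂ) :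
    conjTranslation a (fourierMul ψ) = fourierMul ψ := by
  rw [conjTranslation, translation_eq_fourierMul, ← fourierMul_mul, mul_comm, fourierMul_mul,
    mul_assoc, ← translation_eq_fourierMul, translation_mul_star, mul_one]

/-- The bounded continuous function defined by a Schwartz function. -/
noncomputable abbrev schwartzBCF (s : 𝓢(X, ℂ)) : X →ᵇ ℂ := s.toZeroAtInfty.toBCF

/-- Fourier inversion writes the symbol as an integral of characters, whose multipliers are
translations. The weak form needs only scalar Fubini, and the integrable weight 𝓕 s is what the
commutator estimates use. -/
lemma inner_fourierMul_schwartz (s : 𝓢(X, ℂ)) (f g : L2 X) :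
    inner ℂ g (fourierMul (schwartzBCF s) f) =
      ∫ x, (𝓕 s) x * inner ℂ g (translation x f) := by
  set F := Lp.fourierTransformₗᵢ X ℂ with hF
  have hinv : ∀ ξ, s ξ = ∫ x, (𝓕 s) x * character x ξ := fun ξ => by
    have h : s ξ = (𝓕⁻ (𝓕 s)) ξ := by rw [FourierTransform.fourierInv_fourier_eq]
    rw [h, SchwartzMap.fourierInv_coe, Real.fourierInv_eq']
    refine integral_congr_ae (Eventually.of_forall fun x => ?_)
    simp only [smul_eq_mul, character_apply, mul_comm]
  have h1 : ∀ (φ : X →ᵇ ℂ), inner ℂ g (fourierMul φ f) = ∫ ξ, φ ξ * inner ℂ (F g ξ) (F f ξ) := by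
    intro φ
    rw [fourierMul_apply, ← F.inner_map_map, LinearIsometryEquiv.apply_symm_apply, L2.inner_def]
    refine integral_congr_ae ?_
    filter_upwards [coeFn_mulOp φ (F f)] with ξ h
    rw [h]
    simp
    ring
  have hint : Integrable (Function.uncurry fun ξ x : X =>
      (𝓕 s) x * character x ξ * inner ℂ (F g ξ) (F f ξ)) (volume.prod volume) := by
    have h2 : Integrable (fun z : X × X => inner ℂ (F g z.1) (F f z.1) * (𝓕 s) z.2)
        (volume.prod volume) :=
      (L2.integrable_inner (F g) (F f)).mul_prod (SchwartzMap.integrable (𝓕 s))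
    refine (h2.bdd_mul (c := 1) (f := fun z : X × X => character z.2 z.1) ?_ ?_).congr ?_
    · exact (continuous_uncurry_character.comp continuous_swap).aestronglyMeasurable
    · exact Eventually.of_forall fun z => (norm_character_apply _ _).le
    · refine Eventually.of_forall fun z => ?_
      simp only [Function.uncurry]
      ring
  simp only [translation_eq_fourierMul, h1]
  calc ∫ ξ, schwartzBCF s ξ * inner ℂ (F g ξ) (F f ξ)
      = ∫ ξ, ∫ x, (𝓕 s) x * character x ξ * inner ℂ (F g ξ) (F f ξ) := by
        refine integral_congr_ae (Eventually.of_forall fun ξ => ?_)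
        have : schwartzBCF s ξ = s ξ := rfl
        simp only [this]
        rw [hinv ξ, ← integral_mul_const]
    _ = ∫ x, ∫ ξ, (𝓕 s) x * character x ξ * inner ℂ (F g ξ) (F f ξ) := integral_integral_swap hint
    _ = _ := by
        refine integral_congr_ae (Eventually.of_forall fun x => ?_)
        simp only [mul_assoc, integral_const_mul]

end FourierMultipliers

/-! ### Cutoffs and approximation of symbols by Schwartz functions -/

section Cutoffs

open scoped SchwartzMap

variable (X : Type*) [NormedAddCommGroup X] [InnerProductSpace ℝ X] [FiniteDimensional ℝ X]

/-- A smooth bump, equal to `1` on the ball of radius `n + 1`, supported in that of radius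
`n + 2`. -/
noncomputable def cutoffBump (n : ℕ) : ContDiffBump (0 : X) :=
  ⟨n + 1, n + 2, by positivity, by linarith⟩

/-- `cutoffBump` as an element of `C₀(X)`. -/
noncomputable def cutoff (n : ℕ) : C₀(X, ℂ) where
  toFun x := (cutoffBump X n x : ℂ)
  continuous_toFun := Complex.continuous_ofReal.comp (cutoffBump X n).continuous
  zero_at_infty' := by
    refine HasCompactSupport.is_zero_at_infty ?_
    exact (cutoffBump X n).hasCompactSupport.comp_left Complex.ofReal_zero

variable {X}

lemma cutoff_apply (n : ℕ) (x : X) : cutoff X n x = (cutoffBump X n x : ℂ) := rfl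

lemma cutoff_eq_one {n : ℕ} {x : X} (h : ‖x‖ ≤ n + 1) : cutoff X n x = 1 := by
  rw [cutoff_apply, (cutoffBump X n).one_of_mem_closedBall (by simpa [cutoffBump] using h),
    Complex.ofReal_one]

lemma hasCompactSupport_cutoff (n : ℕ) : HasCompactSupport (cutoff X n) :=
  (cutoffBump X n).hasCompactSupport.comp_left Complex.ofReal_zero

lemma norm_cutoff_apply_le (n : ℕ) (x : X) : ‖cutoff X n x‖ ≤ 1 := by
  rw [cutoff_apply, Complex.norm_real, Real.norm_of_nonneg (cutoffBump X n).nonneg]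
  exact (cutoffBump X n).le_one

lemma norm_one_sub_cutoff_apply_le (n : ℕ) (x : X) : ‖1 - cutoff X n x‖ ≤ 1 := by
  rw [cutoff_apply, ← Complex.ofReal_one, ← Complex.ofReal_sub, Complex.norm_real,
    Real.norm_of_nonneg (sub_nonneg.2 (cutoffBump X n).le_one)]
  linarith [(cutoffBump X n).nonneg (x := x)]

/-- Functions vanishing at infinity are uniformly close to their truncations. -/
lemma eventually_norm_sub_cutoff_mul_le (θ : C₀(X, ℂ)) {ε : ℝ} (hε : 0 < ε) :
    ∀ᶠ n in atTop, ∀ x, ‖θ x - cutoff X n x * θ x‖ ≤ ε := by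
  have h := θ.zero_at_infty'
  have h2 := h.eventually (Metric.ball_mem_nhds 0 hε)
  obtain ⟨r, hr⟩ := (Metric.hasBasis_cobounded_compl_closedBall (0 : X)).eventually_iff.1
    (Metric.cobounded_eq_cocompact (α := X) ▸ h2)
  filter_upwards [eventually_ge_atTop ⌈r⌉₊] with n hn x
  have hrn : r ≤ n := (Nat.le_ceil r).trans (by exact_mod_cast hn)
  by_cases hx : ‖x‖ ≤ n + 1
  · simp [cutoff_eq_one hx, hε.le]
  · have h3 : ‖θ x‖ ≤ ε := by
      have := hr.2 (x := x) (by simp; linarith)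
      simpa using this.le
    calc ‖θ x - cutoff X n x * θ x‖ = ‖1 - cutoff X n x‖ * ‖θ x‖ := by
          rw [← norm_mul]; ring_nf
      _ ≤ 1 * ε := by gcongr; exact norm_one_sub_cutoff_apply_le n x
      _ = ε := one_mul ε

variable [MeasurableSpace X] [BorelSpace X]

/-- Schwartz functions are dense in `C₀(X)`. -/
lemma exists_schwartz_near (ψ : C₀(X, ℂ)) {ε : ℝ} (hε : 0 < ε) :
    ∃ s : 𝓢(X, ℂ), ∀ x, ‖ψ x - s x‖ ≤ ε := by
  obtain ⟨n, hn⟩ := (eventually_norm_sub_cutoff_mul_le ψ (half_pos hε)).exists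
  set g : X → ℂ := fun x => cutoff X n x * ψ x with hg
  have hgc : Continuous g := (cutoff X n).continuous.mul ψ.continuous
  have hgs : HasCompactSupport g := (hasCompactSupport_cutoff n).mul_right
  obtain ⟨δ, hδ, hgδ⟩ := Metric.uniformContinuous_iff.1
    (hgs.uniformContinuous_of_continuous hgc) (ε / 2) (half_pos hε)
  -- Mollifying at the scale δ of uniform continuity moves the truncated function by at most ε / 2.
  let φ : ContDiffBump (0 : X) := ⟨δ / 2, δ, by positivity, by linarith⟩
  have hφ : HasCompactSupport (φ.normed volume) := φ.hasCompactSupport_normed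
  have hsm : ContDiff ℝ ((⊤ : ℕ∞) : WithTop ℕ∞)
      (convolution (φ.normed volume) g (ContinuousLinearMap.lsmul ℝ ℝ) volume) :=
    hφ.contDiff_convolution_left _ φ.contDiff_normed hgc.locallyIntegrable
  refine ⟨(hφ.convolution (ContinuousLinearMap.lsmul ℝ ℝ) hgs).toSchwartzMap hsm, fun x => ?_⟩
  have h1 := φ.dist_normed_convolution_le (μ := volume) (x₀ := x) (ε := ε / 2)
    hgc.aestronglyMeasurable fun y hy => (hgδ hy).le
  rw [dist_comm, dist_eq_norm] at h1
  calc _ ≤ ‖ψ x - g x‖ + ‖g x - _‖ := norm_sub_le_norm_sub_add_norm_sub _ (g x) _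
    _ ≤ ε / 2 + ε / 2 := add_le_add (hn x) h1
    _ = ε := add_halves ε

/-- A property of Fourier multipliers that is stable under norm limits holds for all symbols in
`C₀` if it holds for Schwartz symbols. -/
lemma fourierMul_induction {p : BL2 X → Prop}
    (hp : ∀ T, (∀ ε > 0, ∃ S, p S ∧ ‖T - S‖ ≤ ε) → p T)
    (hs : ∀ s : 𝓢(X, ℂ), p (fourierMul (schwartzBCF s))) (ψ : C₀(X, ℂ)) :
    p (fourierMul ψ.toBCF) := by
  refine hp _ fun ε hε => ?_
  obtain ⟨s, h⟩ := exists_schwartz_near ψ hε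
  refine ⟨_, hs s, ?_⟩
  rw [← fourierMul_sub]
  exact (norm_fourierMul_le _).trans ((BoundedContinuousFunction.norm_le hε.le).2 h)

end Cutoffs

end QuantumGrassmann

namespace QuantumGrassmann

/-! ### Compact operators through finite nets -/

section CompactOperators

variable {𝓗 : Type*} [NormedAddCommGroup 𝓗] [InnerProductSpace ℂ 𝓗] [CompleteSpace 𝓗]

lemma IsCompactOperator.mul_left' {K : 𝓗 →L[ℂ] 𝓗} (hK : IsCompactOperator K) (A : 𝓗 →L[ℂ] 𝓗) :
    IsCompactOperator (A * K : 𝓗 →L[ℂ] 𝓗) :=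
  hK.clm_comp A

lemma IsCompactOperator.mul_right' {K : 𝓗 →L[ℂ] 𝓗} (hK : IsCompactOperator K) (A : 𝓗 →L[ℂ] 𝓗) :
    IsCompactOperator (K * A : 𝓗 →L[ℂ] 𝓗) :=
  hK.comp_clm A

/-- The norm limit of compact operators is compact. -/
lemma isCompactOperator_of_forall_near {T : 𝓗 →L[ℂ] 𝓗}
    (h : ∀ ε > 0, ∃ S : 𝓗 →L[ℂ] 𝓗, IsCompactOperator S ∧ ‖T - S‖ ≤ ε) : IsCompactOperator T := by
  have h1 : T ∈ closure {S : 𝓗 →L[ℂ] 𝓗 | IsCompactOperator S} := by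
    refine Metric.mem_closure_iff.2 fun ε hε => ?_
    obtain ⟨S, hS, hTS⟩ := h (ε / 2) (half_pos hε)
    exact ⟨S, hS, by rw [dist_eq_norm]; linarith⟩
  exact (isClosed_setOfPred_isCompactOperator (𝕜₁ := ℂ) (𝕜₂ := ℂ) (σ₁₂ := RingHom.id ℂ) (M₁ := 𝓗)
    (M₂ := 𝓗)).closure_subset h1

/-- Finite nets for the image of the unit ball. -/
lemma exists_finite_net {E : Type*} [NormedAddCommGroup E] [NormedSpace ℂ E] {K : 𝓗 →L[ℂ] E}
    (hK : IsCompactOperator K) {ε : ℝ} (hε : 0 < ε) :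
    ∃ t : Set 𝓗, t.Finite ∧ t ⊆ Metric.closedBall 0 1 ∧
      ∀ x, ‖x‖ ≤ 1 → ∃ y ∈ t, ‖K x - K y‖ < ε := by
  have h1 : TotallyBounded (K '' Metric.closedBall 0 1) :=
    (hK.isCompact_closure_image_closedBall (f := (K : 𝓗 →ₗ[ℂ] E)) 1).totallyBounded.subset
      subset_closure
  obtain ⟨t, hts, htf, ht⟩ := Metric.finite_approx_of_totallyBounded h1 ε hε
  obtain ⟨t', ht's, ht'f, rfl⟩ := Set.exists_subset_image_finite_and.1 ⟨t, hts, htf, rfl⟩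
  refine ⟨t', ht'f, ht's, fun x hx => ?_⟩
  have h2 := ht (Set.mem_image_of_mem K (mem_closedBall_zero_iff.2 hx))
  simp only [Set.mem_iUnion, Set.mem_image, exists_prop, exists_exists_and_eq_and] at h2
  obtain ⟨y, hy, hxy⟩ := h2
  exact ⟨y, hy, by rwa [← dist_eq_norm]⟩

lemma isCompactOperator_of_finite_net {K : 𝓗 →L[ℂ] 𝓗}
    (h : ∀ ε > 0, ∃ t : Set 𝓗, t.Finite ∧ ∀ x, ‖x‖ ≤ 1 → ∃ y ∈ t, ‖K x - K y‖ < ε) :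
    IsCompactOperator K := by
  refine (isCompactOperator_iff_isCompact_closure_image_closedBall (K : 𝓗 →ₗ[ℂ] 𝓗) one_pos).2 ?_
  refine TotallyBounded.isCompact_of_isClosed (TotallyBounded.closure ?_) isClosed_closure
  rw [Metric.totallyBounded_iff]
  intro ε hε
  obtain ⟨t, htf, ht⟩ := h ε hε
  refine ⟨⇑K '' t, htf.image _, ?_⟩
  rintro _ ⟨x, hx, rfl⟩
  obtain ⟨y, hy, hxy⟩ := ht x (by simpa using hx)
  simp only [Set.mem_iUnion, exists_prop, Set.exists_mem_image]
  exact ⟨y, hy, by rwa [Metric.mem_ball, dist_eq_norm]⟩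

/-- Strong convergence of a bounded family is uniform on the relatively compact image of the unit
ball. -/
lemma tendsto_norm_mul_of_isCompactOperator {ι : Type*} {l : Filter ι} {B : ι → 𝓗 →L[ℂ] 𝓗} {M : ℝ}
    (hM : ∀ i, ‖B i‖ ≤ M) (hB : ∀ g, Tendsto (fun i => B i g) l (𝓝 0)) {K : 𝓗 →L[ℂ] 𝓗}
    (hK : IsCompactOperator K) : Tendsto (fun i => ‖B i * K‖) l (𝓝 0) := by
  have hM' : 0 < |M| + 1 := by positivity
  rw [Metric.tendsto_nhds]
  intro ε hε
  obtain ⟨t, htf, -, ht⟩ := exists_finite_net hK (ε := ε / 4 / (|M| + 1)) (by positivity)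
  have h1 : ∀ᶠ i in l, ∀ y ∈ t, ‖B i (K y)‖ < ε / 4 :=
    (eventually_all_finite htf).2 fun y _ => by
      simpa using (hB (K y)).eventually (Metric.ball_mem_nhds 0 (show 0 < ε / 4 by positivity))
  filter_upwards [h1] with i hi
  have h2 : ‖B i * K‖ ≤ ε / 2 := by
    refine ContinuousLinearMap.opNorm_le_of_unit_norm (by positivity) fun x hx => ?_
    obtain ⟨y, hy, hxy⟩ := ht x hx.le
    have h3 : ‖B i (K x - K y)‖ ≤ ε / 4 := by
      calc ‖B i (K x - K y)‖ ≤ ‖B i‖ * ‖K x - K y‖ := (B i).le_opNorm _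
        _ ≤ (|M| + 1) * (ε / 4 / (|M| + 1)) := by
            gcongr
            exact (hM i).trans (by linarith [le_abs_self M])
        _ = ε / 4 := by field_simp
    calc ‖(B i * K) x‖ = ‖B i (K x - K y) + B i (K y)‖ := by simp
      _ ≤ ε / 4 + ε / 4 := (norm_add_le _ _).trans (add_le_add h3 (hi y hy).le)
      _ = ε / 2 := by ring
  rw [dist_zero_right, norm_norm]
  linarith

/-- In ‖K g‖² = ⟨K g, K g⟩ the left entry is replaced by a multiple of a net point K y, and ⟨K y, K
g⟩ = ⟨K⋆K y, g⟩ tends to 0. Arguing with nets allows arbitrary filters, not only sequences. -/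
lemma tendsto_of_isCompactOperator_of_weak {ι : Type*} {l : Filter ι} {g : ι → 𝓗} {M : ℝ}
    (hM : ∀ i, ‖g i‖ ≤ M) (hg : ∀ h : 𝓗, Tendsto (fun i => inner ℂ h (g i)) l (𝓝 0))
    {K : 𝓗 →L[ℂ] 𝓗} (hK : IsCompactOperator K) : Tendsto (fun i => K (g i)) l (𝓝 0) := by
  have hM' : 0 < |M| + 1 := by positivity
  have hK' : 0 < ‖K‖ + 1 := by positivity
  rw [Metric.tendsto_nhds]
  intro ε hε
  set m := |M| + 1
  set k := ‖K‖ + 1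
  -- The mesh is chosen so that the net error and the weak term contribute ε² / 4 each to ‖K (g
  -- i)‖².
  obtain ⟨t, htf, -, ht⟩ := exists_finite_net hK (ε := ε ^ 2 / (4 * (k * m ^ 2))) (by positivity)
  have h1 : ∀ᶠ i in l, ∀ y ∈ t, ‖inner ℂ (K y) (K (g i))‖ < ε ^ 2 / (4 * m) :=
    (eventually_all_finite htf).2 fun y _ => by
      have h := (hg (ContinuousLinearMap.adjoint K (K y))).eventually
        (Metric.ball_mem_nhds 0 (show 0 < ε ^ 2 / (4 * m) by positivity))
      simpa [ContinuousLinearMap.adjoint_inner_left] using h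
  filter_upwards [h1] with i hi
  have hgm : ‖g i‖ ≤ m := (hM i).trans (by simp only [m]; linarith [le_abs_self M])
  set x : 𝓗 := ((m⁻¹ : ℝ) : ℂ) • g i
  have hgx : g i = ((m : ℝ) : ℂ) • x := by
    rw [smul_smul, ← Complex.ofReal_mul, mul_inv_cancel₀ hM'.ne', Complex.ofReal_one, one_smul]
  have hx : ‖x‖ ≤ 1 := by
    rw [norm_smul, Complex.norm_real, Real.norm_of_nonneg (by positivity)]
    rw [inv_mul_le_iff₀ hM']
    linarith
  obtain ⟨y, hy, hxy⟩ := ht x hx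
  have hKg : ‖K (g i)‖ ≤ k * m :=
    (K.le_opNorm _).trans (by gcongr; simp only [k]; linarith)
  have h2 : ‖K (g i)‖ ^ 2 ≤ m * (ε ^ 2 / (4 * (k * m ^ 2)) * (k * m) + ε ^ 2 / (4 * m)) := by
    calc ‖K (g i)‖ ^ 2 = ‖inner ℂ (K (g i)) (K (g i))‖ := by
          rw [inner_self_eq_norm_sq_to_K]; simp
      _ = ‖((m : ℝ) : ℂ) * (inner ℂ (K x - K y) (K (g i)) + inner ℂ (K y) (K (g i)))‖ := by
          rw [← inner_add_left, sub_add_cancel]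
          conv_lhs => rw [hgx]
          rw [map_smul, inner_smul_left, ← map_smul, ← hgx]
          simp
      _ ≤ m * (‖K x - K y‖ * ‖K (g i)‖ + ‖inner ℂ (K y) (K (g i))‖) := by
          rw [norm_mul, Complex.norm_real, Real.norm_of_nonneg hM'.le]
          gcongr
          exact (norm_add_le _ _).trans (add_le_add_left (norm_inner_le_norm _ _) _)
      _ ≤ _ := by
          gcongr
          exact (hi y hy).le
  have h3 : m * (ε ^ 2 / (4 * (k * m ^ 2)) * (k * m) + ε ^ 2 / (4 * m)) = ε ^ 2 / 2 := by
    field_simp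
    norm_num
  rw [dist_zero_right]
  refine lt_of_pow_lt_pow_left₀ 2 hε.le ?_
  rw [h3] at h2
  nlinarith [sq_pos_of_pos hε]

/-- Since ‖K⋆x‖² ≤ ‖K K⋆x‖ ‖x‖, a finite net for the compact operator K K⋆ is also one for K⋆. -/
lemma isCompactOperator_star {K : 𝓗 →L[ℂ] 𝓗} (hK : IsCompactOperator K) :
    IsCompactOperator (star K : 𝓗 →L[ℂ] 𝓗) := by
  have hKK : IsCompactOperator (K * star K : 𝓗 →L[ℂ] 𝓗) := IsCompactOperator.mul_right' hK _
  have key : ∀ x, ‖star K x‖ ^ 2 ≤ ‖(K * star K) x‖ * ‖x‖ := fun x => by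
    rw [← inner_self_eq_norm_sq (𝕜 := ℂ) (star K x), ContinuousLinearMap.star_eq_adjoint,
      ContinuousLinearMap.adjoint_inner_right]
    exact (RCLike.re_le_norm _).trans (norm_inner_le_norm _ _)
  refine isCompactOperator_of_finite_net fun ε hε => ?_
  obtain ⟨t, htf, ht1, ht⟩ := exists_finite_net hKK (ε := ε ^ 2 / 4) (by positivity)
  refine ⟨t, htf, fun x hx => ?_⟩
  obtain ⟨y, hy, hxy⟩ := ht x hx
  refine ⟨y, hy, ?_⟩
  have h1 : ‖x - y‖ ≤ 2 := by
    have h2 : ‖y‖ ≤ 1 := by simpa using ht1 hy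
    linarith [norm_sub_le x y]
  have h2 := key (x - y)
  rw [map_sub] at h2
  refine lt_of_pow_lt_pow_left₀ 2 hε.le (h2.trans_lt ?_)
  rw [map_sub]
  calc _ ≤ ε ^ 2 / 4 * 2 := by gcongr
    _ < ε ^ 2 := by nlinarith [sq_pos_of_pos hε]

end CompactOperators

/-! ### Invertibility and parametrices from lower bounds -/

section Invertibility

variable {𝓗 : Type*} [NormedAddCommGroup 𝓗] [InnerProductSpace ℂ 𝓗] [CompleteSpace 𝓗]

lemma isUnit_of_coercive {B : 𝓗 →L[ℂ] 𝓗} {c : ℝ} (hc : 0 < c)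
    (h : ∀ x, c * ‖x‖ ^ 2 ≤ ‖inner ℂ (B x) x‖) : IsUnit B :=
  ContinuousLinearMap.isUnit_of_forall_le_norm_inner_map B (c := ⟨c, hc.le⟩) hc fun x => by
    rw [mul_comm]
    exact h x

lemma inner_star_mul_self (A : 𝓗 →L[ℂ] 𝓗) (x : 𝓗) :
    inner ℂ ((star A * A) x) x = ((‖A x‖ ^ 2 : ℝ) : ℂ) := by
  rw [mul_apply_eq_comp, ContinuousLinearMap.star_eq_adjoint,
    ContinuousLinearMap.adjoint_inner_left, inner_self_eq_norm_sq_to_K]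
  norm_cast

/-- An operator bounded below modulo a compact operator has a left parametrix. -/
lemma exists_left_parametrix {A K : 𝓗 →L[ℂ] 𝓗} (hK : IsCompactOperator K) {c : ℝ} (hc : 0 < c)
    (h : ∀ x, c * ‖x‖ ^ 2 ≤ ‖A x‖ ^ 2 + ‖K x‖ ^ 2) :
    ∃ S : 𝓗 →L[ℂ] 𝓗, IsCompactOperator (S * A - 1 : 𝓗 →L[ℂ] 𝓗) := by
  -- The hypothesis is coercivity of this operator. If R is its inverse, then R A⋆ is a left inverse
  -- of A up to −R K⋆K.
  have hB : IsUnit (star A * A + star K * K) := by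
    refine isUnit_of_coercive hc fun x => ?_
    rw [add_apply, inner_add_left, inner_star_mul_self, inner_star_mul_self, ← Complex.ofReal_add,
      Complex.norm_real, Real.norm_of_nonneg (by positivity)]
    exact h x
  obtain ⟨R, hR⟩ := hB.exists_left_inv
  refine ⟨R * star A, ?_⟩
  have h1 : R * star A * A - 1 = -(R * star K * K) := by
    rw [← hR]
    noncomm_ring
  rw [h1]
  exact (IsCompactOperator.mul_left' hK (R * star K)).neg

lemma exists_parametrix {A K L : 𝓗 →L[ℂ] 𝓗} (hK : IsCompactOperator K) (hL : IsCompactOperator L)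
    {c d : ℝ} (hc : 0 < c) (hd : 0 < d) (h : ∀ x, c * ‖x‖ ^ 2 ≤ ‖A x‖ ^ 2 + ‖K x‖ ^ 2)
    (h' : ∀ x, d * ‖x‖ ^ 2 ≤ ‖star A x‖ ^ 2 + ‖L x‖ ^ 2) :
    ∃ S : 𝓗 →L[ℂ] 𝓗, IsCompactOperator (S * A - 1 : 𝓗 →L[ℂ] 𝓗) ∧
      IsCompactOperator (A * S - 1 : 𝓗 →L[ℂ] 𝓗) := by
  obtain ⟨S, hS⟩ := exists_left_parametrix hK hc h
  obtain ⟨S', hS'⟩ := exists_left_parametrix hL hd h'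
  have h1 : IsCompactOperator (A * star S' - 1 : 𝓗 →L[ℂ] 𝓗) := by
    simpa using isCompactOperator_star hS'
  refine ⟨S, hS, ?_⟩
  -- The adjoint of a left parametrix of A⋆ is a right parametrix of A. Left and right parametrices
  -- agree modulo compacts, so S serves on both sides.
  have h2 : A * S - 1 = (A * star S' - 1) + A * (S * A - 1) * star S'
      - A * S * (A * star S' - 1) := by noncomm_ring
  rw [h2]
  exact (h1.add (IsCompactOperator.mul_right' (IsCompactOperator.mul_left' hS A) _)).sub
    (IsCompactOperator.mul_left' h1 _)

lemma isUnit_of_bounded_below {A : 𝓗 →L[ℂ] 𝓗} {c d : ℝ} (hc : 0 < c) (hd : 0 < d)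
    (h : ∀ x, c * ‖x‖ ≤ ‖A x‖) (h' : ∀ x, d * ‖x‖ ≤ ‖star A x‖) : IsUnit A := by
  have key : ∀ (B : 𝓗 →L[ℂ] 𝓗) {c : ℝ}, 0 < c → (∀ x, c * ‖x‖ ≤ ‖B x‖) → IsUnit (star B * B) := by
    intro B c hc h
    refine isUnit_of_coercive (pow_pos hc 2) fun x => ?_
    rw [inner_star_mul_self, Complex.norm_real, Real.norm_of_nonneg (by positivity), ← mul_pow]
    gcongr
    exact h x
  obtain ⟨R, hR⟩ := (key A hc h).exists_left_inv
  obtain ⟨R', hR'⟩ := (key (star A) hd h').exists_right_inv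
  rw [star_star] at hR'
  exact isUnit_iff_exists_and_exists.2 ⟨⟨star A * R', by rw [← mul_assoc, hR']⟩,
    ⟨R * star A, by rw [mul_assoc, hR]⟩⟩

end Invertibility

end QuantumGrassmann

namespace QuantumGrassmann

/-! ### Compactness of products θ(Q)ψ(P) -/

section CompactProducts

open scoped FourierTransform SchwartzMap

variable {X : Type*} [NormedAddCommGroup X] [InnerProductSpace ℝ X] [FiniteDimensional ℝ X]
  [MeasurableSpace X] [BorelSpace X]

/-- The complex conjugate of a Schwartz function, as an element of `L²(X)`. -/
noncomputable def schwartzConj (s : 𝓢(X, ℂ)) : L2 X := star (s.toLp 2 volume)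

lemma coeFn_schwartzConj (s : 𝓢(X, ℂ)) : schwartzConj s =ᵐ[volume] fun ξ => star (s ξ) := by
  filter_upwards [Lp.coeFn_star (s.toLp 2 volume), s.coeFn_toLp 2 volume] with ξ h1 h2
  rw [schwartzConj, h1, Pi.star_apply, h2]

/-- The convolution kernel of the Fourier multiplier with Schwartz symbol `s`, as an element of
`L²(X)`. -/
noncomputable def schwartzKernel (s : 𝓢(X, ℂ)) : L2 X :=
  (Lp.fourierTransformₗᵢ X ℂ).symm (schwartzConj s)

lemma continuous_inner_translation (k f : L2 X) :
    Continuous fun y : X => inner ℂ k (translation y f) :=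
  continuous_const.inner (continuous_translation_apply.comp (.prodMk_left f))

/-- Plancherel turns the Fourier inversion integral at y into a pairing with one fixed L² kernel.
The symbol enters conjugated because the inner product is antilinear on the left. -/
lemma fourierMul_toLp_ae (s t : 𝓢(X, ℂ)) : fourierMul (schwartzBCF s) (t.toLp 2) =ᵐ[volume]
    fun y => inner ℂ (schwartzKernel s) (translation y (t.toLp 2)) := by
  set u : 𝓢(X, ℂ) := SchwartzMap.smulLeftCLM ℂ s (𝓕 t) with hu
  have hu' : ∀ ξ, u ξ = s ξ * (𝓕 t) ξ := fun ξ => by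
    rw [hu, SchwartzMap.smulLeftCLM_apply_apply s.hasTemperateGrowth, smul_eq_mul]
  set f : L2 X := t.toLp 2 volume
  have hF : Lp.fourierTransformₗᵢ X ℂ f = (𝓕 t).toLp 2 := t.toLp_fourier_eq
  have h1 : fourierMul (schwartzBCF s) f = (𝓕⁻ u).toLp 2 := by
    rw [fourierMul_apply, hF]
    have : mulOp (schwartzBCF s) ((𝓕 t).toLp 2) = u.toLp 2 := by
      apply Lp.ext
      filter_upwards [coeFn_mulOp (schwartzBCF s) ((𝓕 t).toLp 2), u.coeFn_toLp 2 volume,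
        (𝓕 t).coeFn_toLp 2 volume] with ξ h1 h2 h3
      rw [h1, h2, h3, hu']
      rfl
    rw [this]
    exact u.toLp_fourierInv_eq
  rw [h1]
  filter_upwards [(𝓕⁻ u).coeFn_toLp 2 volume] with y hy
  have h2 := inner_fourier_symm_left (schwartzConj s) (translation y f)
  rw [fourier_translation] at h2
  rw [hy, schwartzKernel, h2, SchwartzMap.fourierInv_coe, Real.fourierInv_eq', L2.inner_def]
  refine integral_congr_ae ?_
  filter_upwards [coeFn_schwartzConj s, 
    coeFn_mulOp (character y) (Lp.fourierTransformₗᵢ X ℂ f), (𝓕 t).coeFn_toLp 2 volume] with ξ h1 h2 h3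
  rw [h1, h2, hF, h3, hu', character_apply, real_inner_comm]
  simp
  ring

/-- The kernel representation of `θ(Q) ψ(P)` for a cutoff `θ` and a Schwartz symbol `ψ`. -/
lemma mulOp_cutoff_fourierMul_ae (n : ℕ) (s : 𝓢(X, ℂ)) (f : L2 X) :
    (mulOp (cutoff X n).toBCF * fourierMul (schwartzBCF s)) f =ᵐ[volume]
      fun y => cutoff X n y * inner ℂ (schwartzKernel s) (translation y f) := by
  have hm : ∀ f : L2 X, MemLp (fun y => cutoff X n y *
      inner ℂ (schwartzKernel s) (translation y f)) 2 (volume : Measure X) := fun f =>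
    ((cutoff X n).continuous.mul (continuous_inner_translation _ f)).memLp_of_hasCompactSupport
      (hasCompactSupport_cutoff n).mul_right
  have hc : MemLp (cutoff X n) 2 (volume : Measure X) :=
    (cutoff X n).continuous.memLp_of_hasCompactSupport (hasCompactSupport_cutoff n)
  let J₀ : L2 X →ₗ[ℂ] L2 X :=
    { toFun := fun f => (hm f).toLp _
      map_add' := fun f g => by
        rw [← MemLp.toLp_add]
        refine MemLp.toLp_congr _ _ (Eventually.of_forall fun y => ?_)
        simp [inner_add_right, mul_add]
      map_smul' := fun c f => by
        rw [RingHom.id_apply, ← MemLp.toLp_const_smul]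
        refine MemLp.toLp_congr _ _ (Eventually.of_forall fun y => ?_)
        simp [inner_smul_right, mul_left_comm] }
  -- The kernel formula makes sense for every f and is bounded, by Cauchy–Schwarz pointwise. It
  -- remains to compare two bounded operators on Schwartz functions.
  let J : BL2 X := J₀.mkContinuous (‖schwartzKernel s‖ * ‖hc.toLp _‖) fun f => by
    rw [mul_right_comm]
    refine Lp.norm_le_mul_norm_of_ae_le_mul ?_
    filter_upwards [(hm f).coeFn_toLp, hc.coeFn_toLp] with y h1 h2
    have : J₀ f = (hm f).toLp _ := rfl
    rw [this, h1, h2, norm_mul, mul_comm]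
    gcongr
    exact (norm_inner_le_norm _ _).trans_eq (by rw [norm_translation_apply])
  have hJ : ∀ f, J f = (hm f).toLp _ := fun f => rfl
  have key : mulOp (cutoff X n).toBCF * fourierMul (schwartzBCF s) = J := by
    refine ContinuousLinearMap.ext fun f => ?_
    refine (SchwartzMap.denseRange_toLpCLM (E := X) (F := ℂ) (p := 2) (μ := volume)
      ENNReal.ofNat_ne_top).induction_on
      (p := fun f => (mulOp (cutoff X n).toBCF * fourierMul (schwartzBCF s)) f = J f) f
      (isClosed_eq (by fun_prop) (by fun_prop)) fun t => ?_
    rw [SchwartzMap.toLpCLM_apply, hJ]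
    apply Lp.ext
    filter_upwards [(hm (t.toLp 2)).coeFn_toLp, fourierMul_toLp_ae s t,
      coeFn_mulOp (cutoff X n).toBCF (fourierMul (schwartzBCF s) (t.toLp 2))] with y h1 h2 h3
    rw [h1, mul_apply_eq_comp, h3, h2]
    rfl
  rw [key, hJ]
  exact (hm f).coeFn_toLp

/-- The kernel vectors κ y depend continuously on y, so over the compact support of the cutoff
finitely many v approximate them all. A finite net for the finite rank map f ↦ (⟨v, f⟩)ᵥ is then a
net for the operator. -/
lemma isCompactOperator_cutoff_mul_fourierMul (n : ℕ) (s : 𝓢(X, ℂ)) :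
    IsCompactOperator (mulOp (cutoff X n).toBCF * fourierMul (schwartzBCF s) : BL2 X) := by
  have hc : MemLp (cutoff X n) 2 (volume : Measure X) :=
    (cutoff X n).continuous.memLp_of_hasCompactSupport (hasCompactSupport_cutoff n)
  refine isCompactOperator_of_finite_net fun ε hε => ?_
  -- The pointwise error below is 3δ: 2δ from replacing κ y by v, as ‖f − g‖ ≤ 2, and δ from the net
  -- for L.
  set δ : ℝ := ε / (6 * (‖hc.toLp _‖ + 1)) with hδ
  have hδ0 : 0 < δ := by positivity
  let κ : X → L2 X := fun y => translation (-y) (schwartzKernel s)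
  have hκ : Continuous κ :=
    continuous_translation_apply.comp (continuous_neg.prodMk continuous_const)
  have hκi : ∀ y f, inner ℂ (schwartzKernel s) (translation y f) = inner ℂ (κ y) f := fun y f => by
    simp only [κ]
    rw [← star_translation, ContinuousLinearMap.star_eq_adjoint,
      ContinuousLinearMap.adjoint_inner_left]
  have hcpt : IsCompact (κ '' tsupport (cutoff X n)) := (hasCompactSupport_cutoff n).isCompact.image hκ
  obtain ⟨t, -, htf, ht⟩ := Metric.finite_approx_of_totallyBounded hcpt.totallyBounded δ hδ0
  have : Fintype t := htf.fintype
  let L : L2 X →L[ℂ] (t → ℂ) := ContinuousLinearMap.pi fun v => innerSL ℂ (v : L2 X)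
  obtain ⟨u, huf, hu1, hu⟩ := exists_finite_net (K := L)
    (isCompactOperator_of_locallyCompactSpace_dom L) hδ0
  refine ⟨u, huf, fun f hf => ?_⟩
  obtain ⟨g, hg, hfg⟩ := hu f hf
  refine ⟨g, hg, ?_⟩
  have hfg2 : ‖f - g‖ ≤ 2 := by
    have : ‖g‖ ≤ 1 := by simpa using hu1 hg
    linarith [norm_sub_le f g]
  have hpt : ∀ y ∈ tsupport (cutoff X n), ‖inner ℂ (κ y) (f - g)‖ ≤ 3 * δ := fun y hy => by
    have h1 := ht (Set.mem_image_of_mem κ hy)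
    simp only [Set.mem_iUnion, exists_prop] at h1
    obtain ⟨v, hv, hyv⟩ := h1
    have h2 : ‖inner ℂ v (f - g)‖ ≤ δ := by
      have h3 : L (f - g) ⟨v, hv⟩ = inner ℂ v (f - g) := rfl
      rw [← h3, map_sub]
      exact (norm_le_pi_norm _ _).trans hfg.le
    calc ‖inner ℂ (κ y) (f - g)‖ = ‖inner ℂ (κ y - v) (f - g) + inner ℂ v (f - g)‖ := by
          rw [← inner_add_left, sub_add_cancel]
      _ ≤ ‖κ y - v‖ * ‖f - g‖ + δ :=
          (norm_add_le _ _).trans (add_le_add (norm_inner_le_norm _ _) h2)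
      _ ≤ δ * 2 + δ := by
          gcongr
          rw [← dist_eq_norm]
          exact hyv.le
      _ = 3 * δ := by ring
  rw [← map_sub]
  have h4 : ‖(mulOp (cutoff X n).toBCF * fourierMul (schwartzBCF s)) (f - g)‖ ≤
      3 * δ * ‖hc.toLp _‖ := by
    refine Lp.norm_le_mul_norm_of_ae_le_mul ?_
    filter_upwards [hc.coeFn_toLp, mulOp_cutoff_fourierMul_ae n s (f - g)] with y h1 h2
    rw [h1, h2, norm_mul, hκi, mul_comm]
    by_cases hy : y ∈ tsupport (cutoff X n)
    · gcongr
      exact hpt y hy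
    · simp [image_eq_zero_of_notMem_tsupport hy]
  refine h4.trans_lt ?_
  have h5 : 3 * δ * (‖hc.toLp _‖ + 1) = ε / 2 := by
    rw [hδ]
    field_simp
    norm_num
  nlinarith

lemma tendsto_mulOp_mul_cutoff (θ : C₀(X, ℂ)) {ε : ℝ} (hε : 0 < ε) :
    ∀ᶠ n in atTop, ‖mulOp θ.toBCF - mulOp (cutoff X n).toBCF * mulOp θ.toBCF‖ ≤ ε := by
  filter_upwards [eventually_norm_sub_cutoff_mul_le θ hε] with n hn
  rw [← mulOp_mul, ← mulOp_sub]
  exact (norm_mulOp_le _).trans ((BoundedContinuousFunction.norm_le hε.le).2 hn)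

/-- `θ(Q) ψ(P)` is compact when both `θ` and `ψ` vanish at infinity. -/
lemma isCompactOperator_mulOp_mul_fourierMul (θ ψ : C₀(X, ℂ)) :
    IsCompactOperator (mulOp θ.toBCF * fourierMul ψ.toBCF : BL2 X) := by
  refine fourierMul_induction (p := fun T => IsCompactOperator (mulOp θ.toBCF * T : BL2 X))
    (fun T hT => ?_) (fun s => ?_) ψ
  · refine isCompactOperator_of_forall_near fun ε hε => ?_
    have hpos : 0 < ‖mulOp θ.toBCF‖ + 1 := by positivity
    obtain ⟨S, hS, hTS⟩ := hT (ε / (‖mulOp θ.toBCF‖ + 1)) (by positivity)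
    refine ⟨_, hS, ?_⟩
    rw [← mul_sub]
    calc _ ≤ (‖mulOp θ.toBCF‖ + 1) * (ε / (‖mulOp θ.toBCF‖ + 1)) :=
          (norm_mul_le _ _).trans (by gcongr; linarith)
      _ = ε := by field_simp
  · refine isCompactOperator_of_forall_near fun ε hε => ?_
    set C := ‖fourierMul (schwartzBCF s)‖
    have hpos : 0 < C + 1 := by positivity
    obtain ⟨n, hn⟩ := (tendsto_mulOp_mul_cutoff θ (ε := ε / (C + 1)) (by positivity)).exists
    refine ⟨mulOp θ.toBCF * (mulOp (cutoff X n).toBCF * fourierMul (schwartzBCF s)),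
      IsCompactOperator.mul_left' (isCompactOperator_cutoff_mul_fourierMul n s) _, ?_⟩
    rw [← mul_assoc, ← sub_mul, ← mulOp_mul θ.toBCF, mul_comm θ.toBCF, mulOp_mul]
    calc _ ≤ ε / (C + 1) * (C + 1) :=
          (norm_mul_le _ _).trans (by gcongr; simp only [C]; linarith)
      _ = ε := by field_simp

lemma isCompactOperator_fourierMul_mul_mulOp (θ ψ : C₀(X, ℂ)) :
    IsCompactOperator (fourierMul ψ.toBCF * mulOp θ.toBCF : BL2 X) := by
  have h := isCompactOperator_star (isCompactOperator_mulOp_mul_fourierMul (star θ) (star ψ))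
  have h1 : ∀ θ : C₀(X, ℂ), star (star θ).toBCF = θ.toBCF := fun θ => by
    ext x
    exact star_star (θ x)
  rwa [star_mul, star_mulOp, star_fourierMul, h1, h1] at h

/-- The cutoffs converge strongly to the identity. -/
lemma tendsto_mulOp_cutoff (f : L2 X) :
    Tendsto (fun n => mulOp (cutoff X n).toBCF f) atTop (𝓝 f) := by
  have hb : ∀ n, ‖mulOp (cutoff X n).toBCF‖ ≤ 1 := fun n =>
    (norm_mulOp_le _).trans
      ((BoundedContinuousFunction.norm_le zero_le_one).2 (norm_cutoff_apply_le n))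
  rw [Metric.tendsto_nhds]
  intro ε hε
  obtain ⟨g, hgs, hfg, -, hg⟩ := (Lp.memLp f).exists_hasCompactSupport_eLpNorm_sub_le
    (p := 2) ENNReal.ofNat_ne_top (ε := ENNReal.ofReal (ε / 3))
    (by simpa using (by positivity : 0 < ε / 3))
  have hfg' : ‖f - hg.toLp g‖ ≤ ε / 3 := by
    rw [← Lp.toLp_coeFn f (Lp.memLp f), ← MemLp.toLp_sub, Lp.norm_toLp]
    exact ENNReal.toReal_le_of_le_ofReal (by positivity) hfg
  obtain ⟨r, hr⟩ := hgs.isCompact.isBounded.exists_norm_le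
  filter_upwards [eventually_ge_atTop ⌈r⌉₊] with n hn
  have hrn : r ≤ n := (Nat.le_ceil r).trans (by exact_mod_cast hn)
  have h1 : mulOp (cutoff X n).toBCF (hg.toLp g) = hg.toLp g := by
    apply Lp.ext
    filter_upwards [coeFn_mulOp (cutoff X n).toBCF (hg.toLp g), hg.coeFn_toLp] with x h1 h2
    rw [h1, h2]
    change cutoff X n x * g x = g x
    by_cases hx : x ∈ tsupport g
    · rw [cutoff_eq_one ((hr x hx).trans (by linarith)), one_mul]
    · rw [image_eq_zero_of_notMem_tsupport hx, mul_zero]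
  have h2 : mulOp (cutoff X n).toBCF f - f =
      mulOp (cutoff X n).toBCF (f - hg.toLp g) - (f - hg.toLp g) := by
    rw [map_sub, h1]
    abel
  rw [dist_eq_norm, h2]
  have h3 := (mulOp (cutoff X n).toBCF).le_of_opNorm_le (hb n) (f - hg.toLp g)
  calc _ ≤ _ := norm_sub_le _ _
    _ < ε := by linarith

end CompactProducts

end QuantumGrassmann

namespace QuantumGrassmann

/-! ### Directions at infinity: subspaces, lines and ultrafilters -/

section Subspaces

variable {X : Type*} [NormedAddCommGroup X] [InnerProductSpace ℝ X] [FiniteDimensional ℝ X]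

/-- A filter base of subspaces, closed under intersection, has a least element. -/
lemma exists_least_submodule {good : Submodule ℝ X → Prop} (htop : good ⊤)
    (hmono : ∀ Z Z', Z ≤ Z' → good Z → good Z') (hinf : ∀ Z Z', good Z → good Z' → good (Z ⊓ Z')) :
    ∃ Z₀, ∀ Z, good Z ↔ Z₀ ≤ Z := by
  obtain ⟨Z₀, h0, hmin⟩ := (wellFounded_lt (α := Submodule ℝ X)).has_min {Z | good Z} ⟨⊤, htop⟩
  refine ⟨Z₀, fun Z => ⟨fun hZ => ?_, fun hZ => hmono _ _ hZ h0⟩⟩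
  by_contra hle
  exact hmin _ (hinf _ _ h0 hZ) (inf_lt_left.2 hle)

/-- A nonzero subspace contains a line avoiding countably many subspaces that do not contain it. -/
lemma exists_line_avoiding {𝒮 : Set (Submodule ℝ X)} (h𝒮 : 𝒮.Countable) {Z₀ : Submodule ℝ X}
    (hZ₀ : Z₀ ≠ ⊥) : ∃ Y : Lines X, Y.1 ≤ Z₀ ∧ ∀ Z ∈ 𝒮, Y.1 ≤ Z ↔ Z₀ ≤ Z := by
  let _ : MeasurableSpace Z₀ := borel Z₀
  have : BorelSpace Z₀ := ⟨rfl⟩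
  have : Nontrivial Z₀ := Submodule.nontrivial_iff_ne_bot.2 hZ₀
  -- Strict subspaces of Z₀ are Lebesgue null, hence so is the countable union to be avoided.
  have h1 : (volume : Measure Z₀)
      ({0} ∪ ⋃ Z ∈ {Z ∈ 𝒮 | ¬ Z₀ ≤ Z}, ((Z.comap Z₀.subtype : Submodule ℝ Z₀) : Set Z₀)) = 0 := by
    refine measure_union_null (measure_singleton _) ?_
    refine (measure_biUnion_null_iff (h𝒮.mono (Set.sep_subset _ _))).2 fun Z hZ => ?_
    exact Measure.addHaar_submodule _ _ fun htop =>
      hZ.2 (by simpa [Submodule.comap_subtype_eq_top] using htop)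
  obtain ⟨v, hv⟩ : ∃ v : Z₀, v ∉ ({0} ∪ ⋃ Z ∈ {Z ∈ 𝒮 | ¬ Z₀ ≤ Z},
      ((Z.comap Z₀.subtype : Submodule ℝ Z₀) : Set Z₀)) := by
    by_contra! hall
    rw [Set.eq_univ_of_forall hall] at h1
    exact (NeZero.ne (volume : Measure Z₀)) (Measure.measure_univ_eq_zero.1 h1)
  simp only [Set.mem_union, Set.mem_singleton_iff, Set.mem_iUnion, not_or, not_exists] at hv
  have hv0 : (v : X) ≠ 0 := fun h => hv.1 (by exact_mod_cast h)
  refine ⟨⟨Submodule.span ℝ {(v : X)}, finrank_span_singleton hv0⟩, ?_, fun Z hZ => ⟨fun h => ?_,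
    fun h => ?_⟩⟩
  · simp
  · by_contra hle
    exact hv.2 Z ⟨hZ, hle⟩ (by simpa using h)
  · simpa using h v.2

/-- The filter `𝔉` goes to infinity along `Z₀`, based at `x₀`: modulo `Z` it converges to `x₀` if
`Z₀ ≤ Z`, and goes to infinity otherwise. -/
def IsDirected (𝔉 : Filter X) (Z₀ : Submodule ℝ X) (x₀ : X) : Prop :=
  ∀ Z : Submodule ℝ X, (Z₀ ≤ Z → Tendsto Z.mkQ 𝔉 (𝓝 (Z.mkQ x₀))) ∧
    (¬ Z₀ ≤ Z → Tendsto Z.mkQ 𝔉 (cocompact (X ⧸ Z)))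

lemma t2Space_quotient (Z : Submodule ℝ X) : T2Space (X ⧸ Z) :=
  haveI : IsClosed (Z : Set X) := Z.closed_of_finiteDimensional
  inferInstance

/-- In each X/Z the image ultrafilter either converges or leaves every compact set. The Z with
convergence form an upward closed family stable under intersection, because X/(Z ∩ Z') sits as a
closed subspace in X/Z × X/Z'; by finite dimension the family has a least member. -/
lemma isDirected_of_ultrafilter {𝔘 : Ultrafilter X} (h𝔘 : (𝔘 : Filter X) ≤ cocompact X) :
    ∃ Z₀ ≠ ⊥, ∃ x₀, IsDirected (𝔘 : Filter X) Z₀ x₀ := by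
  have hT2 := t2Space_quotient (X := X)
  -- An injective linear map out of a finite dimensional space is a closed embedding, so limits can
  -- be pulled back along it.
  have hpull : ∀ {E : Type _} [AddCommGroup E] [TopologicalSpace E] [IsTopologicalAddGroup E]
      [Module ℝ E] [ContinuousSMul ℝ E] [T2Space E] (W : Submodule ℝ X)
      (f : (X ⧸ W) →ₗ[ℝ] E), f.ker = ⊥ → ∀ q : E,
      Tendsto (fun a => f (W.mkQ a)) 𝔘 (𝓝 q) →
      ∃ p : X, Tendsto W.mkQ 𝔘 (𝓝 (W.mkQ p)) := by
    intro E _ _ _ _ _ _ W f hf q hq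
    have hemb := LinearMap.isClosedEmbedding_of_injective hf
    obtain ⟨r, rfl⟩ : q ∈ Set.range f :=
      hemb.isClosed_range.mem_of_tendsto hq (Eventually.of_forall fun a => ⟨_, rfl⟩)
    obtain ⟨p, rfl⟩ := W.mkQ_surjective r
    exact ⟨p, hemb.tendsto_nhds_iff.2 hq⟩
  have hex : ∃ Z₀ : Submodule ℝ X, ∀ Z : Submodule ℝ X,
      (∃ p : X, Tendsto Z.mkQ 𝔘 (𝓝 (Z.mkQ p))) ↔ Z₀ ≤ Z := by
    refine exists_least_submodule ?_ ?_ ?_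
    · exact ⟨0, tendsto_const_nhds.congr fun a => Subsingleton.elim _ _⟩
    · rintro Z Z' h ⟨p, hp⟩
      have hc : Continuous (Submodule.factor h) := LinearMap.continuous_of_finiteDimensional _
      exact ⟨p, (hc.tendsto _).comp hp⟩
    · rintro Z Z' ⟨p, hp⟩ ⟨p', hp'⟩
      refine hpull (Z ⊓ Z') ((Submodule.factor inf_le_left).prod (Submodule.factor inf_le_right)) ?_
        (Z.mkQ p, Z'.mkQ p') (hp.prodMk_nhds hp')
      refine LinearMap.ker_eq_bot'.2 fun m hm => ?_
      obtain ⟨x, rfl⟩ := (Z ⊓ Z').mkQ_surjective m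
      have h1 : Z.mkQ x = 0 := congrArg Prod.fst hm
      have h2 : Z'.mkQ x = 0 := congrArg Prod.snd hm
      rw [Submodule.mkQ_apply, Submodule.Quotient.mk_eq_zero] at h1 h2 ⊢
      exact ⟨h1, h2⟩
  obtain ⟨Z₀, hZ₀⟩ := hex
  obtain ⟨x₀, hx₀⟩ := (hZ₀ Z₀).2 le_rfl
  refine ⟨Z₀, ?_, x₀, fun Z => ⟨fun h => ?_, fun h => ?_⟩⟩
  -- With Z₀ = 0 the ultrafilter would converge in X itself and contain a compact neighbourhood.
  · rintro rfl
    have hemb := LinearMap.isClosedEmbedding_of_injective (Submodule.ker_mkQ (⊥ : Submodule ℝ X))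
    have h1 : Tendsto (id : X → X) 𝔘 (𝓝 x₀) := hemb.tendsto_nhds_iff.2 hx₀
    have h2 : (𝔘 : Filter X) ≤ 𝓝 x₀ := h1
    obtain ⟨K, hK, hKx⟩ := exists_compact_mem_nhds x₀
    have h3 : K ∩ Kᶜ ∈ (𝔘 : Filter X) := inter_mem (h2 hKx) (h𝔘 hK.compl_mem_cocompact)
    rw [Set.inter_compl_self] at h3
    exact 𝔘.empty_notMem h3
  · have hc : Continuous (Submodule.factor h) := LinearMap.continuous_of_finiteDimensional _
    exact (hc.tendsto _).comp hx₀
  · by_contra hnt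
    apply h
    rw [← hZ₀]
    -- If the image does not go to infinity, some compact set belongs to the image ultrafilter,
    -- which therefore converges.
    rw [(hasBasis_cocompact).tendsto_right_iff] at hnt
    push Not at hnt
    obtain ⟨K, hK, hKn⟩ := hnt
    have hKm : K ∈ 𝔘.map Z.mkQ := by
      rw [Ultrafilter.mem_map]
      filter_upwards [hKn] with a ha
      exact not_not.1 ha
    obtain ⟨q, -, hq⟩ := hK.ultrafilter_le_nhds (𝔘.map Z.mkQ) (le_principal_iff.2 hKm)
    obtain ⟨p, rfl⟩ := Z.mkQ_surjective q
    exact ⟨p, hq⟩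

/-- The zero subspace is the only strict subspace of a line, so each L + Λ lies in the compact set
Λ. -/
lemma grassmannFilter_line (Y : Lines X) : grassmannFilter Y.1 = cocompact Y.1 := by
  have hY : (⊥ : Submodule ℝ Y.1) ≠ ⊤ := fun h => by
    have h1 := Y.2
    rw [← finrank_top, ← h, finrank_bot] at h1
    exact zero_ne_one h1
  refine le_antisymm (fun S hS => ?_) (le_generate_iff.2 ?_)
  · obtain ⟨K, hK, hKS⟩ := mem_cocompact.1 hS
    -- The family {⊥} is needed rather than ∅: the empty union plus K is empty and would remove
    -- nothing.
    refine mem_of_superset (mem_generate_of_mem ⟨{⊥}, Set.finite_singleton _, ?_, K, hK, rfl⟩) ?_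
    · simpa using hY.symm
    · simpa using hKS
  · rintro _ ⟨𝔽, -, h𝔽, Λ, hΛ, rfl⟩
    refine mem_of_superset hΛ.compl_mem_cocompact (Set.compl_subset_compl.2 ?_)
    rintro _ ⟨v, hv, l, hl, rfl⟩
    simp only [Set.mem_iUnion] at hv
    obtain ⟨W, hW, hvW⟩ := hv
    have hW0 : W = ⊥ := by
      have h1 : W ≠ ⊤ := fun h => h𝔽 (h ▸ hW)
      have h2 := Submodule.finrank_lt h1
      rw [Y.2] at h2
      exact Submodule.finrank_eq_zero.1 (by omega)
    rw [hW0, SetLike.mem_coe, Submodule.mem_bot] at hvW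
    simpa [hvW] using hl

instance grassmannFilterOf_neBot (Y : Lines X) : (grassmannFilterOf Y.1).NeBot := by
  have : Nontrivial Y.1 := Module.nontrivial_of_finrank_pos (R := ℝ) (by rw [Y.2]; exact one_pos)
  have : NoncompactSpace Y.1 := NormedSpace.noncompactSpace ℝ Y.1
  rw [grassmannFilterOf, grassmannFilter_line]
  infer_instance

lemma grassmannFilterOf_le_cocompact (Y : Lines X) : grassmannFilterOf Y.1 ≤ cocompact X := by
  have hemb : IsClosedEmbedding ((↑) : Y.1 → X) :=
    LinearMap.isClosedEmbedding_of_injective (f := Y.1.subtype) Y.1.ker_subtype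
  rw [grassmannFilterOf, grassmannFilter_line]
  exact hemb.tendsto_cocompact

/-- A line not contained in Z meets it only in 0, so Y → X/Z is a closed embedding and preserves
going to infinity; if Y ≤ Z the map is constantly 0. -/
lemma isDirected_grassmannFilterOf (Y : Lines X) :
    IsDirected (grassmannFilterOf Y.1) Y.1 0 := by
  have hT2 := t2Space_quotient (X := X)
  rw [grassmannFilterOf, grassmannFilter_line]
  refine fun Z => ⟨fun h => tendsto_map'_iff.2 ?_, fun h => tendsto_map'_iff.2 ?_⟩
  · refine tendsto_const_nhds.congr fun a => ?_
    rw [map_zero, Function.comp_apply, eq_comm, Submodule.mkQ_apply,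
      Submodule.Quotient.mk_eq_zero]
    exact h a.2
  · have hker : (Z.mkQ ∘ₗ Y.1.subtype).ker = ⊥ := by
      rw [LinearMap.ker_comp, Submodule.ker_mkQ]
      by_contra hne
      apply h
      have h1 : Module.finrank ℝ (Z.comap Y.1.subtype) ≠ 0 := fun h0 =>
        hne (Submodule.finrank_eq_zero.1 h0)
      have h2 : Z.comap Y.1.subtype = ⊤ :=
        Submodule.eq_top_of_finrank_eq
          (le_antisymm (Submodule.finrank_le _) (by rw [Y.2]; omega))
      simpa [Submodule.comap_subtype_eq_top] using h2
    exact (LinearMap.isClosedEmbedding_of_injective hker).tendsto_cocompact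

end Subspaces

end QuantumGrassmann

namespace QuantumGrassmann

/-! ### Calculus of local limits of translated operators -/

section LocalLimits

variable {X : Type*} [NormedAddCommGroup X] [InnerProductSpace ℝ X] [FiniteDimensional ℝ X]
  [MeasurableSpace X] [BorelSpace X]

/-- `S = lim_{y → 𝔉} U_y T U_y⋆` in the local topology given by the seminorms
`‖A θ(Q)‖ + ‖θ(Q) A‖`. -/
def LocalLimit (𝔉 : Filter X) (T S : BL2 X) : Prop :=
  ∀ θ : C₀(X, ℂ), Tendsto
    (fun y : X => ‖(conjTranslation y T - S) * mulOp θ.toBCF‖ +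
      ‖mulOp θ.toBCF * (conjTranslation y T - S)‖) 𝔉 (𝓝 0)

lemma localLimit_iff {𝔉 : Filter X} {T S : BL2 X} : LocalLimit 𝔉 T S ↔ ∀ θ : C₀(X, ℂ),
    Tendsto (fun y => (conjTranslation y T - S) * mulOp θ.toBCF) 𝔉 (𝓝 0) ∧
      Tendsto (fun y => mulOp θ.toBCF * (conjTranslation y T - S)) 𝔉 (𝓝 0) := by
  refine forall_congr' fun θ => ⟨fun h => ⟨?_, ?_⟩, fun h => ?_⟩
  · exact squeeze_zero_norm (fun y => le_add_of_nonneg_right (norm_nonneg _)) h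
  · exact squeeze_zero_norm (fun y => le_add_of_nonneg_left (norm_nonneg _)) h
  · simpa using h.1.norm.add h.2.norm

namespace LocalLimit

variable {𝔉 : Filter X} {T T' S S' : BL2 X}

lemma add (h : LocalLimit 𝔉 T S) (h' : LocalLimit 𝔉 T' S') : LocalLimit 𝔉 (T + T') (S + S') := by
  rw [localLimit_iff] at h h' ⊢
  refine fun θ => ⟨?_, ?_⟩
  · simpa [conjTranslation_add, add_sub_add_comm, add_mul] using (h θ).1.add (h' θ).1
  · simpa [conjTranslation_add, add_sub_add_comm, mul_add] using (h θ).2.add (h' θ).2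

lemma smul (c : ℂ) (h : LocalLimit 𝔉 T S) : LocalLimit 𝔉 (c • T) (c • S) := by
  rw [localLimit_iff] at h ⊢
  refine fun θ => ⟨?_, ?_⟩
  · simpa [conjTranslation_smul, ← smul_sub] using (h θ).1.const_smul c
  · simpa [conjTranslation_smul, ← smul_sub] using (h θ).2.const_smul c

lemma star (h : LocalLimit 𝔉 T S) : LocalLimit 𝔉 (star T) (star S) := by
  rw [localLimit_iff] at h ⊢
  refine fun θ => ⟨?_, ?_⟩
  · have h1 := ((h (Star.star θ)).2).star
    simp only [star_mul, star_sub, star_conjTranslation, star_mulOp, star_zero] at h1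
    have h2 : Star.star (Star.star θ).toBCF = θ.toBCF := by ext x; exact star_star (θ x)
    rwa [h2] at h1
  · have h1 := ((h (Star.star θ)).1).star
    simp only [star_mul, star_sub, star_conjTranslation, star_mulOp, star_zero] at h1
    have h2 : Star.star (Star.star θ).toBCF = θ.toBCF := by ext x; exact star_star (θ x)
    rwa [h2] at h1

lemma of_tendsto (h : Tendsto (fun y => conjTranslation y T) 𝔉 (𝓝 S)) : LocalLimit 𝔉 T S := by
  rw [localLimit_iff]
  have h1 : Tendsto (fun y => conjTranslation y T - S) 𝔉 (𝓝 0) := by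
    simpa using h.sub_const S
  refine fun θ => ⟨?_, ?_⟩
  · simpa using h1.mul_const (mulOp θ.toBCF)
  · simpa using h1.const_mul (mulOp θ.toBCF)

/-- Conjugation by translations is norm decreasing, so the approximation error is uniform in y. -/
lemma of_near (h : ∀ ε > 0, ∃ T' S' : BL2 X, LocalLimit 𝔉 T' S' ∧ ‖T - T'‖ ≤ ε ∧ ‖S - S'‖ ≤ ε) :
    LocalLimit 𝔉 T S := by
  have key : ∀ (R : BL2 X) (ε : ℝ), 0 < ε → ∃ T' S' : BL2 X, LocalLimit 𝔉 T' S' ∧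
      ∀ y, ‖(conjTranslation y T - S) - (conjTranslation y T' - S')‖ * ‖R‖ ≤ ε := by
    intro R ε hε
    have hR : 0 < ‖R‖ + 1 := by positivity
    obtain ⟨T', S', h1, h2, h3⟩ := h (ε / 2 / (‖R‖ + 1)) (by positivity)
    refine ⟨T', S', h1, fun y => ?_⟩
    have h4 : ‖(conjTranslation y T - S) - (conjTranslation y T' - S')‖ ≤ ε / (‖R‖ + 1) := by
      rw [sub_sub_sub_comm, ← conjTranslation_sub]
      refine (norm_sub_le _ _).trans ?_
      calc _ ≤ ε / 2 / (‖R‖ + 1) + ε / 2 / (‖R‖ + 1) :=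
            add_le_add ((norm_conjTranslation_le _ _).trans h2) h3
        _ = _ := by ring
    calc _ ≤ ε / (‖R‖ + 1) * (‖R‖ + 1) := by gcongr; linarith
      _ = ε := by field_simp
  rw [localLimit_iff]
  refine fun θ => ⟨?_, ?_⟩
  · rw [Metric.tendsto_nhds]
    intro ε hε
    obtain ⟨T', S', h1, h2⟩ := key (mulOp θ.toBCF) (ε / 2) (half_pos hε)
    filter_upwards [Metric.tendsto_nhds.1 ((localLimit_iff.1 h1 θ).1) (ε / 2) (half_pos hε)] with y hy
    rw [dist_zero_right] at hy ⊢
    have h3 := (norm_mul_le _ _).trans (h2 y)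
    rw [sub_mul] at h3
    linarith [norm_le_norm_add_norm_sub' ((conjTranslation y T - S) * mulOp θ.toBCF)
      ((conjTranslation y T' - S') * mulOp θ.toBCF)]
  · rw [Metric.tendsto_nhds]
    intro ε hε
    obtain ⟨T', S', h1, h2⟩ := key (mulOp θ.toBCF) (ε / 2) (half_pos hε)
    filter_upwards [Metric.tendsto_nhds.1 ((localLimit_iff.1 h1 θ).2) (ε / 2) (half_pos hε)] with y hy
    rw [dist_zero_right] at hy ⊢
    have h3 := (norm_mul_le _ _).trans ((mul_comm _ _).le.trans (h2 y))
    rw [mul_sub] at h3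
    linarith [norm_le_norm_add_norm_sub' (mulOp θ.toBCF * (conjTranslation y T - S))
      (mulOp θ.toBCF * (conjTranslation y T' - S'))]

/-- The translates are uniformly bounded and cutoff(Q)f approximates f, so local convergence implies
strong convergence. Uniqueness, norm bounds and multiplicativity of limits follow from this. -/
lemma tendsto_apply (h : LocalLimit 𝔉 T S) (f : L2 X) :
    Tendsto (fun y => conjTranslation y T f) 𝔉 (𝓝 (S f)) := by
  rw [Metric.tendsto_nhds]
  intro ε hε
  set C := ‖T‖ + ‖S‖ + 1
  have hC : 0 < C := by positivity
  obtain ⟨n, hn⟩ := ((Metric.tendsto_nhds.1 (tendsto_mulOp_cutoff f)) (ε / 2 / C)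
    (by positivity)).exists
  have h1 : Tendsto (fun y => ((conjTranslation y T - S) * mulOp (cutoff X n).toBCF) f) 𝔉 (𝓝 0) := by
    have h0 := (localLimit_iff.1 h (cutoff X n)).1
    refine squeeze_zero_norm (fun y => ContinuousLinearMap.le_opNorm _ f) ?_
    simpa using h0.norm.mul_const ‖f‖
  filter_upwards [Metric.tendsto_nhds.1 h1 (ε / 2) (half_pos hε)] with y hy
  rw [dist_zero_right] at hy
  rw [dist_eq_norm, norm_sub_rev] at hn
  rw [dist_eq_norm]
  have h2 : conjTranslation y T f - S f =
      ((conjTranslation y T - S) * mulOp (cutoff X n).toBCF) f +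
        (conjTranslation y T - S) (f - mulOp (cutoff X n).toBCF f) := by
    simp
    abel
  rw [h2]
  have h3 : ‖(conjTranslation y T - S) (f - mulOp (cutoff X n).toBCF f)‖ ≤ C * (ε / 2 / C) := by
    refine (ContinuousLinearMap.le_opNorm _ _).trans ?_
    gcongr
    calc _ ≤ ‖conjTranslation y T‖ + ‖S‖ := norm_sub_le _ _
      _ ≤ C := by simp only [C]; linarith [norm_conjTranslation_le y T]
  have h4 : C * (ε / 2 / C) = ε / 2 := by field_simp
  calc _ ≤ _ := norm_add_le _ _
    _ < ε := by linarith

lemma unique [𝔉.NeBot] (h : LocalLimit 𝔉 T S) (h' : LocalLimit 𝔉 T S') : S = S' :=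
  ContinuousLinearMap.ext fun f => tendsto_nhds_unique (h.tendsto_apply f) (h'.tendsto_apply f)

lemma norm_le [𝔉.NeBot] (h : LocalLimit 𝔉 T S) : ‖S‖ ≤ ‖T‖ := by
  refine ContinuousLinearMap.opNorm_le_bound _ (norm_nonneg _) fun f => ?_
  refine le_of_tendsto (h.tendsto_apply f).norm (Eventually.of_forall fun y => ?_)
  exact (conjTranslation y T).le_of_opNorm_le (norm_conjTranslation_le y T) f

lemma sub (h : LocalLimit 𝔉 T S) (h' : LocalLimit 𝔉 T' S') : LocalLimit 𝔉 (T - T') (S - S') := by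
  simpa [sub_eq_add_neg] using h.add (h'.smul (-1))

lemma zero : LocalLimit 𝔉 (0 : BL2 X) 0 := by
  refine of_tendsto (tendsto_const_nhds.congr fun y => ?_)
  simp [conjTranslation]

/-- The set of operators having a local limit in a closed set is closed. -/
lemma exists_of_near [𝔉.NeBot] {V : Set (BL2 X)} (hV : IsClosed V)
    (h : ∀ ε > 0, ∃ T', (∃ S' ∈ V, LocalLimit 𝔉 T' S') ∧ ‖T - T'‖ ≤ ε) :
    ∃ S ∈ V, LocalLimit 𝔉 T S := by
  have h' : ∀ n : ℕ, ∃ T' S', S' ∈ V ∧ LocalLimit 𝔉 T' S' ∧ ‖T - T'‖ ≤ 1 / ((n : ℝ) + 1) := by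
    intro n
    obtain ⟨T', ⟨S', hS, hL⟩, hT⟩ := h (1 / ((n : ℝ) + 1)) (by positivity)
    exact ⟨T', S', hS, hL, hT⟩
  choose Tn Sn hSV hL hT using h'
  have hTn : Tendsto Tn atTop (𝓝 T) := by
    rw [tendsto_iff_norm_sub_tendsto_zero]
    refine squeeze_zero (fun n => norm_nonneg _) (fun n => ?_) tendsto_one_div_add_atTop_nhds_zero_nat
    rw [norm_sub_rev]
    exact hT n
  -- Passing to local limits is norm decreasing along a proper filter, so the limits inherit the
  -- Cauchy property.
  have hS : CauchySeq Sn := by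
    have := hTn.cauchySeq
    rw [Metric.cauchySeq_iff] at this ⊢
    intro ε hε
    obtain ⟨N, hN⟩ := this ε hε
    refine ⟨N, fun m hm n hn => lt_of_le_of_lt ?_ (hN m hm n hn)⟩
    rw [dist_eq_norm, dist_eq_norm]
    exact ((hL m).sub (hL n)).norm_le
  obtain ⟨S, hS⟩ := cauchySeq_tendsto_of_complete hS
  refine ⟨S, hV.mem_of_tendsto hS (Eventually.of_forall hSV), of_near fun ε hε => ?_⟩
  obtain ⟨n, hn1, hn2⟩ := ((Metric.tendsto_nhds.1 hTn ε hε).and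
    (Metric.tendsto_nhds.1 hS ε hε)).exists
  refine ⟨Tn n, Sn n, hL n, ?_, ?_⟩
  · rw [← dist_eq_norm, dist_comm]; exact hn1.le
  · rw [← dist_eq_norm, dist_comm]; exact hn2.le

end LocalLimit

end LocalLimits

/-! ### Limits of the generators φ(Q)ψ(P) -/

section GeneratorLimits

variable {X : Type*} [NormedAddCommGroup X] [InnerProductSpace ℝ X] [FiniteDimensional ℝ X]
  [MeasurableSpace X] [BorelSpace X]

lemma pullback_apply (Z : Submodule ℝ X) (φ : C₀(X ⧸ Z, ℂ)) (x : X) :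
    pullback Z φ x = φ (Z.mkQ x) := rfl

lemma conjTranslation_mulOp_mul_fourierMul (a : X) (φ ψ : X →ᵇ ℂ) :
    conjTranslation a (mulOp φ * fourierMul ψ) = mulOp (shift a φ) * fourierMul ψ := by
  rw [conjTranslation_mul, conjTranslation_mulOp, conjTranslation_fourierMul]

/-- The shifted symbol depends only on the shift modulo Z, which converges, and φ is uniformly
continuous; convergence is therefore even in norm. -/
lemma localLimit_of_le {𝔉 : Filter X} {Z₀ Z : Submodule ℝ X} {x₀ : X} (h : IsDirected 𝔉 Z₀ x₀)
    (hZ : Z₀ ≤ Z) (φ : C₀(X ⧸ Z, ℂ)) (ψ : X →ᵇ ℂ) :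
    LocalLimit 𝔉 (mulOp (pullback Z φ) * fourierMul ψ)
      (conjTranslation x₀ (mulOp (pullback Z φ) * fourierMul ψ)) := by
  refine LocalLimit.of_tendsto ?_
  simp only [conjTranslation_mulOp_mul_fourierMul]
  refine Tendsto.mul_const _ ?_
  refine (mulOpL.continuous.tendsto _).comp ?_
  have h1 := (h Z).1 hZ
  rw [BoundedContinuousFunction.tendsto_iff_tendstoUniformly, Metric.tendstoUniformly_iff]
  intro ε hε
  obtain ⟨δ, hδ, hu⟩ := Metric.uniformContinuous_iff.1
    (ZeroAtInftyContinuousMap.uniformContinuous φ) ε hε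
  filter_upwards [Metric.tendsto_nhds.1 h1 δ hδ] with a ha x
  rw [shift_apply, shift_apply, pullback_apply, pullback_apply, map_add Z.mkQ, map_add Z.mkQ]
  apply hu
  rwa [dist_add_right, dist_comm]

/-- If φ is small outside a compact L, then a + K avoids L modulo Z once a modulo Z leaves the
compact difference of L and the image of K. -/
lemma eventually_shift_pullback_small {𝔉 : Filter X} {Z : Submodule ℝ X}
    (h : Tendsto Z.mkQ 𝔉 (cocompact (X ⧸ Z))) (φ : C₀(X ⧸ Z, ℂ)) {K : Set X} (hK : IsCompact K)
    {ε : ℝ} (hε : 0 < ε) : ∀ᶠ a in 𝔉, ∀ x ∈ K, ‖shift a (pullback Z φ) x‖ ≤ ε := by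
  have h1 := φ.zero_at_infty'.eventually (Metric.ball_mem_nhds 0 hε)
  obtain ⟨L, hL, hLφ⟩ := mem_cocompact.1 h1
  have hc : Continuous Z.mkQ := continuous_quot_mk
  have hKL : IsCompact ((fun p : (X ⧸ Z) × (X ⧸ Z) => p.1 - p.2) '' (L ×ˢ (Z.mkQ '' K))) :=
    (hL.prod (hK.image hc)).image continuous_sub
  filter_upwards [h hKL.compl_mem_cocompact] with a ha x hx
  rw [shift_apply, pullback_apply, map_add Z.mkQ]
  have h2 : Z.mkQ a + Z.mkQ x ∈ Lᶜ := fun hmem =>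
    ha ⟨(Z.mkQ a + Z.mkQ x, Z.mkQ x), ⟨hmem, Set.mem_image_of_mem _ hx⟩, by simp⟩
  have h3 := hLφ h2
  simpa using (show dist (φ (Z.mkQ a + Z.mkQ x)) 0 < ε from h3).le

lemma tendsto_mulOp_shift_mul_cutoff {𝔉 : Filter X} {Z : Submodule ℝ X}
    (h : Tendsto Z.mkQ 𝔉 (cocompact (X ⧸ Z))) (φ : C₀(X ⧸ Z, ℂ)) (n : ℕ) :
    Tendsto (fun a => mulOp (shift a (pullback Z φ)) * mulOp (cutoff X n).toBCF) 𝔉 (𝓝 0) := by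
  rw [Metric.tendsto_nhds]
  intro ε hε
  filter_upwards [eventually_shift_pullback_small h φ (hasCompactSupport_cutoff n).isCompact
    (half_pos hε)] with a ha
  rw [dist_zero_right, ← mulOp_mul]
  refine lt_of_le_of_lt ((norm_mulOp_le _).trans
    ((BoundedContinuousFunction.norm_le (half_pos hε).le).2 fun x => ?_)) (half_lt_self hε)
  rw [BoundedContinuousFunction.mul_apply, norm_mul]
  by_cases hx : x ∈ tsupport (cutoff X n)
  · calc _ ≤ ε / 2 * 1 := mul_le_mul (ha x hx) (norm_cutoff_apply_le n x) (norm_nonneg _) (by positivity)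
      _ = ε / 2 := mul_one _
  · have : (cutoff X n).toBCF x = 0 := image_eq_zero_of_notMem_tsupport hx
    rw [this, norm_zero, mul_zero]
    positivity

lemma norm_shift_le (a : X) (φ : X →ᵇ ℂ) : ‖shift a φ‖ ≤ ‖φ‖ :=
  (BoundedContinuousFunction.norm_le (norm_nonneg _)).2 fun _ => φ.norm_coe_le_norm _

/-- If `R` is approximated by `cutoff(Q) R`, then `φ(Q + a) R → 0`. -/
lemma tendsto_mulOp_shift_mul {𝔉 : Filter X} {Z : Submodule ℝ X}
    (h : Tendsto Z.mkQ 𝔉 (cocompact (X ⧸ Z))) (φ : C₀(X ⧸ Z, ℂ)) {R : BL2 X}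
    (hR : ∀ ε > 0, ∃ n, ‖R - mulOp (cutoff X n).toBCF * R‖ ≤ ε) :
    Tendsto (fun a => mulOp (shift a (pullback Z φ)) * R) 𝔉 (𝓝 0) := by
  rw [Metric.tendsto_nhds]
  intro ε hε
  set C := ‖pullback Z φ‖ + 1
  have hC : 0 < C := by positivity
  obtain ⟨n, hn⟩ := hR (ε / 2 / C) (by positivity)
  have h1 : Tendsto (fun a => mulOp (shift a (pullback Z φ)) * mulOp (cutoff X n).toBCF * R) 𝔉
      (𝓝 0) := by simpa using (tendsto_mulOp_shift_mul_cutoff h φ n).mul_const R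
  filter_upwards [Metric.tendsto_nhds.1 h1 (ε / 2) (half_pos hε)] with a ha
  rw [dist_zero_right] at ha ⊢
  have h2 : mulOp (shift a (pullback Z φ)) * R =
      mulOp (shift a (pullback Z φ)) * mulOp (cutoff X n).toBCF * R +
        mulOp (shift a (pullback Z φ)) * (R - mulOp (cutoff X n).toBCF * R) := by noncomm_ring
  have h3 : ‖mulOp (shift a (pullback Z φ)) * (R - mulOp (cutoff X n).toBCF * R)‖ ≤
      C * (ε / 2 / C) := by
    refine (norm_mul_le _ _).trans ?_
    gcongr
    exact (norm_mulOp_le _).trans ((norm_shift_le _ _).trans (by simp only [C]; linarith))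
  have h4 : C * (ε / 2 / C) = ε / 2 := by field_simp
  rw [h2]
  calc _ ≤ _ := norm_add_le _ _
    _ < ε := by linarith

lemma exists_norm_sub_cutoff_mul_le {K : BL2 X} (hK : IsCompactOperator K) {ε : ℝ} (hε : 0 < ε) :
    ∃ n, ‖K - mulOp (cutoff X n).toBCF * K‖ ≤ ε := by
  have h1 : ∀ n, ‖mulOp (cutoff X n).toBCF - 1‖ ≤ 1 := fun n => by
    rw [← mulOp_one, ← mulOp_sub]
    refine (norm_mulOp_le _).trans ((BoundedContinuousFunction.norm_le zero_le_one).2 fun x => ?_)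
    change ‖cutoff X n x - 1‖ ≤ 1
    rw [norm_sub_rev]
    exact norm_one_sub_cutoff_apply_le n x
  have h2 : ∀ g : L2 X, Tendsto (fun n => (mulOp (cutoff X n).toBCF - 1) g) atTop (𝓝 0) :=
    fun g => by simpa using (tendsto_mulOp_cutoff g).sub_const g
  obtain ⟨n, hn⟩ := ((tendsto_norm_mul_of_isCompactOperator h1 h2 hK).eventually
    (Iio_mem_nhds hε)).exists
  refine ⟨n, ?_⟩
  rw [norm_sub_rev, ← sub_one_mul]
  exact (Set.mem_Iio.1 hn).le

/-- Only φ moves, and it becomes small on each compact set. With θ(Q) on the left, θ and φ commute.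
With θ(Q) on the right, ψ(P)θ(Q) is compact and hence well approximated after a cutoff; here ψ must
vanish at infinity. -/
lemma localLimit_of_not_le {𝔉 : Filter X} {Z₀ Z : Submodule ℝ X} {x₀ : X}
    (h : IsDirected 𝔉 Z₀ x₀) (hZ : ¬ Z₀ ≤ Z) (φ : C₀(X ⧸ Z, ℂ)) (ψ : C₀(X, ℂ)) :
    LocalLimit 𝔉 (mulOp (pullback Z φ) * fourierMul ψ.toBCF) 0 := by
  rw [localLimit_iff]
  simp only [conjTranslation_mulOp_mul_fourierMul, sub_zero]
  refine fun θ => ⟨?_, ?_⟩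
  · simp only [mul_assoc]
    exact tendsto_mulOp_shift_mul ((h Z).2 hZ) φ fun ε hε =>
      exists_norm_sub_cutoff_mul_le (isCompactOperator_fourierMul_mul_mulOp θ ψ) hε
  · have h1 := (tendsto_mulOp_shift_mul ((h Z).2 hZ) φ (R := mulOp θ.toBCF) fun ε hε =>
      (tendsto_mulOp_mul_cutoff θ hε).exists).mul_const (fourierMul ψ.toBCF)
    rw [zero_mul] at h1
    refine h1.congr fun a => ?_
    rw [← mulOp_mul, mul_comm, mulOp_mul, mul_assoc]

end GeneratorLimits

end QuantumGrassmann

namespace QuantumGrassmann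

/-! ### Generators of the algebra and countability of the subspaces involved -/

section ClosedSpans

lemma closure_span_induction {E : Type*} [NormedAddCommGroup E] [NormedSpace ℂ E] {s : Set E}
    {P : E → Prop} (hs : ∀ x ∈ s, P x) (h0 : P 0) (hadd : ∀ x y, P x → P y → P (x + y))
    (hsmul : ∀ (c : ℂ) x, P x → P (c • x))
    (hcl : ∀ x, (∀ ε > 0, ∃ y, P y ∧ ‖x - y‖ ≤ ε) → P x) :
    ∀ x ∈ (Submodule.span ℂ s).topologicalClosure, P x := by
  intro x hx
  refine hcl x fun ε hε => ?_
  obtain ⟨y, hy, hxy⟩ := Metric.mem_closure_iff.1 hx ε hε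
  refine ⟨y, ?_, by rw [← dist_eq_norm]; exact hxy.le⟩
  exact Submodule.span_induction (p := fun x _ => P x) (fun x hx => hs x hx) h0
    (fun x y _ _ => hadd x y) (fun c x _ => hsmul c x) hy

end ClosedSpans

section Generators

variable {X : Type*} [NormedAddCommGroup X] [InnerProductSpace ℝ X] [FiniteDimensional ℝ X]
  [MeasurableSpace X] [BorelSpace X]

/-- The operators `φ(Q) ψ(P)` with `φ ∈ C₀(X/Z)`, `Z ∈ 𝒮`, and `ψ ∈ C₀(X*)`. -/
def generators (𝒮 : Set (Submodule ℝ X)) : Set (BL2 X) :=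
  {T | ∃ Z ∈ 𝒮, ∃ (φ : C₀(X ⧸ Z, ℂ)) (ψ : C₀(X, ℂ)),
    T = mulOp (pullback Z φ) * fourierMul ψ.toBCF}

lemma generators_mono {𝒮 𝒮' : Set (Submodule ℝ X)} (h : 𝒮 ⊆ 𝒮') : generators 𝒮 ⊆ generators 𝒮' := by
  rintro _ ⟨Z, hZ, φ, ψ, rfl⟩
  exact ⟨Z, h hZ, φ, ψ, rfl⟩

/-- The norm closed span of `generators 𝒮`. -/
noncomputable def partialGrassmann (𝒮 : Set (Submodule ℝ X)) : Submodule ℂ (BL2 X) :=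
  (Submodule.span ℂ (generators 𝒮)).topologicalClosure

lemma partialGrassmann_mono {𝒮 𝒮' : Set (Submodule ℝ X)} (h : 𝒮 ⊆ 𝒮') :
    partialGrassmann 𝒮 ≤ partialGrassmann 𝒮' :=
  Submodule.topologicalClosure_mono (Submodule.span_mono (generators_mono h))

lemma isClosed_partialGrassmann (𝒮 : Set (Submodule ℝ X)) :
    IsClosed (partialGrassmann 𝒮 : Set (BL2 X)) :=
  Submodule.isClosed_topologicalClosure _

lemma isClosed_quantumGrassmann : IsClosed (quantumGrassmann X : Set (BL2 X)) :=
  Submodule.isClosed_topologicalClosure _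

lemma partialGrassmann_le (𝒮 : Set (Submodule ℝ X)) :
    partialGrassmann 𝒮 ≤ quantumGrassmann X := by
  refine Submodule.topologicalClosure_mono (Submodule.span_mono ?_)
  rintro _ ⟨Z, -, φ, ψ, rfl⟩
  refine ⟨pullback Z φ, ?_, ψ, rfl⟩
  exact Submodule.le_topologicalClosure _ (Submodule.mem_iSup_of_mem Z ⟨φ, rfl⟩)

lemma mem_partialGrassmann {𝒮 : Set (Submodule ℝ X)} {T : BL2 X} (h : T ∈ generators 𝒮) :
    T ∈ partialGrassmann 𝒮 :=
  Submodule.le_topologicalClosure _ (Submodule.subset_span h)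

lemma mem_of_forall_near {V : Submodule ℂ (BL2 X)} (hV : IsClosed (V : Set (BL2 X))) {T : BL2 X}
    (h : ∀ ε > 0, ∃ S ∈ V, ‖T - S‖ ≤ ε) : T ∈ V := by
  refine hV.closure_subset (Metric.mem_closure_iff.2 fun ε hε => ?_)
  obtain ⟨S, hS, hTS⟩ := h (ε / 2) (half_pos hε)
  exact ⟨S, hS, by rw [dist_eq_norm]; linarith⟩

/-- A finite sum involves finitely many subspaces, and φ is the limit of a sequence of such sums.
The family is chosen before ψ, so one family serves every ψ. -/
lemma exists_countable_of_classicalGrassmann {φ : X →ᵇ ℂ} (hφ : φ ∈ classicalGrassmann X) :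
    ∃ 𝒮 : Set (Submodule ℝ X), 𝒮.Countable ∧
      ∀ ψ : C₀(X, ℂ), mulOp φ * fourierMul ψ.toBCF ∈ partialGrassmann 𝒮 := by
  have h1 : ∀ φ ∈ (⨆ Z : Submodule ℝ X, C0Quotient Z), ∃ 𝒮 : Set (Submodule ℝ X), 𝒮.Countable ∧
      ∀ ψ : C₀(X, ℂ), mulOp φ * fourierMul ψ.toBCF ∈ partialGrassmann 𝒮 := by
    intro φ hφ
    refine Submodule.iSup_induction _ (motive := fun φ => ∃ 𝒮 : Set (Submodule ℝ X), 𝒮.Countable ∧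
      ∀ ψ : C₀(X, ℂ), mulOp φ * fourierMul ψ.toBCF ∈ partialGrassmann 𝒮) hφ ?_ ?_ ?_
    · rintro Z _ ⟨φ, rfl⟩
      exact ⟨{Z}, Set.countable_singleton _, fun ψ => mem_partialGrassmann ⟨Z, rfl, φ, ψ, rfl⟩⟩
    · exact ⟨∅, Set.countable_empty, fun ψ => by
        rw [mulOp_zero, zero_mul]
        exact zero_mem _⟩
    · rintro φ φ' ⟨𝒮, hc, h⟩ ⟨𝒮', hc', h'⟩
      refine ⟨𝒮 ∪ 𝒮', hc.union hc', fun ψ => ?_⟩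
      rw [mulOp_add, add_mul]
      exact add_mem (partialGrassmann_mono Set.subset_union_left (h ψ))
        (partialGrassmann_mono Set.subset_union_right (h' ψ))
  have h2 : ∀ n : ℕ, ∃ φ' : X →ᵇ ℂ, ‖φ - φ'‖ < 1 / ((n : ℝ) + 1) ∧
      ∃ 𝒮 : Set (Submodule ℝ X), 𝒮.Countable ∧
      ∀ ψ : C₀(X, ℂ), mulOp φ' * fourierMul ψ.toBCF ∈ partialGrassmann 𝒮 := fun n => by
    obtain ⟨φ', hφ', hd⟩ := Metric.mem_closure_iff.1 hφ (1 / ((n : ℝ) + 1)) (by positivity)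
    exact ⟨φ', by rwa [← dist_eq_norm], h1 φ' hφ'⟩
  choose φn hφn 𝒮 hc h𝒮 using h2
  refine ⟨⋃ n, 𝒮 n, Set.countable_iUnion hc, fun ψ => ?_⟩
  refine mem_of_forall_near (isClosed_partialGrassmann _) fun ε hε => ?_
  have hpos : 0 < ‖fourierMul ψ.toBCF‖ + 1 := by positivity
  obtain ⟨n, hn⟩ := exists_nat_one_div_lt (show 0 < ε / (‖fourierMul ψ.toBCF‖ + 1) by positivity)
  refine ⟨_, partialGrassmann_mono (Set.subset_iUnion 𝒮 n) (h𝒮 n ψ), ?_⟩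
  rw [← sub_mul, ← mulOp_sub]
  calc _ ≤ ‖φ - φn n‖ * ‖fourierMul ψ.toBCF‖ :=
        (norm_mul_le _ _).trans (by gcongr; exact norm_mulOp_le _)
    _ ≤ ε / (‖fourierMul ψ.toBCF‖ + 1) * (‖fourierMul ψ.toBCF‖ + 1) := by
        gcongr
        · exact ((hφn n).trans hn).le
        · linarith
    _ = ε := by field_simp

/-- Every element of the quantum Grassmann algebra involves only countably many subspaces. -/
lemma exists_countable_of_quantumGrassmann {T : BL2 X} (hT : T ∈ quantumGrassmann X) :
    ∃ 𝒮 : Set (Submodule ℝ X), 𝒮.Countable ∧ T ∈ partialGrassmann 𝒮 := by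
  refine closure_span_induction (P := fun T => ∃ 𝒮 : Set (Submodule ℝ X), 𝒮.Countable ∧
    T ∈ partialGrassmann 𝒮) ?_ ?_ ?_ ?_ ?_ T hT
  · rintro _ ⟨φ, hφ, ψ, rfl⟩
    obtain ⟨𝒮, hc, h⟩ := exists_countable_of_classicalGrassmann hφ
    exact ⟨𝒮, hc, h ψ⟩
  · exact ⟨∅, Set.countable_empty, zero_mem _⟩
  · rintro S S' ⟨𝒮, hc, h⟩ ⟨𝒮', hc', h'⟩
    exact ⟨𝒮 ∪ 𝒮', hc.union hc', add_mem (partialGrassmann_mono Set.subset_union_left h)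
        (partialGrassmann_mono Set.subset_union_right h')⟩
  · rintro c S ⟨𝒮, hc, h⟩
    exact ⟨𝒮, hc, Submodule.smul_mem _ c h⟩
  · intro S h
    have h2 : ∀ n : ℕ, ∃ S' : BL2 X, ∃ 𝒮 : Set (Submodule ℝ X), 𝒮.Countable ∧
        S' ∈ partialGrassmann 𝒮 ∧ ‖S - S'‖ ≤ 1 / ((n : ℝ) + 1) := fun n => by
      obtain ⟨S', ⟨𝒮, hc, h𝒮⟩, hS⟩ := h (1 / ((n : ℝ) + 1)) (by positivity)
      exact ⟨S', 𝒮, hc, h𝒮, hS⟩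
    choose Sn 𝒮 hc h𝒮 hS using h2
    refine ⟨⋃ n, 𝒮 n, Set.countable_iUnion hc, ?_⟩
    refine mem_of_forall_near (isClosed_partialGrassmann _) fun ε hε => ?_
    obtain ⟨n, hn⟩ := exists_nat_one_div_lt hε
    exact ⟨Sn n, partialGrassmann_mono (Set.subset_iUnion 𝒮 n) (h𝒮 n), (hS n).trans hn.le⟩

/-- This permits induction over generators whose symbol is pulled back from a single quotient. -/
lemma partialGrassmann_univ : partialGrassmann (Set.univ : Set (Submodule ℝ X)) =
    quantumGrassmann X :=
  le_antisymm (partialGrassmann_le _) fun T hT => by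
    obtain ⟨𝒮, -, h⟩ := exists_countable_of_quantumGrassmann hT
    exact partialGrassmann_mono (Set.subset_univ _) h

/-- Induction principle for elements of `partialGrassmann 𝒮`. -/
lemma partialGrassmann_induction {𝒮 : Set (Submodule ℝ X)} {P : BL2 X → Prop}
    (hs : ∀ Z ∈ 𝒮, ∀ (φ : C₀(X ⧸ Z, ℂ)) (ψ : C₀(X, ℂ)),
      P (mulOp (pullback Z φ) * fourierMul ψ.toBCF))
    (h0 : P 0) (hadd : ∀ S T, P S → P T → P (S + T)) (hsmul : ∀ (c : ℂ) T, P T → P (c • T))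
    (hcl : ∀ T, (∀ ε > 0, ∃ S, P S ∧ ‖T - S‖ ≤ ε) → P T) {T : BL2 X}
    (hT : T ∈ partialGrassmann 𝒮) : P T :=
  closure_span_induction (P := P) (by rintro _ ⟨Z, hZ, φ, ψ, rfl⟩; exact hs Z hZ φ ψ) h0 hadd hsmul
    hcl T hT

end Generators

/-! ### Localizations along lines and their compactness -/

section Tau

variable {X : Type*} [NormedAddCommGroup X] [InnerProductSpace ℝ X] [FiniteDimensional ℝ X]
  [MeasurableSpace X] [BorelSpace X]

lemma conjTranslation_zero_left (T : BL2 X) : conjTranslation 0 T = T := by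
  rw [conjTranslation, star_translation, neg_zero, translation_zero, one_mul, mul_one]

lemma tau_eq {Y : Lines X} {T S : BL2 X} (h : LocalLimit (grassmannFilterOf Y.1) T S) :
    tau Y.1 T = S := by
  have hex : ∃ S, IsTranslationLimit Y.1 T S := ⟨S, h⟩
  rw [tau, dif_pos hex]
  exact LocalLimit.unique hex.choose_spec h

lemma exists_localLimit (Y : Lines X) {T : BL2 X} (hT : T ∈ quantumGrassmann X) :
    ∃ S ∈ quantumGrassmann X, LocalLimit (grassmannFilterOf Y.1) T S := by
  have hdir := isDirected_grassmannFilterOf Y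
  rw [← partialGrassmann_univ] at hT
  refine partialGrassmann_induction (P := fun T => ∃ S ∈ quantumGrassmann X,
    LocalLimit (grassmannFilterOf Y.1) T S) ?_ ?_ ?_ ?_ ?_ hT
  · intro Z _ φ ψ
    by_cases hZ : Y.1 ≤ Z
    · refine ⟨_, ?_, localLimit_of_le hdir hZ φ ψ.toBCF⟩
      rw [conjTranslation_zero_left]
      exact partialGrassmann_le {Z} (mem_partialGrassmann ⟨Z, rfl, φ, ψ, rfl⟩)
    · exact ⟨0, zero_mem _, localLimit_of_not_le hdir hZ φ ψ⟩
  · exact ⟨0, zero_mem _, LocalLimit.zero⟩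
  · rintro T T' ⟨S, hS, h⟩ ⟨S', hS', h'⟩
    exact ⟨S + S', add_mem hS hS', h.add h'⟩
  · rintro c T ⟨S, hS, h⟩
    exact ⟨c • S, Submodule.smul_mem _ c hS, h.smul c⟩
  · exact fun T h => LocalLimit.exists_of_near isClosed_quantumGrassmann h

lemma localLimit_tau (Y : Lines X) {T : BL2 X} (hT : T ∈ quantumGrassmann X) :
    LocalLimit (grassmannFilterOf Y.1) T (tau Y.1 T) := by
  obtain ⟨S, -, hS⟩ := exists_localLimit Y hT
  rwa [tau_eq hS]

lemma tau_mem (Y : Lines X) {T : BL2 X} (hT : T ∈ quantumGrassmann X) :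
    tau Y.1 T ∈ quantumGrassmann X := by
  obtain ⟨S, hS, h⟩ := exists_localLimit Y hT
  rwa [tau_eq h]

lemma tau_zero (Y : Lines X) : tau Y.1 (0 : BL2 X) = 0 := tau_eq LocalLimit.zero

lemma tau_add (Y : Lines X) {S T : BL2 X} (hS : S ∈ quantumGrassmann X)
    (hT : T ∈ quantumGrassmann X) : tau Y.1 (S + T) = tau Y.1 S + tau Y.1 T :=
  tau_eq ((localLimit_tau Y hS).add (localLimit_tau Y hT))

lemma tau_smul (Y : Lines X) (c : ℂ) {T : BL2 X} (hT : T ∈ quantumGrassmann X) :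
    tau Y.1 (c • T) = c • tau Y.1 T :=
  tau_eq ((localLimit_tau Y hT).smul c)

lemma norm_tau_sub_le (Y : Lines X) {S T : BL2 X} (hS : S ∈ quantumGrassmann X)
    (hT : T ∈ quantumGrassmann X) : ‖tau Y.1 S - tau Y.1 T‖ ≤ ‖S - T‖ :=
  ((localLimit_tau Y hS).sub (localLimit_tau Y hT)).norm_le

/-- The base point along a line is 0, so nothing is translated. Thus τ_Y T depends on Y only through
which of the subspaces involved in T contain Y. -/
lemma tau_generator_of_le {Y : Lines X} {Z : Submodule ℝ X} (h : Y.1 ≤ Z) (φ : C₀(X ⧸ Z, ℂ))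
    (ψ : X →ᵇ ℂ) : tau Y.1 (mulOp (pullback Z φ) * fourierMul ψ) =
      mulOp (pullback Z φ) * fourierMul ψ := by
  rw [tau_eq (localLimit_of_le (isDirected_grassmannFilterOf Y) h φ ψ), conjTranslation_zero_left]

lemma tau_generator_of_not_le {Y : Lines X} {Z : Submodule ℝ X} (h : ¬ Y.1 ≤ Z) (φ : C₀(X ⧸ Z, ℂ))
    (ψ : C₀(X, ℂ)) : tau Y.1 (mulOp (pullback Z φ) * fourierMul ψ.toBCF) = 0 :=
  tau_eq (localLimit_of_not_le (isDirected_grassmannFilterOf Y) h φ ψ)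

lemma generator_mem (Z : Submodule ℝ X) (φ : C₀(X ⧸ Z, ℂ)) (ψ : C₀(X, ℂ)) :
    mulOp (pullback Z φ) * fourierMul ψ.toBCF ∈ quantumGrassmann X :=
  partialGrassmann_le {Z} (mem_partialGrassmann ⟨Z, rfl, φ, ψ, rfl⟩)

lemma quantumGrassmann_mem_of_near {P : BL2 X → Prop} {T : BL2 X}
    (h : ∀ ε > 0, ∃ S, (S ∈ quantumGrassmann X ∧ P S) ∧ ‖T - S‖ ≤ ε) : T ∈ quantumGrassmann X :=
  mem_of_forall_near isClosed_quantumGrassmann fun ε hε => by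
    obtain ⟨S, ⟨hS, -⟩, hTS⟩ := h ε hε
    exact ⟨S, hS, hTS⟩

/-- Along an ultrafilter on the projective space, the localizations converge in norm. -/
lemma exists_tendsto_tau (𝔘 : Ultrafilter (Lines X)) {T : BL2 X} (hT : T ∈ quantumGrassmann X) :
    ∃ Y₀ : Lines X, Tendsto (fun Y : Lines X => tau Y.1 T) 𝔘 (𝓝 (tau Y₀.1 T)) := by
  obtain ⟨𝒮, hc, hT𝒮⟩ := exists_countable_of_quantumGrassmann hT
  -- Z₀ is the smallest subspace containing 𝔘-almost every line. A line Y₀ in general position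
  -- inside Z₀ then lies in the same members of 𝒮 as 𝔘-almost every line.
  obtain ⟨Z₀, hZ₀⟩ := exists_least_submodule (X := X)
    (good := fun Z => ∀ᶠ Y : Lines X in 𝔘, Y.1 ≤ Z) (Eventually.of_forall fun _ => le_top)
    (fun Z Z' h hZ => hZ.mono fun Y hY => hY.trans h)
    (fun Z Z' h h' => (h.and h').mono fun Y hY => le_inf hY.1 hY.2)
  have hne : Z₀ ≠ ⊥ := by
    rintro rfl
    obtain ⟨Y, hY⟩ := ((hZ₀ ⊥).2 le_rfl).exists
    have h1 := Y.2
    rw [le_bot_iff.1 hY, finrank_bot] at h1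
    exact zero_ne_one h1
  obtain ⟨Y₀, -, hY₀⟩ := exists_line_avoiding hc hne
  -- Membership is carried through the induction because additivity and continuity of τ are
  -- available only inside the algebra.
  refine ⟨Y₀, And.right (a := T ∈ quantumGrassmann X) ?_⟩
  refine partialGrassmann_induction (P := fun T => T ∈ quantumGrassmann X ∧
    Tendsto (fun Y : Lines X => tau Y.1 T) 𝔘 (𝓝 (tau Y₀.1 T))) ?_ ?_ ?_ ?_ ?_ hT𝒮
  · refine fun Z hZ φ ψ => ⟨generator_mem Z φ ψ, ?_⟩
    by_cases h : Z₀ ≤ Z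
    · rw [tau_generator_of_le ((hY₀ Z hZ).2 h)]
      refine tendsto_const_nhds.congr' ?_
      filter_upwards [(hZ₀ Z).2 h] with Y hY
      rw [tau_generator_of_le hY]
    · rw [tau_generator_of_not_le (mt (hY₀ Z hZ).1 h)]
      refine tendsto_const_nhds.congr' ?_
      filter_upwards [Ultrafilter.eventually_not.2 (mt (hZ₀ Z).1 h)] with Y hY
      rw [tau_generator_of_not_le hY]
  · refine ⟨zero_mem _, ?_⟩
    simp only [tau_zero]
    exact tendsto_const_nhds
  · rintro S T ⟨hS, h⟩ ⟨hT, h'⟩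
    refine ⟨add_mem hS hT, ?_⟩
    simp only [tau_add _ hS hT]
    exact h.add h'
  · rintro c T ⟨hT, h⟩
    refine ⟨Submodule.smul_mem _ c hT, ?_⟩
    simp only [tau_smul _ c hT]
    exact h.const_smul c
  · intro T h
    have hT := quantumGrassmann_mem_of_near h
    refine ⟨hT, Metric.tendsto_nhds.2 fun ε hε => ?_⟩
    obtain ⟨S, ⟨hS, hSl⟩, hTS⟩ := h (ε / 4) (by positivity)
    filter_upwards [Metric.tendsto_nhds.1 hSl (ε / 4) (by positivity)] with Y hY
    have h1 := (norm_tau_sub_le Y hT hS).trans hTS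
    have h2 := (norm_tau_sub_le Y₀ hT hS).trans hTS
    rw [← dist_eq_norm] at h1 h2
    rw [dist_comm] at h2
    calc _ ≤ dist (tau Y.1 T) (tau Y.1 S) + dist (tau Y.1 S) (tau Y₀.1 S) +
          dist (tau Y₀.1 S) (tau Y₀.1 T) := dist_triangle4 _ _ _ _
      _ < ε := by linarith

/-- Every ultrafilter on the range is the image of an ultrafilter of lines, and the latter yields a
limit of the form τ_Y₀ T. No topology on the set of lines is involved. -/
lemma isCompact_setOf_tau {T : BL2 X} (hT : T ∈ quantumGrassmann X) :
    IsCompact {S : BL2 X | ∃ Y : Lines X, S = tau Y.1 T} := by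
  have hrange : {S : BL2 X | ∃ Y : Lines X, S = tau Y.1 T} =
      Set.range fun Y : Lines X => tau Y.1 T := by
    ext S
    simp only [Set.mem_ofPred_eq, Set.mem_range, eq_comm]
  rw [hrange, isCompact_iff_ultrafilter_le_nhds]
  intro 𝔙 h𝔙
  obtain ⟨𝔘, h𝔘⟩ : ∃ 𝔘 : Ultrafilter (Lines X), 𝔘.map (fun Y => tau Y.1 T) = 𝔙 := by
    refine ⟨Ultrafilter.ofComapInfPrincipal (m := fun Y : Lines X => tau Y.1 T) (s := Set.univ)
      (g := 𝔙) ?_, Ultrafilter.ofComapInfPrincipal_eq_of_map _⟩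
    rw [Set.image_univ]
    exact le_principal_iff.1 h𝔙
  obtain ⟨Y₀, hY₀⟩ := exists_tendsto_tau 𝔘 hT
  refine ⟨_, ⟨Y₀, rfl⟩, ?_⟩
  rw [← h𝔘]
  exact hY₀

/-- Along an ultrafilter going to infinity in `X`, the translates converge locally to a translate
of a localization along a line. -/
lemma exists_localLimit_of_ultrafilter {𝔘 : Ultrafilter X} (h𝔘 : (𝔘 : Filter X) ≤ cocompact X)
    {T : BL2 X} (hT : T ∈ quantumGrassmann X) :
    ∃ (Y : Lines X) (x₀ : X), LocalLimit 𝔘 T (conjTranslation x₀ (tau Y.1 T)) := by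
  obtain ⟨𝒮, hc, hT𝒮⟩ := exists_countable_of_quantumGrassmann hT
  obtain ⟨Z₀, hne, x₀, hdir⟩ := isDirected_of_ultrafilter h𝔘
  -- On the countable family 𝒮, the line Y₀ and the subspace Z₀ lie in the same members, so 𝔘 and
  -- the filter of Y₀ keep and kill the same generators, up to translation by x₀.
  obtain ⟨Y₀, -, hY₀⟩ := exists_line_avoiding hc hne
  refine ⟨Y₀, x₀, And.right (a := T ∈ quantumGrassmann X) ?_⟩
  refine partialGrassmann_induction (P := fun T => T ∈ quantumGrassmann X ∧
    LocalLimit 𝔘 T (conjTranslation x₀ (tau Y₀.1 T))) ?_ ?_ ?_ ?_ ?_ hT𝒮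
  · refine fun Z hZ φ ψ => ⟨generator_mem Z φ ψ, ?_⟩
    by_cases h : Z₀ ≤ Z
    · rw [tau_generator_of_le ((hY₀ Z hZ).2 h)]
      exact localLimit_of_le hdir h φ ψ.toBCF
    · rw [tau_generator_of_not_le (mt (hY₀ Z hZ).1 h)]
      simpa [conjTranslation] using localLimit_of_not_le hdir h φ ψ
  · refine ⟨zero_mem _, ?_⟩
    rw [tau_zero]
    simpa [conjTranslation] using LocalLimit.zero
  · rintro S T ⟨hS, h⟩ ⟨hT, h'⟩
    refine ⟨add_mem hS hT, ?_⟩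
    rw [tau_add _ hS hT, conjTranslation_add]
    exact h.add h'
  · rintro c T ⟨hT, h⟩
    refine ⟨Submodule.smul_mem _ c hT, ?_⟩
    rw [tau_smul _ c hT, conjTranslation_smul]
    exact h.smul c
  · intro T h
    have hT := quantumGrassmann_mem_of_near h
    refine ⟨hT, LocalLimit.of_near fun ε hε => ?_⟩
    obtain ⟨S, ⟨hS, hSl⟩, hTS⟩ := h ε hε
    refine ⟨S, _, hSl, hTS, ?_⟩
    rw [← conjTranslation_sub]
    exact (norm_conjTranslation_le _ _).trans ((norm_tau_sub_le Y₀ hT hS).trans hTS)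

end Tau

end QuantumGrassmann

namespace QuantumGrassmann

/-! ### Slowly varying windows -/

section Windows

variable {X : Type*} [NormedAddCommGroup X] [InnerProductSpace ℝ X] [FiniteDimensional ℝ X]
  [MeasurableSpace X] [BorelSpace X]

lemma enorm_sq_eq_lintegral (f : L2 X) : ‖f‖ₑ ^ 2 = ∫⁻ y, ‖f y‖ₑ ^ 2 := by
  rw [Lp.enorm_def, eLpNorm_eq_lintegral_rpow_enorm_toReal two_ne_zero ENNReal.ofNat_ne_top,
    ← ENNReal.rpow_natCast, ← ENNReal.rpow_mul]
  simp

/-- By Tonelli, with the integral over a done first: ∫ |u(y − a)|² da does not depend on y. For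
normalized u this is a continuous quadratic partition of unity. -/
lemma lintegral_enorm_mulOp_shift (u : X →ᵇ ℂ) (f : L2 X) :
    ∫⁻ a, ‖mulOp (shift (-a) u) f‖ₑ ^ 2 = (∫⁻ y, ‖u y‖ₑ ^ 2) * ‖f‖ₑ ^ 2 := by
  have hf : Measurable f := (Lp.stronglyMeasurable f).measurable
  have h1 : ∀ a, ‖mulOp (shift (-a) u) f‖ₑ ^ 2 = ∫⁻ y, ‖u (-a + y)‖ₑ ^ 2 * ‖f y‖ₑ ^ 2 := fun a => by
    rw [enorm_sq_eq_lintegral]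
    refine lintegral_congr_ae ?_
    filter_upwards [coeFn_mulOp (shift (-a) u) f] with y hy
    rw [hy, enorm_mul, mul_pow, shift_apply]
  simp only [h1]
  have hm : Measurable (Function.uncurry fun a y : X => ‖u (-a + y)‖ₑ ^ 2 * ‖f y‖ₑ ^ 2) := by
    have hu : Continuous fun p : X × X => u (-p.1 + p.2) := by fun_prop
    exact (hu.measurable.enorm.pow_const 2).mul ((hf.comp measurable_snd).enorm.pow_const 2)
  rw [lintegral_lintegral_swap hm.aemeasurable, enorm_sq_eq_lintegral,
    ← lintegral_const_mul _ (hf.enorm.pow_const 2)]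
  refine lintegral_congr fun y => ?_
  rw [lintegral_mul_const]
  · congr 1
    rw [← lintegral_sub_left_eq_self (fun z => ‖u z‖ₑ ^ 2) y]
    refine lintegral_congr fun a => ?_
    rw [neg_add_eq_sub]
  · have : Continuous fun a : X => u (-a + y) := by fun_prop
    exact this.measurable.enorm.pow_const 2

lemma lintegral_comp_smul_eq {r : ℝ} (hr : r ≠ 0) {g : X → ℝ≥0∞} (hg : Measurable g) :
    ∫⁻ y, g (r • y) = ENNReal.ofReal |(r ^ Module.finrank ℝ X)⁻¹| * ∫⁻ y, g y := by
  have h := Measure.map_addHaar_smul (volume : Measure X) hr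
  rw [← lintegral_map hg (measurable_const_smul r), h, lintegral_smul_measure, smul_eq_mul]

/-- A sequence of compactly supported functions of `L²` norm one, asymptotically invariant under
translations. -/
structure IsWindow (w : ℕ → C₀(X, ℂ)) : Prop where
  hasCompactSupport : ∀ n, HasCompactSupport (w n)
  lintegral_eq_one : ∀ n, ∫⁻ y, ‖w n y‖ₑ ^ 2 = 1
  tendsto : ∀ x, Tendsto (fun n => ∫⁻ y, ‖w n (x + y) - w n y‖ₑ ^ 2) atTop (𝓝 0)

variable (X) in
-- Normalized dilates of one bump work: shifting the n-th dilate by x amounts to shifting the bump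
-- by x / (n + 1), and translations are continuous on L².
lemma exists_isWindow : ∃ w : ℕ → C₀(X, ℂ), IsWindow w := by
  set χ : C₀(X, ℂ) := cutoff X 0 with hχ
  have hL2 : MemLp χ 2 (volume : Measure X) :=
    χ.continuous.memLp_of_hasCompactSupport (hasCompactSupport_cutoff 0)
  have hχm : Measurable fun y => ‖χ y‖ₑ ^ 2 := χ.continuous.measurable.enorm.pow_const 2
  have hI : ∀ g : L2 X, ∀ u : X → ℂ, g =ᵐ[volume] u → ∫⁻ y, ‖u y‖ₑ ^ 2 = ‖g‖ₑ ^ 2 := by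
    intro g u hgu
    rw [enorm_sq_eq_lintegral]
    refine lintegral_congr_ae ?_
    filter_upwards [hgu] with y hy
    rw [hy]
  set I : ℝ≥0∞ := ∫⁻ y, ‖χ y‖ₑ ^ 2 with hIdef
  have hItop : I ≠ ⊤ := by
    rw [hIdef, hI (hL2.toLp _) χ hL2.coeFn_toLp]
    exact ENNReal.pow_ne_top enorm_ne_top
  have hI0 : I ≠ 0 := by
    intro h0
    rw [hIdef, lintegral_eq_zero_iff hχm] at h0
    have h1 : (volume : Measure X) (Metric.ball 0 1) = 0 := by
      refine measure_mono_null (fun y hy => ?_) h0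
      have : χ y = 1 := cutoff_eq_one (by simpa using (mem_ball_zero_iff.1 hy).le)
      simp [this]
    exact (Metric.measure_ball_pos volume (0 : X) one_pos).ne' h1
  set N : ℝ := I.toReal
  have hN : 0 < N := ENNReal.toReal_pos hI0 hItop
  let r : ℕ → ℝ := fun n => ((n : ℝ) + 1)⁻¹
  have hr : ∀ n, 0 < r n := fun n => by positivity
  -- D n is the Jacobian of the dilation; the constant c n compensates for it and for the norm of
  -- the bump.
  let D : ℕ → ℝ := fun n => |(r n ^ Module.finrank ℝ X)⁻¹|
  have hD : ∀ n, 0 < D n := fun n => abs_pos.2 (inv_ne_zero (pow_ne_zero _ (hr n).ne'))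
  let c : ℕ → ℝ := fun n => √(1 / (D n * N))
  have hc : ∀ n, ‖(c n : ℂ)‖ₑ ^ 2 * ENNReal.ofReal (D n) = ENNReal.ofReal (1 / N) := fun n => by
    have h1 : ‖(c n : ℂ)‖ₑ = ENNReal.ofReal (c n) := by
      rw [← ofReal_norm, Complex.norm_real, Real.norm_of_nonneg (Real.sqrt_nonneg _)]
    have h2 : 0 ≤ 1 / (D n * N) := by have := hD n; positivity
    rw [h1, ← ENNReal.ofReal_pow (Real.sqrt_nonneg _), Real.sq_sqrt h2,
      ← ENNReal.ofReal_mul h2]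
    congr 1
    have := (hD n).ne'
    field_simp
  have hemb : ∀ n, IsClosedEmbedding fun y : X => r n • y := fun n =>
    (Homeomorph.smulOfNeZero (r n) (hr n).ne').isClosedEmbedding
  let w : ℕ → C₀(X, ℂ) := fun n =>
    { toFun := fun y => (c n : ℂ) * χ (r n • y)
      continuous_toFun := by fun_prop
      zero_at_infty' := by
        simpa using (χ.zero_at_infty'.comp (hemb n).tendsto_cocompact).const_mul (c n : ℂ) }
  have hw : ∀ n y, w n y = (c n : ℂ) * χ (r n • y) := fun n y => rfl
  refine ⟨w, fun n => ?_, fun n => ?_, fun x => ?_⟩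
  · exact ((hasCompactSupport_cutoff 0).comp_isClosedEmbedding (hemb n)).mul_left
  · simp only [hw, enorm_mul, mul_pow]
    have hm' : Measurable fun y => ‖χ (r n • y)‖ₑ ^ 2 := hχm.comp (measurable_const_smul (r n))
    rw [lintegral_const_mul _ hm',
      lintegral_comp_smul_eq (hr n).ne' hχm, ← mul_assoc, hc, ← hIdef,
      ← ENNReal.ofReal_toReal hItop, ← ENNReal.ofReal_mul (by positivity)]
    change ENNReal.ofReal (1 / N * N) = 1
    rw [one_div_mul_cancel hN.ne', ENNReal.ofReal_one]
  · have h1 : ∀ n, ∫⁻ y, ‖w n (x + y) - w n y‖ₑ ^ 2 = ENNReal.ofReal (1 / N) *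
        ‖translation (r n • x) (hL2.toLp χ) - hL2.toLp χ‖ₑ ^ 2 := fun n => by
      simp only [hw, ← mul_sub, enorm_mul, mul_pow, smul_add]
      have hm : Measurable fun y => ‖χ (r n • x + y) - χ y‖ₑ ^ 2 := by
        have : Continuous fun y => χ (r n • x + y) - χ y := by fun_prop
        exact this.measurable.enorm.pow_const 2
      have hm' : Measurable fun y => ‖χ (r n • x + r n • y) - χ (r n • y)‖ₑ ^ 2 :=
        hm.comp (measurable_const_smul (r n))
      rw [lintegral_const_mul _ hm', lintegral_comp_smul_eq (hr n).ne' hm, ← mul_assoc, hc]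
      congr 1
      refine hI _ _ ?_
      filter_upwards [Lp.coeFn_sub (translation (r n • x) (hL2.toLp χ)) (hL2.toLp χ),
        coeFn_translation (r n • x) (hL2.toLp χ), hL2.coeFn_toLp,
        ae_comp_add_left (r n • x) hL2.coeFn_toLp] with y h1 h2 h3 h4
      rw [h1, Pi.sub_apply, h2, h3, h4]
    have hr0 : Tendsto (fun n => r n • x) atTop (𝓝 0) := by
      have : Tendsto r atTop (𝓝 0) := by
        simpa [r, one_div] using tendsto_one_div_add_atTop_nhds_zero_nat (𝕜 := ℝ)
      simpa using this.smul_const x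
    have h2 : Tendsto (fun n => translation (r n • x) (hL2.toLp χ) - hL2.toLp χ) atTop (𝓝 0) := by
      have h3 := (continuous_translation_apply (X := X)).tendsto (0, hL2.toLp χ)
      have h4 := (h3.comp (hr0.prodMk_nhds tendsto_const_nhds)).sub_const (hL2.toLp χ)
      simpa [translation_zero] using h4
    simp only [h1]
    have h5 := ENNReal.Tendsto.const_mul (a := ENNReal.ofReal (1 / N))
      ((ENNReal.continuous_pow 2).tendsto _ |>.comp (h2.enorm)) (Or.inr ENNReal.ofReal_ne_top)
    simpa using h5

/-- The multiplication operator by `u(· - a)`. -/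
noncomputable def windowOp (u : C₀(X, ℂ)) (a : X) : BL2 X := mulOp (shift (-a) u.toBCF)

lemma windowOp_eq (u : C₀(X, ℂ)) (a : X) : windowOp u a = conjTranslation (-a) (mulOp u.toBCF) :=
  (conjTranslation_mulOp _ _).symm

lemma windowOp_apply (u : C₀(X, ℂ)) (a : X) (f : L2 X) :
    windowOp u a f = translation (-a) (mulOp u.toBCF (translation a f)) := by
  rw [windowOp_eq, conjTranslation, star_translation, neg_neg]
  rfl

lemma continuous_windowOp (u : C₀(X, ℂ)) :
    Continuous fun p : X × L2 X => windowOp u p.1 p.2 := by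
  simp only [windowOp_apply]
  exact continuous_translation_apply.comp ((continuous_neg.comp continuous_fst).prodMk
    ((mulOp u.toBCF).continuous.comp continuous_translation_apply))

lemma windowOp_mul_mulOp (u : C₀(X, ℂ)) (a : X) (φ : X →ᵇ ℂ) :
    windowOp u a * mulOp φ = mulOp φ * windowOp u a := by
  rw [windowOp, ← mulOp_mul, mul_comm, mulOp_mul]

end Windows

/-! ### Mean square smallness of commutators with windows -/

section SlowCommutation

variable {X : Type*} [NormedAddCommGroup X] [InnerProductSpace ℝ X] [FiniteDimensional ℝ X]
  [MeasurableSpace X] [BorelSpace X]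

/-- The commutator of `T` with multiplication by `u(· - a)`. -/
noncomputable def windowComm (T : BL2 X) (u : C₀(X, ℂ)) (a : X) : BL2 X :=
  T * windowOp u a - windowOp u a * T

lemma continuous_windowComm (T : BL2 X) (u : C₀(X, ℂ)) :
    Continuous fun p : X × L2 X => windowComm T u p.1 p.2 := by
  have h1 : Continuous fun p : X × L2 X => windowOp u p.1 (T p.2) :=
    (continuous_windowOp u).comp (continuous_fst.prodMk (T.continuous.comp continuous_snd))
  exact (T.continuous.comp (continuous_windowOp u)).sub h1

lemma measurable_windowComm (T : BL2 X) (u : C₀(X, ℂ)) (f : L2 X) :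
    Measurable fun a => ‖windowComm T u a f‖ₑ ^ 2 := by
  have h0 : Continuous fun a : X => (a, f) := continuous_id.prodMk continuous_const
  have h1 : Continuous fun a => windowComm T u a f := by
    have h := Continuous.comp (g := fun p : X × L2 X => windowComm T u p.1 p.2)
      (continuous_windowComm T u) h0
    simpa only [Function.comp_def] using h
  have h2 : Continuous fun a => ‖windowComm T u a f‖ₑ := h1.enorm
  exact h2.measurable.pow_const 2

/-- The commutators of `T` with the windows are small in the mean square sense. -/
def SlowCommutation (w : ℕ → C₀(X, ℂ)) (T : BL2 X) : Prop :=
  ∀ ε : ℝ, 0 < ε → ∀ᶠ n in atTop, ∀ f : L2 X,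
    ∫⁻ a, ‖windowComm T (w n) a f‖ₑ ^ 2 ≤ ENNReal.ofReal ε * ‖f‖ₑ ^ 2

lemma enorm_add_sq_le {E : Type*} [NormedAddCommGroup E] (x y : E) :
    ‖x + y‖ₑ ^ 2 ≤ 2 * ‖x‖ₑ ^ 2 + 2 * ‖y‖ₑ ^ 2 := by
  calc ‖x + y‖ₑ ^ 2 ≤ (‖x‖ₑ + ‖y‖ₑ) ^ 2 := by gcongr; exact enorm_add_le x y
    _ ≤ 2 * (‖x‖ₑ ^ 2 + ‖y‖ₑ ^ 2) := by
        have h := ENNReal.rpow_add_le_mul_rpow_add_rpow ‖x‖ₑ ‖y‖ₑ (p := 2) one_le_two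
        have h1 : (2 : ℝ≥0∞) ^ ((2 : ℝ) - 1) = 2 := by norm_num
        simpa only [h1, ENNReal.rpow_two] using h
    _ = _ := mul_add _ _ _

end SlowCommutation

end QuantumGrassmann

namespace QuantumGrassmann

section SlowCommutationLemmas

open scoped FourierTransform SchwartzMap

variable {X : Type*} [NormedAddCommGroup X] [InnerProductSpace ℝ X] [FiniteDimensional ℝ X]
  [MeasurableSpace X] [BorelSpace X]

lemma enorm_apply_sq_le (T : BL2 X) (f : L2 X) : ‖T f‖ₑ ^ 2 ≤ ‖T‖ₑ ^ 2 * ‖f‖ₑ ^ 2 := by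
  rw [← mul_pow]
  gcongr
  exact T.le_opENorm f

lemma lintegral_windowOp {w : ℕ → C₀(X, ℂ)} (hw : IsWindow w) (n : ℕ) (f : L2 X) :
    ∫⁻ a, ‖windowOp (w n) a f‖ₑ ^ 2 = ‖f‖ₑ ^ 2 := by
  refine (lintegral_enorm_mulOp_shift (w n).toBCF f).trans ?_
  have h : ∫⁻ y, ‖(w n).toBCF y‖ₑ ^ 2 = 1 := hw.lintegral_eq_one n
  rw [h, one_mul]

lemma continuous_windowOp_apply (u : C₀(X, ℂ)) (f : L2 X) : Continuous fun a => windowOp u a f := by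
  have h0 : Continuous fun a : X => (a, f) := continuous_id.prodMk continuous_const
  have h := Continuous.comp (g := fun p : X × L2 X => windowOp u p.1 p.2)
    (continuous_windowOp u) h0
  simpa only [Function.comp_def] using h

lemma measurable_windowOp (u : C₀(X, ℂ)) (f : L2 X) :
    Measurable fun a => ‖windowOp u a f‖ₑ ^ 2 := by
  have h2 : Continuous fun a => ‖windowOp u a f‖ₑ := (continuous_windowOp_apply u f).enorm
  exact h2.measurable.pow_const 2

lemma windowComm_apply (T : BL2 X) (u : C₀(X, ℂ)) (a : X) (f : L2 X) :
    windowComm T u a f = T (windowOp u a f) - windowOp u a (T f) := rfl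

lemma lintegral_windowComm_add_le (S T : BL2 X) (u : C₀(X, ℂ)) (f : L2 X) :
    ∫⁻ a, ‖windowComm (S + T) u a f‖ₑ ^ 2 ≤
      2 * (∫⁻ a, ‖windowComm S u a f‖ₑ ^ 2) + 2 * ∫⁻ a, ‖windowComm T u a f‖ₑ ^ 2 := by
  have h : ∀ a, windowComm (S + T) u a f = windowComm S u a f + windowComm T u a f := fun a => by
    simp only [windowComm_apply, add_apply, map_add]
    abel
  rw [← lintegral_const_mul _ (measurable_windowComm S u f),
    ← lintegral_const_mul _ (measurable_windowComm T u f),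
    ← lintegral_add_left ((measurable_windowComm S u f).const_mul 2)]
  refine lintegral_mono fun a => ?_
  rw [h]
  exact enorm_add_sq_le _ _

/-- A crude bound, uniform in n, which makes slow commutation stable under norm limits. -/
lemma lintegral_windowComm_le {w : ℕ → C₀(X, ℂ)} (hw : IsWindow w) (T : BL2 X) (n : ℕ)
    (f : L2 X) : ∫⁻ a, ‖windowComm T (w n) a f‖ₑ ^ 2 ≤ 4 * ‖T‖ₑ ^ 2 * ‖f‖ₑ ^ 2 := by
  calc ∫⁻ a, ‖windowComm T (w n) a f‖ₑ ^ 2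
      ≤ ∫⁻ a, (2 * ‖T‖ₑ ^ 2 * ‖windowOp (w n) a f‖ₑ ^ 2 + 2 * ‖windowOp (w n) a (T f)‖ₑ ^ 2) := by
        refine lintegral_mono fun a => ?_
        rw [windowComm_apply, sub_eq_add_neg]
        refine (enorm_add_sq_le _ _).trans ?_
        rw [enorm_neg, mul_assoc]
        gcongr
        exact enorm_apply_sq_le _ _
    _ = 2 * ‖T‖ₑ ^ 2 * ‖f‖ₑ ^ 2 + 2 * ‖T f‖ₑ ^ 2 := by
        rw [lintegral_add_left ((measurable_windowOp _ _).const_mul _),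
          lintegral_const_mul _ (measurable_windowOp _ _),
          lintegral_const_mul _ (measurable_windowOp _ _), lintegral_windowOp hw,
          lintegral_windowOp hw]
    _ ≤ 2 * ‖T‖ₑ ^ 2 * ‖f‖ₑ ^ 2 + 2 * (‖T‖ₑ ^ 2 * ‖f‖ₑ ^ 2) := by
        gcongr
        exact enorm_apply_sq_le _ _
    _ = _ := by ring

namespace SlowCommutation

variable {w : ℕ → C₀(X, ℂ)} {S T : BL2 X}

lemma add (hS : SlowCommutation w S) (hT : SlowCommutation w T) : SlowCommutation w (S + T) := by
  intro ε hε
  filter_upwards [hS (ε / 4) (by positivity), hT (ε / 4) (by positivity)] with n h1 h2 f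
  refine (lintegral_windowComm_add_le S T (w n) f).trans ?_
  calc _ ≤ 2 * (ENNReal.ofReal (ε / 4) * ‖f‖ₑ ^ 2) + 2 * (ENNReal.ofReal (ε / 4) * ‖f‖ₑ ^ 2) := by
        gcongr
        · exact h1 f
        · exact h2 f
    _ = ENNReal.ofReal ε * ‖f‖ₑ ^ 2 := by
        have : ENNReal.ofReal ε = 4 * ENNReal.ofReal (ε / 4) := by
          rw [← ENNReal.ofReal_ofNat, ← ENNReal.ofReal_mul (by norm_num)]
          congr 1
          ring
        rw [this]
        ring

/-- Transfer of slow commutation along a bound for the commutators. -/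
lemma of_bound (hT : SlowCommutation w T) (C : ℝ) (h : ∀ (n : ℕ) (δ : ℝ≥0∞),
      (∀ g, ∫⁻ a, ‖windowComm T (w n) a g‖ₑ ^ 2 ≤ δ * ‖g‖ₑ ^ 2) →
      ∀ f, ∫⁻ a, ‖windowComm S (w n) a f‖ₑ ^ 2 ≤ ENNReal.ofReal C * (δ * ‖f‖ₑ ^ 2)) :
    SlowCommutation w S := by
  intro ε hε
  have hC : 0 < |C| + 1 := by positivity
  filter_upwards [hT (ε / (|C| + 1)) (by positivity)] with n hn f
  refine (h n _ hn f).trans ?_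
  rw [← mul_assoc]
  gcongr
  rw [← ENNReal.ofReal_mul' (by positivity)]
  refine ENNReal.ofReal_le_ofReal ?_
  calc C * (ε / (|C| + 1)) ≤ (|C| + 1) * (ε / (|C| + 1)) := by
        gcongr
        linarith [le_abs_self C]
    _ = ε := by field_simp

lemma enorm_sq_eq_ofReal {E : Type*} [NormedAddCommGroup E] (x : E) :
    ‖x‖ₑ ^ 2 = ENNReal.ofReal (‖x‖ ^ 2) := by
  rw [← ofReal_norm, ENNReal.ofReal_pow (norm_nonneg _)]

lemma smul (c : ℂ) (hT : SlowCommutation w T) : SlowCommutation w (c • T) := by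
  refine hT.of_bound (‖c‖ ^ 2) fun n δ h f => ?_
  have h1 : ∀ a, ‖windowComm (c • T) (w n) a f‖ₑ ^ 2 =
      ‖c‖ₑ ^ 2 * ‖windowComm T (w n) a f‖ₑ ^ 2 := fun a => by
    simp only [windowComm_apply, smul_apply, map_smul, ← smul_sub, enorm_smul, mul_pow]
  simp only [h1]
  rw [lintegral_const_mul _ (measurable_windowComm T (w n) f), enorm_sq_eq_ofReal c]
  gcongr
  exact h f

/-- Multiplication operators commute exactly with the windows, so φ(Q) factors out of the
commutator. -/
lemma mulOp_mul (φ : X →ᵇ ℂ) (hT : SlowCommutation w T) : SlowCommutation w (mulOp φ * T) := by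
  refine hT.of_bound (‖mulOp φ‖ ^ 2) fun n δ h f => ?_
  have h1 : ∀ a, windowComm (mulOp φ * T) (w n) a f = mulOp φ (windowComm T (w n) a f) := fun a => by
    rw [windowComm, ← mul_assoc, windowOp_mul_mulOp, mul_assoc, mul_assoc, ← mul_sub]
    rfl
  rw [← enorm_sq_eq_ofReal]
  calc _ ≤ ∫⁻ a, ‖mulOp φ‖ₑ ^ 2 * ‖windowComm T (w n) a f‖ₑ ^ 2 := by
        refine lintegral_mono fun a => ?_
        rw [h1]
        exact enorm_apply_sq_le _ _
    _ = ‖mulOp φ‖ₑ ^ 2 * ∫⁻ a, ‖windowComm T (w n) a f‖ₑ ^ 2 :=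
        lintegral_const_mul _ (measurable_windowComm T (w n) f)
    _ ≤ _ := by
        gcongr
        exact h f

lemma mul_mulOp (φ : X →ᵇ ℂ) (hT : SlowCommutation w T) : SlowCommutation w (T * mulOp φ) := by
  refine hT.of_bound (‖mulOp φ‖ ^ 2) fun n δ h f => ?_
  have h1 : ∀ a, windowComm (T * mulOp φ) (w n) a f = windowComm T (w n) a (mulOp φ f) := fun a => by
    rw [windowComm, mul_assoc, ← windowOp_mul_mulOp, ← mul_assoc, ← mul_assoc, ← sub_mul]
    rfl
  rw [← enorm_sq_eq_ofReal]
  simp only [h1]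
  calc _ ≤ δ * ‖mulOp φ f‖ₑ ^ 2 := h _
    _ ≤ δ * (‖mulOp φ‖ₑ ^ 2 * ‖f‖ₑ ^ 2) := by
        gcongr
        exact enorm_apply_sq_le _ _
    _ = _ := by ring

lemma of_near (hw : IsWindow w) (h : ∀ ε > 0, ∃ S, SlowCommutation w S ∧ ‖T - S‖ ≤ ε) :
    SlowCommutation w T := by
  intro ε hε
  obtain ⟨S, hS, hTS⟩ := h (√(ε / 16)) (by positivity)
  filter_upwards [hS (ε / 4) (by positivity)] with n hn f
  have h1 : ‖T - S‖ₑ ^ 2 ≤ ENNReal.ofReal (ε / 16) := by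
    rw [enorm_sq_eq_ofReal]
    refine ENNReal.ofReal_le_ofReal ?_
    calc ‖T - S‖ ^ 2 ≤ √(ε / 16) ^ 2 := by gcongr
      _ = ε / 16 := Real.sq_sqrt (by positivity)
  have h2 := lintegral_windowComm_add_le (T - S) S (w n) f
  rw [sub_add_cancel] at h2
  refine h2.trans ?_
  calc _ ≤ 2 * (4 * ENNReal.ofReal (ε / 16) * ‖f‖ₑ ^ 2) +
        2 * (ENNReal.ofReal (ε / 4) * ‖f‖ₑ ^ 2) := by
        gcongr
        · refine (lintegral_windowComm_le hw (T - S) n f).trans ?_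
          gcongr
        · exact hn f
    _ = ENNReal.ofReal ε * ‖f‖ₑ ^ 2 := by
        have h3 : ENNReal.ofReal ε = 16 * ENNReal.ofReal (ε / 16) := by
          rw [← ENNReal.ofReal_ofNat, ← ENNReal.ofReal_mul (by norm_num)]
          congr 1
          ring
        have h4 : ENNReal.ofReal (ε / 4) = 4 * ENNReal.ofReal (ε / 16) := by
          rw [← ENNReal.ofReal_ofNat, ← ENNReal.ofReal_mul (by norm_num)]
          congr 1
          ring
        rw [h3, h4]
        ring

lemma zero : SlowCommutation w (0 : BL2 X) := by
  intro ε hε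
  filter_upwards with n f
  simp [windowComm]

end SlowCommutation

/-- The commutator with U_x is U_x followed by multiplication with the translated increment u(x + ·)
− u, so the quadratic partition identity applies to the increment. -/
lemma lintegral_windowComm_translation (x : X) (u : C₀(X, ℂ)) (f : L2 X) :
    ∫⁻ a, ‖windowComm (translation x) u a f‖ₑ ^ 2 =
      (∫⁻ y, ‖u (x + y) - u y‖ₑ ^ 2) * ‖f‖ₑ ^ 2 := by
  have h1 : ∀ a, windowComm (translation x) u a f =
      mulOp (shift (-a) (shift x u.toBCF - u.toBCF)) (translation x f) := fun a => by
    have h2 : shift (-a) (shift x u.toBCF - u.toBCF) =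
        shift x (shift (-a) u.toBCF) - shift (-a) u.toBCF := by
      ext y
      simp [add_left_comm]
    rw [windowComm, translation_mul, windowOp, conjTranslation_mulOp, h2, mulOp_sub, ← sub_mul]
    rfl
  simp only [h1, lintegral_enorm_mulOp_shift]
  congr 1
  rw [← ofReal_norm, ← ofReal_norm, norm_translation_apply]

/-- Minkowski's integral inequality by duality: the weak formula is tested against the commutator
vector itself, and one factor of its norm is cancelled. -/
lemma enorm_windowComm_le {T : BL2 X} {k : X → ℂ} (hk : Integrable k)
    (hT : ∀ f g : L2 X, inner ℂ g (T f) = ∫ x, k x * inner ℂ g (translation x f))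
    (u : C₀(X, ℂ)) (a : X) (f : L2 X) :
    ‖windowComm T u a f‖ₑ ≤ ∫⁻ x, ‖k x‖ₑ * ‖windowComm (translation x) u a f‖ₑ := by
  set v := windowComm T u a f with hv
  have hint : ∀ g h : L2 X, Integrable (fun x => k x * inner ℂ g (translation x h)) volume := by
    intro g h
    refine hk.mul_bdd (c := ‖g‖ * ‖h‖) ?_ (Eventually.of_forall fun x => ?_)
    · exact (continuous_inner_translation g h).aestronglyMeasurable
    · exact (norm_inner_le_norm _ _).trans_eq (by rw [norm_translation_apply])
  have key : ∀ g : L2 X, inner ℂ g v =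
      ∫ x, k x * inner ℂ g (windowComm (translation x) u a f) := by
    intro g
    rw [hv, windowComm_apply, inner_sub_right, hT,
      ← ContinuousLinearMap.adjoint_inner_left, hT,
      ← integral_sub (hint _ _) (hint _ _)]
    refine integral_congr_ae (Eventually.of_forall fun x => ?_)
    simp only [windowComm_apply, inner_sub_right, ContinuousLinearMap.adjoint_inner_left]
    ring
  by_cases hv0 : v = 0
  · simp [hv0]
  have hv1 : ‖v‖ₑ ≠ 0 := by simpa using hv0
  have h1 : ‖v‖ₑ * ‖v‖ₑ ≤ ‖v‖ₑ * ∫⁻ x, ‖k x‖ₑ * ‖windowComm (translation x) u a f‖ₑ := by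
    calc ‖v‖ₑ * ‖v‖ₑ = ‖inner ℂ v v‖ₑ := by
          rw [inner_self_eq_norm_sq_to_K, ← sq, ← ofReal_norm v, ← ofReal_norm,
            ← ENNReal.ofReal_pow (norm_nonneg _)]
          simp
      _ ≤ ∫⁻ x, ‖k x * inner ℂ v (windowComm (translation x) u a f)‖ₑ := by
          conv_lhs => rw [key v]
          exact enorm_integral_le_lintegral_enorm _
      _ ≤ ∫⁻ x, ‖v‖ₑ * (‖k x‖ₑ * ‖windowComm (translation x) u a f‖ₑ) := by
          refine lintegral_mono fun x => ?_
          rw [enorm_mul, mul_left_comm]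
          gcongr
          rw [← ofReal_norm, ← ofReal_norm, ← ofReal_norm, ← ENNReal.ofReal_mul (norm_nonneg _)]
          exact ENNReal.ofReal_le_ofReal (norm_inner_le_norm _ _)
      _ = ‖v‖ₑ * ∫⁻ x, ‖k x‖ₑ * ‖windowComm (translation x) u a f‖ₑ :=
          lintegral_const_mul' _ _ enorm_ne_top
  exact (ENNReal.mul_le_mul_iff_right hv1 enorm_ne_top).1 h1

lemma continuous_windowOp_comp {α : Type*} [TopologicalSpace α] (u : C₀(X, ℂ)) {b : α → X}
    {g : α → L2 X} (hb : Continuous b) (hg : Continuous g) :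
    Continuous fun p => windowOp u (b p) (g p) := by
  have h := Continuous.comp (g := fun p : X × L2 X => windowOp u p.1 p.2)
    (continuous_windowOp u) (hb.prodMk hg)
  simpa only [Function.comp_def] using h

lemma continuous_translation_comp {α : Type*} [TopologicalSpace α] {b : α → X}
    {g : α → L2 X} (hb : Continuous b) (hg : Continuous g) :
    Continuous fun p => translation (b p) (g p) := by
  have h := Continuous.comp (g := fun p : X × L2 X => translation p.1 p.2)
    continuous_translation_apply (hb.prodMk hg)
  simpa only [Function.comp_def] using h

lemma continuous_windowComm_translation (u : C₀(X, ℂ)) (f : L2 X) :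
    Continuous fun p : X × X => windowComm (translation p.1) u p.2 f := by
  simp only [windowComm_apply]
  exact (continuous_translation_comp continuous_fst
      (continuous_windowOp_comp u continuous_snd continuous_const)).sub
    (continuous_windowOp_comp u continuous_snd
      (continuous_translation_comp continuous_fst continuous_const))

/-- Cauchy–Schwarz for the measure with density k. -/
lemma lintegral_mul_sq_le {α : Type*} [MeasurableSpace α] (μ : Measure α) {k h : α → ℝ≥0∞}
    (hk : AEMeasurable k μ) (hh : AEMeasurable h μ) :
    (∫⁻ x, k x * h x ∂μ) ^ 2 ≤ (∫⁻ x, k x ∂μ) * ∫⁻ x, k x * h x ^ 2 ∂μ := by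
  have h1 := ENNReal.lintegral_mul_norm_pow_le (μ := μ) (f := k) (g := fun x => k x * h x ^ 2) hk
    (hk.mul (hh.pow_const 2)) (p := 1 / 2) (q := 1 / 2) (by norm_num) (by norm_num) (by norm_num)
  have h2 : ∀ x, k x ^ (1 / 2 : ℝ) * (k x * h x ^ 2) ^ (1 / 2 : ℝ) = k x * h x := fun x => by
    rw [← ENNReal.mul_rpow_of_nonneg _ _ (by norm_num), ← mul_assoc, ← sq, ← mul_pow,
      ← ENNReal.rpow_natCast, ← ENNReal.rpow_mul]
    norm_num
  simp only [h2] at h1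
  calc _ ≤ ((∫⁻ x, k x ∂μ) ^ (1 / 2 : ℝ) * (∫⁻ x, k x * h x ^ 2 ∂μ) ^ (1 / 2 : ℝ)) ^ 2 := by gcongr
    _ = _ := by
      rw [← ENNReal.mul_rpow_of_nonneg _ _ (by norm_num), ← ENNReal.rpow_natCast,
        ← ENNReal.rpow_mul]
      norm_num

lemma lintegral_windowComm_le_of_inner {T : BL2 X} {k : X → ℂ} (hk : Integrable k)
    (hT : ∀ f g : L2 X, inner ℂ g (T f) = ∫ x, k x * inner ℂ g (translation x f))
    (u : C₀(X, ℂ)) (f : L2 X) : ∫⁻ a, ‖windowComm T u a f‖ₑ ^ 2 ≤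
      (∫⁻ x, ‖k x‖ₑ) * (∫⁻ x, ‖k x‖ₑ * ∫⁻ y, ‖u (x + y) - u y‖ₑ ^ 2) * ‖f‖ₑ ^ 2 := by
  have hkm : AEMeasurable fun x => ‖k x‖ₑ := hk.aestronglyMeasurable.enorm
  have hc : Measurable fun p : X × X => ‖windowComm (translation p.1) u p.2 f‖ₑ := by
    have h : Continuous fun p : X × X => ‖windowComm (translation p.1) u p.2 f‖ₑ :=
      (continuous_windowComm_translation u f).enorm
    exact h.measurable
  generalize hG : (fun p : X × X => ‖windowComm (translation p.1) u p.2 f‖ₑ) = G at hc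
  have hGa : ∀ x a, ‖windowComm (translation x) u a f‖ₑ = G (x, a) := fun x a => by rw [← hG]
  have hca : ∀ a, Measurable fun x => G (x, a) := fun a => hc.comp measurable_prodMk_right
  have hcx : ∀ x, Measurable fun a => G (x, a) := fun x => hc.comp measurable_prodMk_left
  calc _ ≤ ∫⁻ a, (∫⁻ x, ‖k x‖ₑ) * ∫⁻ x, ‖k x‖ₑ * G (x, a) ^ 2 := by
        refine lintegral_mono fun a => ?_
        refine le_trans ?_ (lintegral_mul_sq_le volume hkm (hca a).aemeasurable)
        have := enorm_windowComm_le hk hT u a f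
        simp only [hGa] at this
        gcongr
    _ = (∫⁻ x, ‖k x‖ₑ) * ∫⁻ a, ∫⁻ x, ‖k x‖ₑ * G (x, a) ^ 2 :=
        lintegral_const_mul' _ _ hk.hasFiniteIntegral.ne
    _ = (∫⁻ x, ‖k x‖ₑ) * ∫⁻ x, ‖k x‖ₑ * ((∫⁻ y, ‖u (x + y) - u y‖ₑ ^ 2) * ‖f‖ₑ ^ 2) := by
        congr 1
        rw [lintegral_lintegral_swap]
        · refine lintegral_congr fun x => ?_
          rw [← lintegral_windowComm_translation, lintegral_const_mul _ ((hcx x).pow_const 2)]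
          simp only [hGa]
        · exact (hkm.comp_quasiMeasurePreserving Measure.quasiMeasurePreserving_snd).mul
            ((hc.comp measurable_swap).pow_const 2).aemeasurable
    _ = _ := by
        simp only [← mul_assoc]
        rw [lintegral_mul_const' _ _ (ENNReal.pow_ne_top enorm_ne_top)]
        ring

/-- Each translation commutes slowly with the windows. Dominated convergence with majorant 4‖k‖
passes this to integrable superpositions, uniformly in f. -/
lemma slowCommutation_of_inner {w : ℕ → C₀(X, ℂ)} (hw : IsWindow w) {T : BL2 X} {k : X → ℂ}
    (hk : Integrable k)
    (hT : ∀ f g : L2 X, inner ℂ g (T f) = ∫ x, k x * inner ℂ g (translation x f)) :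
    SlowCommutation w T := by
  have hkm : AEMeasurable fun x => ‖k x‖ₑ := hk.aestronglyMeasurable.enorm
  have hwm : ∀ n, Measurable fun p : X × X => ‖w n (p.1 + p.2) - w n p.2‖ₑ ^ 2 := fun n => by
    have : Continuous fun p : X × X => w n (p.1 + p.2) - w n p.2 := by fun_prop
    exact this.measurable.enorm.pow_const 2
  have hle : ∀ n x, ∫⁻ y, ‖w n (x + y) - w n y‖ₑ ^ 2 ≤ 4 := fun n x => by
    have hm : Measurable fun y => ‖w n y‖ₑ ^ 2 := by
      have : Continuous fun y => w n y := by fun_prop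
      exact this.measurable.enorm.pow_const 2
    calc _ ≤ ∫⁻ y, (2 * ‖w n (x + y)‖ₑ ^ 2 + 2 * ‖w n y‖ₑ ^ 2) := by
          refine lintegral_mono fun y => ?_
          rw [sub_eq_add_neg]
          refine (enorm_add_sq_le _ _).trans ?_
          rw [enorm_neg]
      _ = 2 * 1 + 2 * 1 := by
          rw [lintegral_add_right _ (hm.const_mul 2), lintegral_const_mul _ hm,
            lintegral_const_mul' _ _ ENNReal.ofNat_ne_top,
            lintegral_add_left_eq_self (fun y => ‖w n y‖ₑ ^ 2) x, hw.lintegral_eq_one]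
      _ = 4 := by norm_num
  have hfin : ∫⁻ x, ‖k x‖ₑ ≠ ⊤ := hk.hasFiniteIntegral.ne
  have h1 : Tendsto (fun n => ∫⁻ x, ‖k x‖ₑ * ∫⁻ y, ‖w n (x + y) - w n y‖ₑ ^ 2) atTop
      (𝓝 (∫⁻ _ : X, 0)) := by
    refine tendsto_lintegral_of_dominated_convergence' (fun x => ‖k x‖ₑ * 4) (fun n => ?_)
      (fun n => Eventually.of_forall fun x => ?_) ?_ ?_
    · exact hkm.mul (hwm n).lintegral_prod_right'.aemeasurable
    · dsimp only
      gcongr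
      exact hle n x
    · rw [lintegral_mul_const' _ _ (by norm_num)]
      exact ENNReal.mul_ne_top hfin (by norm_num)
    · refine Eventually.of_forall fun x => ?_
      have := ENNReal.Tendsto.const_mul (a := ‖k x‖ₑ) (hw.tendsto x) (Or.inr enorm_ne_top)
      simpa using this
  have h2 := ENNReal.Tendsto.const_mul (a := ∫⁻ x, ‖k x‖ₑ) h1 (Or.inr hfin)
  rw [lintegral_zero, mul_zero] at h2
  intro ε hε
  filter_upwards [(ENNReal.tendsto_nhds_zero.1 h2) (ENNReal.ofReal ε) (by simpa using hε)]
    with n hn f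
  refine (lintegral_windowComm_le_of_inner hk hT (w n) f).trans ?_
  gcongr

lemma slowCommutation_fourierMul {w : ℕ → C₀(X, ℂ)} (hw : IsWindow w) (ψ : C₀(X, ℂ)) :
    SlowCommutation w (fourierMul ψ.toBCF) := by
  refine fourierMul_induction (fun T h => SlowCommutation.of_near hw h) (fun s => ?_) ψ
  exact slowCommutation_of_inner hw (SchwartzMap.integrable (𝓕 s))
    fun f g => inner_fourierMul_schwartz s f g

/-- The complex conjugate of a function in `C₀`, as an element of `C₀`. -/
lemma toBCF_star (ψ : C₀(X, ℂ)) : star ψ.toBCF = (star ψ).toBCF := by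
  ext x
  rfl

lemma slowCommutation_of_mem {w : ℕ → C₀(X, ℂ)} (hw : IsWindow w) {T : BL2 X}
    (hT : T ∈ quantumGrassmann X) : SlowCommutation w T := by
  rw [← partialGrassmann_univ] at hT
  refine partialGrassmann_induction (P := SlowCommutation w) (fun Z _ φ ψ => ?_)
    SlowCommutation.zero (fun S T => SlowCommutation.add) (fun c T => SlowCommutation.smul c)
    (fun T => SlowCommutation.of_near hw) hT
  exact (slowCommutation_fourierMul hw ψ).mulOp_mul _

/-- The adjoint of a generator has its factors in reverse order. Putting the adjoint inside the
induction predicate avoids needing stability of the algebra under adjoints. -/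
lemma slowCommutation_star_of_mem {w : ℕ → C₀(X, ℂ)} (hw : IsWindow w) {T : BL2 X}
    (hT : T ∈ quantumGrassmann X) : SlowCommutation w (star T) := by
  rw [← partialGrassmann_univ] at hT
  refine partialGrassmann_induction (P := fun T => SlowCommutation w (star T))
    (fun Z _ φ ψ => ?_) ?_ (fun S T hS hT => ?_) (fun c T hT => ?_) (fun T h => ?_) hT
  · rw [star_mul, star_fourierMul, star_mulOp, toBCF_star]
    exact (slowCommutation_fourierMul hw _).mul_mulOp _
  · rw [star_zero]
    exact SlowCommutation.zero
  · rw [star_add]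
    exact hS.add hT
  · rw [star_smul]
    exact hT.smul _
  · refine SlowCommutation.of_near hw fun ε hε => ?_
    obtain ⟨S, hS, hST⟩ := h ε hε
    exact ⟨star S, hS, by rwa [← star_sub, norm_star]⟩

/-- θ(Q) commutes past φ(Q) and meets ψ(P). This is what turns a cutoff error into a compact one. -/
lemma isCompactOperator_mulOp_mul_of_mem (θ : C₀(X, ℂ)) {T : BL2 X}
    (hT : T ∈ quantumGrassmann X) : IsCompactOperator (mulOp θ.toBCF * T) := by
  rw [← partialGrassmann_univ] at hT
  refine partialGrassmann_induction (P := fun T => IsCompactOperator (mulOp θ.toBCF * T : BL2 X))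
    (fun Z _ φ ψ => ?_) ?_ (fun S T hS hT => ?_) (fun c T hT => ?_) (fun T h => ?_) hT
  · rw [← mul_assoc, ← mulOp_mul, mul_comm, mulOp_mul, mul_assoc]
    exact IsCompactOperator.mul_left' (isCompactOperator_mulOp_mul_fourierMul θ ψ) _
  · rw [mul_zero]
    exact isCompactOperator_zero
  · rw [mul_add]
    exact hS.add hT
  · rw [mul_smul_comm]
    exact hT.smul c
  · refine isCompactOperator_of_forall_near fun ε hε => ?_
    obtain ⟨S, hS, hST⟩ := h (ε / (‖mulOp θ.toBCF‖ + 1)) (by positivity)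
    refine ⟨_, hS, ?_⟩
    rw [← mul_sub]
    refine (norm_mul_le _ _).trans ?_
    calc _ ≤ (‖mulOp θ.toBCF‖ + 1) * (ε / (‖mulOp θ.toBCF‖ + 1)) := by
          gcongr
          linarith
      _ = ε := by field_simp

lemma isCompactOperator_mulOp_mul_star_of_mem (θ : C₀(X, ℂ)) {T : BL2 X}
    (hT : T ∈ quantumGrassmann X) : IsCompactOperator (mulOp θ.toBCF * star T) := by
  have h : IsCompactOperator (T * mulOp (star θ).toBCF : BL2 X) := by
    rw [← partialGrassmann_univ] at hT
    refine partialGrassmann_induction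
      (P := fun T => IsCompactOperator (T * mulOp (star θ).toBCF : BL2 X))
      (fun Z _ φ ψ => ?_) ?_ (fun S T hS hT => ?_) (fun c T hT => ?_) (fun T h => ?_) hT
    · rw [mul_assoc]
      exact IsCompactOperator.mul_left' (isCompactOperator_fourierMul_mul_mulOp _ ψ) _
    · rw [zero_mul]
      exact isCompactOperator_zero
    · rw [add_mul]
      exact hS.add hT
    · rw [smul_mul_assoc]
      exact hT.smul c
    · refine isCompactOperator_of_forall_near fun ε hε => ?_
      obtain ⟨S, hS, hST⟩ := h (ε / (‖mulOp (star θ).toBCF‖ + 1)) (by positivity)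
      refine ⟨_, hS, ?_⟩
      rw [← sub_mul]
      refine (norm_mul_le _ _).trans ?_
      calc _ ≤ (ε / (‖mulOp (star θ).toBCF‖ + 1)) * (‖mulOp (star θ).toBCF‖ + 1) := by
            gcongr
            linarith
        _ = ε := by field_simp
  have h2 := isCompactOperator_star h
  rwa [star_mul, ← toBCF_star, star_mulOp, star_star] at h2

end SlowCommutationLemmas

end QuantumGrassmann

namespace QuantumGrassmann

/-! ### From localizations at infinity to a parametrix -/

section LowerBounds

variable {X : Type*} [NormedAddCommGroup X] [InnerProductSpace ℝ X] [FiniteDimensional ℝ X]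
  [MeasurableSpace X] [BorelSpace X]

lemma LocalLimit.one {𝔉 : Filter X} : LocalLimit 𝔉 (1 : BL2 X) 1 := by
  refine LocalLimit.of_tendsto ?_
  simp only [conjTranslation_one]
  exact tendsto_const_nhds

lemma norm_conjTranslation_apply (a : X) (T : BL2 X) (f : L2 X) :
    ‖conjTranslation a T f‖ = ‖T (translation (-a) f)‖ := by
  rw [conjTranslation, star_translation]
  exact norm_translation_apply _ _

lemma exists_cutoff_eq_one {u : C₀(X, ℂ)} (hu : HasCompactSupport u) (R : ℝ) :
    ∃ m : ℕ, ∀ a : X, ‖a‖ ≤ R → ∀ y, u (-a + y) ≠ 0 → cutoff X m y = 1 := by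
  obtain ⟨ρ, hρ⟩ := hu.isCompact.isBounded.subset_closedBall 0
  obtain ⟨m, hm⟩ := exists_nat_ge (ρ + R)
  refine ⟨m, fun a ha y hy => cutoff_eq_one ?_⟩
  have h1 : ‖-a + y‖ ≤ ρ := by simpa using hρ (subset_tsupport _ hy)
  have h2 : ‖y‖ ≤ ‖a‖ + ‖-a + y‖ := by
    simpa using norm_add_le a (-a + y)
  linarith

lemma windowOp_mul_cutoff {u : C₀(X, ℂ)} {a : X} {m : ℕ}
    (h : ∀ y, u (-a + y) ≠ 0 → cutoff X m y = 1) :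
    windowOp u a * mulOp (cutoff X m).toBCF = windowOp u a := by
  rw [windowOp, ← mulOp_mul]
  congr 1
  ext y
  change u (-a + y) * cutoff X m y = u (-a + y)
  by_cases hy : u (-a + y) = 0
  · rw [hy, zero_mul]
  · rw [h y hy, mul_one]

/-- Otherwise some ultrafilter at infinity contains the bad positions a. Translating the window back
to the origin puts its support in a fixed compact set, where the translates of B are norm close to a
limit bounded below by c; half of c survives. -/
lemma eventually_le_norm_apply_windowOp {B : BL2 X} {c : ℝ} (hc : 0 < c)
    (hB : ∀ 𝔘 : Ultrafilter X, (𝔘 : Filter X) ≤ cocompact X →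
      ∃ S : BL2 X, LocalLimit 𝔘 B S ∧ ∀ f, c * ‖f‖ ≤ ‖S f‖)
    {u : C₀(X, ℂ)} (hu : HasCompactSupport u) :
    ∀ᶠ a in cocompact X, ∀ f, c / 2 * ‖windowOp u a f‖ ≤ ‖B (windowOp u a f)‖ := by
  by_contra hcon
  rw [not_eventually, frequently_iff_neBot] at hcon
  let 𝔘 : Ultrafilter X := Ultrafilter.of
    (cocompact X ⊓ 𝓟 {a | ¬ ∀ f, c / 2 * ‖windowOp u a f‖ ≤ ‖B (windowOp u a f)‖})
  have h𝔘 := Ultrafilter.of_le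
    (cocompact X ⊓ 𝓟 {a | ¬ ∀ f, c / 2 * ‖windowOp u a f‖ ≤ ‖B (windowOp u a f)‖})
  obtain ⟨S, hS, hSc⟩ := hB 𝔘 (h𝔘.trans inf_le_left)
  obtain ⟨m, hm⟩ := exists_cutoff_eq_one hu 0
  have h1 : mulOp (cutoff X m).toBCF * mulOp u.toBCF = mulOp u.toBCF := by
    have h2 := windowOp_mul_cutoff (hm 0 (by simp))
    rw [windowOp_eq, neg_zero, conjTranslation_zero_left] at h2
    rw [← mulOp_mul, mul_comm, mulOp_mul, h2]
  have h3 := (Metric.tendsto_nhds.1 ((localLimit_iff.1 hS (cutoff X m)).1) (c / 2) (half_pos hc)).and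
    (h𝔘.trans inf_le_right (mem_principal_self _))
  obtain ⟨a, h4, h5⟩ := h3.exists
  refine h5 fun f => ?_
  rw [dist_zero_right] at h4
  set g := mulOp u.toBCF (translation a f) with hg
  have hW : windowOp u a f = translation (-a) g := windowOp_apply u a f
  have hθg : mulOp (cutoff X m).toBCF g = g := DFunLike.congr_fun h1 (translation a f)
  rw [hW, norm_translation_apply, ← norm_conjTranslation_apply]
  have h6 : ‖((conjTranslation a B - S) * mulOp (cutoff X m).toBCF) g‖ ≤ c / 2 * ‖g‖ := by
    refine (ContinuousLinearMap.le_opNorm _ _).trans ?_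
    have : ‖(conjTranslation a B - S) * mulOp (cutoff X m).toBCF‖ ≤ c / 2 := by
      simpa using h4.le
    gcongr
  have h7 : ((conjTranslation a B - S) * mulOp (cutoff X m).toBCF) g =
      conjTranslation a B g - S g := by
    change (conjTranslation a B - S) (mulOp (cutoff X m).toBCF g) = _
    rw [hθg]
    rfl
  rw [h7] at h6
  have h8 := hSc g
  have h9 := norm_sub_norm_le (S g) (conjTranslation a B g)
  rw [norm_sub_rev] at h9
  linarith

/-- Far windows satisfy the local lower bound, and windows centred in a compact set are seen by the
cutoff. Squaring and integrating over all centres reassembles f, at the price of the commutator. -/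
lemma exists_cutoff_lower_bound {w : ℕ → C₀(X, ℂ)} (hw : IsWindow w) {B : BL2 X}
    (hBw : SlowCommutation w B) {c : ℝ} (hc : 0 < c)
    (hB : ∀ 𝔘 : Ultrafilter X, (𝔘 : Filter X) ≤ cocompact X →
      ∃ S : BL2 X, LocalLimit 𝔘 B S ∧ ∀ f, c * ‖f‖ ≤ ‖S f‖) :
    ∃ (m : ℕ) (d : ℝ), 0 < d ∧
      ∀ f, d * ‖f‖ ^ 2 ≤ ‖B f‖ ^ 2 + ‖mulOp (cutoff X m).toBCF f‖ ^ 2 := by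
  -- The commutator enters with a factor 2 and so costs c² / 8, half of the local constant (c / 2)²
  -- = c² / 4.
  obtain ⟨n, hn⟩ := (hBw (c ^ 2 / 16) (by positivity)).exists
  have hu := hw.hasCompactSupport n
  obtain ⟨K, hK, hKc⟩ := mem_cocompact.1 (eventually_le_norm_apply_windowOp hc hB hu)
  obtain ⟨R, hR⟩ := hK.isBounded.subset_closedBall 0
  obtain ⟨m, hm⟩ := exists_cutoff_eq_one hu R
  set θ := mulOp (cutoff X m).toBCF with hθ
  set e : ℝ≥0∞ := ENNReal.ofReal (c ^ 2 / 4) with he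
  have key : ∀ f a, e * ‖windowOp (w n) a f‖ₑ ^ 2 ≤ 2 * ‖windowOp (w n) a (B f)‖ₑ ^ 2 +
      2 * ‖windowComm B (w n) a f‖ₑ ^ 2 + e * ‖windowOp (w n) a (θ f)‖ₑ ^ 2 := by
    intro f a
    by_cases ha : a ∈ K
    · have h1 : windowOp (w n) a (θ f) = windowOp (w n) a f :=
        DFunLike.congr_fun (windowOp_mul_cutoff (hm a (by simpa using hR ha))) f
      rw [h1]
      exact le_add_self
    · refine le_trans ?_ le_self_add
      have h1 := hKc ha f
      have h2 : B (windowOp (w n) a f) = windowOp (w n) a (B f) + windowComm B (w n) a f := by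
        rw [windowComm_apply]
        abel
      refine le_trans ?_ (enorm_add_sq_le _ _)
      rw [← h2, SlowCommutation.enorm_sq_eq_ofReal, SlowCommutation.enorm_sq_eq_ofReal, he,
        ← ENNReal.ofReal_mul (by positivity)]
      refine ENNReal.ofReal_le_ofReal ?_
      calc _ = (c / 2 * ‖windowOp (w n) a f‖) ^ 2 := by ring
        _ ≤ _ := by gcongr
  have key2 : ∀ f, e * ‖f‖ₑ ^ 2 ≤ 2 * ‖B f‖ₑ ^ 2 +
      2 * (ENNReal.ofReal (c ^ 2 / 16) * ‖f‖ₑ ^ 2) + e * ‖θ f‖ₑ ^ 2 := by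
    intro f
    calc e * ‖f‖ₑ ^ 2 = ∫⁻ a, e * ‖windowOp (w n) a f‖ₑ ^ 2 := by
          rw [lintegral_const_mul _ (measurable_windowOp _ _), lintegral_windowOp hw]
      _ ≤ ∫⁻ a, (2 * ‖windowOp (w n) a (B f)‖ₑ ^ 2 +
          2 * ‖windowComm B (w n) a f‖ₑ ^ 2 + e * ‖windowOp (w n) a (θ f)‖ₑ ^ 2) :=
          lintegral_mono fun a => key f a
      _ = 2 * ‖B f‖ₑ ^ 2 + 2 * (∫⁻ a, ‖windowComm B (w n) a f‖ₑ ^ 2) + e * ‖θ f‖ₑ ^ 2 := by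
          rw [lintegral_add_right _ ((measurable_windowOp _ _).const_mul _),
            lintegral_add_left ((measurable_windowOp _ _).const_mul _),
            lintegral_const_mul _ (measurable_windowOp _ _),
            lintegral_const_mul _ (measurable_windowOp _ _),
            lintegral_const_mul _ (measurable_windowComm _ _ _),
            lintegral_windowOp hw, lintegral_windowOp hw]
      _ ≤ _ := by
          gcongr
          exact hn f
  -- c² / 8 is what remains after absorbing the commutator; 2 + c² / 4 dominates both coefficients
  -- on the right.
  refine ⟨m, c ^ 2 / 8 / (2 + c ^ 2 / 4), by positivity, fun f => ?_⟩
  have aux : ∀ x y t : ℝ, 0 ≤ x → 0 ≤ y → 0 ≤ t →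
      ENNReal.ofReal (c ^ 2 / 4) * ENNReal.ofReal x ≤ 2 * ENNReal.ofReal y +
        2 * (ENNReal.ofReal (c ^ 2 / 16) * ENNReal.ofReal x) +
        ENNReal.ofReal (c ^ 2 / 4) * ENNReal.ofReal t →
      c ^ 2 / 4 * x ≤ 2 * y + 2 * (c ^ 2 / 16 * x) + c ^ 2 / 4 * t := by
    intro x y t hx hy ht h
    rw [← ENNReal.ofReal_ofNat 2, ← ENNReal.ofReal_mul (by positivity),
      ← ENNReal.ofReal_mul (by positivity), ← ENNReal.ofReal_mul (by positivity),
      ← ENNReal.ofReal_mul (by positivity), ← ENNReal.ofReal_mul (by positivity),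
      ← ENNReal.ofReal_add (by positivity) (by positivity),
      ← ENNReal.ofReal_add (by positivity) (by positivity),
      ENNReal.ofReal_le_ofReal_iff (by positivity)] at h
    exact h
  have h1 := key2 f
  rw [SlowCommutation.enorm_sq_eq_ofReal, SlowCommutation.enorm_sq_eq_ofReal,
    SlowCommutation.enorm_sq_eq_ofReal] at h1
  replace h1 := aux _ _ _ (sq_nonneg _) (sq_nonneg _) (sq_nonneg _) h1
  rw [div_mul_eq_mul_div, div_le_iff₀ (by positivity)]
  nlinarith [sq_nonneg ‖B f‖, sq_nonneg ‖θ f‖, sq_nonneg c,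
    mul_nonneg (sq_nonneg c) (sq_nonneg ‖B f‖)]

lemma norm_mulOp_cutoff_apply_le (n : ℕ) (g : L2 X) : ‖mulOp (cutoff X n).toBCF g‖ ≤ ‖g‖ := by
  refine (norm_mulOp_apply_le _ g).trans (mul_le_of_le_one_left (norm_nonneg _) ?_)
  exact (BoundedContinuousFunction.norm_le zero_le_one).2 (norm_cutoff_apply_le n)

lemma exists_compact_lower_bound {w : ℕ → C₀(X, ℂ)} (hw : IsWindow w) {A : BL2 X}
    (hAw : SlowCommutation w A) (hAc : ∀ θ : C₀(X, ℂ), IsCompactOperator (mulOp θ.toBCF * A))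
    {z : ℂ} (hz : z ≠ 0) {c : ℝ} (hc : 0 < c)
    (hA : ∀ 𝔘 : Ultrafilter X, (𝔘 : Filter X) ≤ cocompact X →
      ∃ S : BL2 X, LocalLimit 𝔘 A S ∧ ∀ f, c * ‖f‖ ≤ ‖(S - z • 1) f‖) :
    ∃ (K : BL2 X) (d : ℝ), IsCompactOperator K ∧ 0 < d ∧
      ∀ f, d * ‖f‖ ^ 2 ≤ ‖(A - z • 1) f‖ ^ 2 + ‖K f‖ ^ 2 := by
  have hBw : SlowCommutation w (A - z • 1) := by
    intro ε hε
    filter_upwards [hAw ε hε] with n hn f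
    have : windowComm (A - z • 1) (w n) = windowComm A (w n) := by
      ext1 a
      simp [windowComm, sub_mul, mul_sub]
    rw [this]
    exact hn f
  obtain ⟨m, d, hd, h⟩ := exists_cutoff_lower_bound hw hBw hc fun 𝔘 h𝔘 => by
    obtain ⟨S, hS, hSc⟩ := hA 𝔘 h𝔘
    exact ⟨S - z • 1, hS.sub (LocalLimit.one.smul z), hSc⟩
  have hz' : 0 < ‖z‖ := norm_pos_iff.2 hz
  refine ⟨mulOp (cutoff X m).toBCF * A, d / (1 + 2 / ‖z‖ ^ 2), hAc _, by positivity, fun f => ?_⟩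
  set θ := mulOp (cutoff X m).toBCF with hθ
  -- Since z ≠ 0, this expresses the noncompact cutoff term by the compact θ A and by A − z itself.
  have h1 : z • θ f = (θ * A) f - θ ((A - z • 1) f) := by
    have : (A - z • 1) f = A f - z • f := rfl
    rw [this, map_sub, map_smul]
    change z • θ f = θ (A f) - _
    abel
  have h2 : ‖z‖ ^ 2 * ‖θ f‖ ^ 2 ≤ 2 * ‖(θ * A) f‖ ^ 2 + 2 * ‖(A - z • 1) f‖ ^ 2 := by
    calc _ = ‖z • θ f‖ ^ 2 := by rw [norm_smul, mul_pow]
      _ ≤ (‖(θ * A) f‖ + ‖θ ((A - z • 1) f)‖) ^ 2 := by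
        rw [h1]
        gcongr
        exact norm_sub_le _ _
      _ ≤ 2 * ‖(θ * A) f‖ ^ 2 + 2 * ‖θ ((A - z • 1) f)‖ ^ 2 := by
        nlinarith [sq_nonneg (‖(θ * A) f‖ - ‖θ ((A - z • 1) f)‖)]
      _ ≤ _ := by
        gcongr
        exact norm_mulOp_cutoff_apply_le _ _
  have h3 : ‖θ f‖ ^ 2 ≤ 2 / ‖z‖ ^ 2 * (‖(θ * A) f‖ ^ 2 + ‖(A - z • 1) f‖ ^ 2) := by
    rw [div_mul_eq_mul_div, le_div_iff₀ (by positivity)]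
    linarith
  rw [div_mul_eq_mul_div, div_le_iff₀ (by positivity)]
  nlinarith [h f, sq_nonneg ‖(θ * A) f‖]

/-- The localizations of `T` along lines are uniformly invertible if they are invertible. -/
lemma exists_uniform_lower_bound {T : BL2 X} (hT : T ∈ quantumGrassmann X) {z : ℂ}
    (hz : ∀ Y : Lines X, IsUnit (tau Y.1 T - z • 1)) :
    ∃ c : ℝ, 0 < c ∧ ∀ (Y : Lines X) (f : L2 X), c * ‖f‖ ≤ ‖(tau Y.1 T - z • 1) f‖ ∧
      c * ‖f‖ ≤ ‖star (tau Y.1 T - z • 1) f‖ := by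
  -- Inversion is continuous on the norm compact set of localizations, hence the inverses are
  -- uniformly bounded.
  obtain ⟨M, hM⟩ := (isCompact_setOf_tau hT).exists_bound_of_continuousOn
    (f := fun S => Ring.inverse (S - z • 1)) (by
      rintro _ ⟨Y, rfl⟩
      obtain ⟨v, hv⟩ := hz Y
      have h1 := NormedRing.inverse_continuousAt v
      rw [hv] at h1
      have h2 : ContinuousAt (fun S : BL2 X => S - z • 1) (tau Y.1 T) := by fun_prop
      exact (ContinuousAt.comp (f := fun S : BL2 X => S - z • 1) h1 h2).continuousWithinAt)
  have hpos : 0 < |M| + 1 := by positivity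
  refine ⟨(|M| + 1)⁻¹, inv_pos.2 hpos, fun Y f => ?_⟩
  set D := tau Y.1 T - z • 1 with hD
  have hI : ‖Ring.inverse D‖ ≤ |M| + 1 :=
    (hM _ ⟨Y, rfl⟩).trans ((le_abs_self M).trans (by linarith))
  have key : ∀ E F : BL2 X, ‖E‖ ≤ |M| + 1 → E * F = 1 → (|M| + 1)⁻¹ * ‖f‖ ≤ ‖F f‖ := by
    intro E F hE hEF
    rw [inv_mul_le_iff₀ hpos]
    calc ‖f‖ = ‖E (F f)‖ := by
          rw [← mul_apply_eq_comp, hEF]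
          rfl
      _ ≤ _ := (E.le_opNorm _).trans (by gcongr)
  refine ⟨key _ _ hI (Ring.inverse_mul_cancel _ (hz Y)), key (star (Ring.inverse D)) _ ?_ ?_⟩
  · exact (norm_star (Ring.inverse D)).trans_le hI
  · rw [← star_mul, Ring.mul_inverse_cancel _ (hz Y), star_one]

/-- Limits along ultrafilters at infinity are translates of localizations along lines, so one lower
bound uniform over lines controls them all. It is used for T and for its adjoint. -/
lemma exists_parametrix_of_forall_isUnit {T : BL2 X} (hT : T ∈ quantumGrassmann X) {z : ℂ}
    (hz0 : z ≠ 0) (hz : ∀ Y : Lines X, IsUnit (tau Y.1 T - z • 1)) :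
    ∃ S : BL2 X, IsCompactOperator (S * (T - z • 1) - 1 : BL2 X) ∧
      IsCompactOperator ((T - z • 1) * S - 1 : BL2 X) := by
  obtain ⟨c, hc, hcY⟩ := exists_uniform_lower_bound hT hz
  obtain ⟨w, hw⟩ := exists_isWindow X
  have hstar : ∀ S : BL2 X, star (S - z • 1) = star S - star z • 1 := fun S => by
    rw [star_sub, star_smul, star_one]
  have hconj : ∀ (x₀ : X) (S : BL2 X) (ζ : ℂ),
      conjTranslation x₀ S - ζ • 1 = conjTranslation x₀ (S - ζ • 1) := fun x₀ S ζ => by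
    rw [conjTranslation_sub, conjTranslation_smul, conjTranslation_one]
  obtain ⟨K, d, hK, hd, h1⟩ := exists_compact_lower_bound hw (slowCommutation_of_mem hw hT)
    (fun θ => isCompactOperator_mulOp_mul_of_mem θ hT) hz0 hc fun 𝔘 h𝔘 => by
      obtain ⟨Y, x₀, h⟩ := exists_localLimit_of_ultrafilter h𝔘 hT
      refine ⟨_, h, fun f => ?_⟩
      rw [hconj, norm_conjTranslation_apply, ← norm_translation_apply (-x₀) f]
      exact (hcY Y _).1
  obtain ⟨K', d', hK', hd', h1'⟩ := exists_compact_lower_bound hw (slowCommutation_star_of_mem hw hT)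
    (fun θ => isCompactOperator_mulOp_mul_star_of_mem θ hT) (star_ne_zero.2 hz0) hc fun 𝔘 h𝔘 => by
      obtain ⟨Y, x₀, h⟩ := exists_localLimit_of_ultrafilter h𝔘 hT
      refine ⟨_, h.star, fun f => ?_⟩
      rw [star_conjTranslation, hconj, norm_conjTranslation_apply, ← norm_translation_apply (-x₀) f,
        ← hstar]
      exact (hcY Y _).2
  refine exists_parametrix hK hK' hd hd' h1 fun f => ?_
  rw [hstar]
  exact h1' f

end LowerBounds

end QuantumGrassmann

namespace QuantumGrassmann

/-! ### Compact operators at infinity and the essential spectrum of bounded operators -/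

section WeakConvergence

variable {X : Type*} [NormedAddCommGroup X] [InnerProductSpace ℝ X] [FiniteDimensional ℝ X]
  [MeasurableSpace X] [BorelSpace X]

lemma mulOp_mul_translation_mul_mulOp_eq_zero {θ η : X →ᵇ ℂ} {y : X}
    (h : ∀ x, θ x * η (y + x) = 0) : mulOp θ * translation y * mulOp η = 0 := by
  rw [mul_assoc, translation_mul, conjTranslation_mulOp, ← mul_assoc, ← mulOp_mul]
  have h0 : θ * shift y η = 0 := by
    ext x
    exact h x
  rw [h0, mulOp_zero, zero_mul]

lemma norm_inner_translation_le {θ : BL2 X} (hθ : ∀ g, ‖θ g‖ ≤ ‖g‖) {y : X}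
    (hy : star θ * translation y * θ = 0) (h f : L2 X) :
    ‖inner ℂ h (translation y f)‖ ≤ ‖h - θ h‖ * ‖f‖ + ‖h‖ * ‖f - θ f‖ := by
  have h1 : inner ℂ (θ h) (translation y (θ f)) = 0 := by
    rw [← ContinuousLinearMap.adjoint_inner_right]
    have h2 : ContinuousLinearMap.adjoint θ (translation y (θ f)) = 0 :=
      DFunLike.congr_fun hy f
    rw [h2, inner_zero_right]
  have h3 : inner ℂ h (translation y f) = inner ℂ (h - θ h) (translation y f) +
      inner ℂ (θ h) (translation y (f - θ f)) := by
    rw [map_sub, inner_sub_left, inner_sub_right, h1]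
    ring
  rw [h3]
  refine (norm_add_le _ _).trans (add_le_add ?_ ?_)
  · exact (norm_inner_le_norm _ _).trans_eq (by rw [norm_translation_apply])
  · refine (norm_inner_le_norm _ _).trans ?_
    rw [norm_translation_apply]
    gcongr
    exact hθ h

lemma eventually_star_mul_translation_mul_eq_zero (n : ℕ) : ∀ᶠ y in cocompact X,
    star (mulOp (cutoff X n).toBCF) * translation y * mulOp (cutoff X n).toBCF = 0 := by
  obtain ⟨R, hR⟩ := (hasCompactSupport_cutoff (X := X) n).isCompact.isBounded.subset_closedBall 0
  filter_upwards [tendsto_norm_cocompact_atTop.eventually (eventually_gt_atTop (R + R))] with y hy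
  rw [star_mulOp]
  refine mulOp_mul_translation_mul_mulOp_eq_zero fun x => ?_
  change star (cutoff X n x) * cutoff X n (y + x) = 0
  by_contra hne
  obtain ⟨h1, h2⟩ := mul_ne_zero_iff.1 hne
  have h3 : ‖x‖ ≤ R := by simpa using hR (subset_tsupport _ (star_ne_zero.1 h1))
  have h4 : ‖y + x‖ ≤ R := by simpa using hR (subset_tsupport _ h2)
  have h5 : ‖y‖ ≤ ‖y + x‖ + ‖x‖ := by simpa using norm_sub_le (y + x) x
  linarith

lemma tendsto_norm_sub_mulOp_cutoff (f : L2 X) :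
    Tendsto (fun n : ℕ => ‖f - mulOp (cutoff X n).toBCF f‖) atTop (𝓝 0) := by
  have h := ((tendsto_mulOp_cutoff f).const_sub f).norm
  rwa [sub_self, norm_zero] at h

/-- After cutting both vectors off to compact support, distant translations make the supports
disjoint. -/
lemma tendsto_inner_translation (h f : L2 X) :
    Tendsto (fun y => inner ℂ h (translation y f)) (cocompact X) (𝓝 0) := by
  have hlim := ((tendsto_norm_sub_mulOp_cutoff h).mul_const ‖f‖).add
    ((tendsto_norm_sub_mulOp_cutoff f).const_mul ‖h‖)
  rw [zero_mul, mul_zero, add_zero] at hlim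
  refine tendsto_zero_iff_norm_tendsto_zero.2 (Metric.tendsto_nhds.2 fun ε hε => ?_)
  obtain ⟨n, hn⟩ := (hlim.eventually (eventually_lt_nhds hε)).exists
  refine (eventually_star_mul_translation_mul_eq_zero n).mono fun y hy => ?_
  rw [dist_zero_right, norm_norm]
  exact (norm_inner_translation_le (norm_mulOp_cutoff_apply_le n) hy h f).trans_lt hn

lemma tendsto_conjTranslation_of_isCompactOperator {K : BL2 X} (hK : IsCompactOperator K)
    (f : L2 X) : Tendsto (fun y => conjTranslation y K f) (cocompact X) (𝓝 0) := by
  rw [tendsto_zero_iff_norm_tendsto_zero]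
  simp only [norm_conjTranslation_apply]
  rw [← tendsto_zero_iff_norm_tendsto_zero]
  refine tendsto_of_isCompactOperator_of_weak (M := ‖f‖)
    (fun y => (norm_translation_apply _ _).le) (fun h => ?_) hK
  exact (tendsto_inner_translation h f).comp (Homeomorph.neg X).isClosedEmbedding.tendsto_cocompact

/-- Conjugating S B = 1 + compact by U_y sends the compact part strongly to 0, so f is the limit of
translates of S applied to vectors converging to B' f. -/
lemma norm_le_of_localLimit {𝔉 : Filter X} [𝔉.NeBot] (h𝔉 : 𝔉 ≤ cocompact X) {B B' S : BL2 X}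
    (hB : LocalLimit 𝔉 B B') (hS : IsCompactOperator (S * B - 1 : BL2 X)) (f : L2 X) :
    ‖f‖ ≤ ‖S‖ * ‖B' f‖ := by
  have h1 : Tendsto (fun y => f + conjTranslation y (S * B - 1) f) 𝔉 (𝓝 f) := by
    simpa using ((tendsto_conjTranslation_of_isCompactOperator hS f).mono_left h𝔉).const_add f
  refine le_of_tendsto_of_tendsto h1.norm ((hB.tendsto_apply f).norm.const_mul ‖S‖)
    (Eventually.of_forall fun y => ?_)
  have h2 : f + conjTranslation y (S * B - 1) f = conjTranslation y S (conjTranslation y B f) := by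
    rw [conjTranslation_sub, conjTranslation_one, conjTranslation_mul]
    change f + (conjTranslation y S (conjTranslation y B f) - f) = _
    abel
  dsimp only
  rw [h2]
  refine (ContinuousLinearMap.le_opNorm _ _).trans ?_
  gcongr
  exact norm_conjTranslation_le y S

lemma isUnit_of_localLimit {𝔉 : Filter X} [𝔉.NeBot] (h𝔉 : 𝔉 ≤ cocompact X) {B B' S : BL2 X}
    (hB : LocalLimit 𝔉 B B') (hS : IsCompactOperator (S * B - 1 : BL2 X))
    (hS' : IsCompactOperator (B * S - 1 : BL2 X)) : IsUnit B' := by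
  have hpos : 0 < ‖S‖ + 1 := by positivity
  have hpos' : 0 < ‖star S‖ + 1 := by positivity
  refine isUnit_of_bounded_below (inv_pos.2 hpos) (inv_pos.2 hpos') (fun f => ?_) fun f => ?_
  · rw [inv_mul_le_iff₀ hpos]
    refine (norm_le_of_localLimit h𝔉 hB hS f).trans ?_
    gcongr
    linarith
  · rw [inv_mul_le_iff₀ hpos']
    have h1 : IsCompactOperator (star S * star B - 1 : BL2 X) := by
      have := isCompactOperator_star hS'
      rwa [star_sub, star_mul, star_one] at this
    refine (norm_le_of_localLimit h𝔉 hB.star h1 f).trans ?_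
    gcongr
    linarith

lemma tau_eq_zero_of_isCompactOperator (Y : Lines X) {T : BL2 X} (hT : T ∈ quantumGrassmann X)
    (hTc : IsCompactOperator T) : tau Y.1 T = 0 := by
  ext1 f
  exact tendsto_nhds_unique ((localLimit_tau Y hT).tendsto_apply f)
    ((tendsto_conjTranslation_of_isCompactOperator hTc f).mono_left (grassmannFilterOf_le_cocompact Y))

lemma tendsto_inner_mulOp_character (h f : L2 X) :
    Tendsto (fun a => inner ℂ h (mulOp (character a) f)) (cocompact X) (𝓝 0) := by
  have h1 := (tendsto_integral_exp_inner_smul_cocompact (V := X)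
    fun x => inner ℂ (h x) (f x)).comp (Homeomorph.neg X).isClosedEmbedding.tendsto_cocompact
  refine h1.congr fun a => ?_
  rw [L2.inner_def]
  refine integral_congr_ae ?_
  filter_upwards [coeFn_mulOp (character a) f] with x hx
  rw [hx, character_apply]
  simp only [Homeomorph.coe_neg, inner_neg_right, neg_neg, Circle.smul_def, smul_eq_mul,
    Real.fourierChar_apply, real_inner_comm]
  simp
  ring_nf

/-- Multiplication by characters is isometric, commutes with θ(Q), and tends weakly to 0 by
Riemann–Lebesgue. A compact θ(Q) would therefore vanish, and not all of them do. Nontriviality of X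
makes the filter at infinity proper. -/
lemma not_isCompactOperator_mulOp [Nontrivial X] :
    ∃ θ : C₀(X, ℂ), ¬ IsCompactOperator (mulOp θ.toBCF) := by
  by_contra! hcon
  have hzero : ∀ (θ : C₀(X, ℂ)) (f : L2 X), mulOp θ.toBCF f = 0 := by
    intro θ f
    have hch : ∀ (a : X) (g : L2 X), ‖mulOp (character a) g‖ = ‖g‖ := fun a g => by
      refine le_antisymm ?_ ?_ <;> refine Lp.norm_le_norm_of_ae_le ?_ <;>
        filter_upwards [coeFn_mulOp (character a) g] with x hx <;>
        rw [hx, norm_mul, norm_character_apply, one_mul]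
    have h1 := tendsto_of_isCompactOperator_of_weak (M := ‖f‖)
      (fun a => (hch a f).le) (fun h => tendsto_inner_mulOp_character h f) (hcon θ)
    have h2 : ∀ a, ‖mulOp θ.toBCF (mulOp (character a) f)‖ = ‖mulOp θ.toBCF f‖ := fun a => by
      have : mulOp θ.toBCF * mulOp (character a) = mulOp (character a) * mulOp θ.toBCF := by
        rw [← mulOp_mul, mul_comm, mulOp_mul]
      rw [← hch a (mulOp θ.toBCF f)]
      exact congrArg norm (DFunLike.congr_fun this f)
    have h3 := h1.norm
    simp only [h2, norm_zero] at h3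
    have : NoncompactSpace X := NormedSpace.noncompactSpace ℝ X
    exact norm_eq_zero.1 (tendsto_nhds_unique tendsto_const_nhds h3)
  obtain ⟨w, hw⟩ := exists_isWindow X
  have hm : MemLp (w 0) 2 (volume : Measure X) :=
    (w 0).continuous.memLp_of_hasCompactSupport (hw.hasCompactSupport 0)
  have h1 : ‖hm.toLp (w 0)‖ₑ ^ 2 = 1 := by
    rw [enorm_sq_eq_lintegral, ← hw.lintegral_eq_one 0]
    refine lintegral_congr_ae ?_
    filter_upwards [hm.coeFn_toLp] with x hx
    rw [hx]
  have h2 : hm.toLp (w 0) = 0 := by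
    refine tendsto_nhds_unique (tendsto_mulOp_cutoff (hm.toLp (w 0))) ?_
    simp only [hzero]
    exact tendsto_const_nhds
  rw [h2] at h1
  simp at h1

/-- Multiplying by θ(Q) on the left, compactness of θ(Q)T would make every θ(Q) compact. This
settles z = 0. -/
lemma not_exists_parametrix_zero [Nontrivial X] {T : BL2 X} (hT : T ∈ quantumGrassmann X)
    (S : BL2 X) : ¬ IsCompactOperator (T * S - 1 : BL2 X) := by
  intro h
  obtain ⟨θ, hθ⟩ := not_isCompactOperator_mulOp (X := X)
  refine hθ ?_
  have h1 : mulOp θ.toBCF = mulOp θ.toBCF * T * S - mulOp θ.toBCF * (T * S - 1) := by noncomm_ring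
  rw [h1]
  exact (IsCompactOperator.mul_right' (isCompactOperator_mulOp_mul_of_mem θ hT) S).sub
    (IsCompactOperator.mul_left' h _)

lemma isCompactOperator_one [Subsingleton X] : IsCompactOperator (1 : BL2 X) := by
  have h1 : (cutoff X 0).toBCF = 1 := by
    ext x
    exact cutoff_eq_one (by simp [Subsingleton.elim x 0])
  have h2 := isCompactOperator_mulOp_mul_fourierMul (cutoff X 0) (cutoff X 0)
  rwa [h1, mulOp_one, fourierMul_one, one_mul] at h2

lemma mem_spectrum_iff {A : BL2 X} {z : ℂ} : z ∈ spectrum ℂ A ↔ ¬ IsUnit (A - z • 1) := by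
  rw [spectrum.mem_iff, Algebra.algebraMap_eq_smul_one, IsUnit.sub_iff]

theorem essSpectrum_eq {T : BL2 X} (hT : T ∈ quantumGrassmann X) :
    essSpectrum T = ⋃ Y : Lines X, spectrum ℂ (tau Y.1 T) := by
  ext z
  simp only [Set.mem_iUnion, mem_spectrum_iff]
  refine ⟨fun hz => ?_, ?_⟩
  -- If X = 0 there are no lines, but the identity is compact, so every z has the parametrix 0.
  · by_contra! hcon
    rcases subsingleton_or_nontrivial X with hX | hX
    · refine hz ⟨0, ?_, ?_⟩
      · rw [zero_mul, zero_sub]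
        exact isCompactOperator_one.neg
      · rw [mul_zero, zero_sub]
        exact isCompactOperator_one.neg
    -- At z = 0 no localization can be invertible, since it again lies in the algebra; a single line
    -- gives the contradiction.
    · by_cases hz0 : z = 0
      · obtain ⟨v, hv⟩ := exists_ne (0 : X)
        let Y : Lines X := ⟨Submodule.span ℝ {v}, finrank_span_singleton hv⟩
        obtain ⟨S, hS⟩ := (hcon Y).exists_right_inv
        rw [hz0, zero_smul, sub_zero] at hS
        refine not_exists_parametrix_zero (tau_mem Y hT) S ?_
        rw [hS, sub_self]
        exact isCompactOperator_zero
      · exact hz (exists_parametrix_of_forall_isUnit hT hz0 hcon)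
  · rintro ⟨Y, hY⟩ ⟨S, hS, hS'⟩
    exact hY (isUnit_of_localLimit (grassmannFilterOf_le_cocompact Y)
      ((localLimit_tau Y hT).sub (LocalLimit.one.smul z)) hS hS')

end WeakConvergence

/-! ### Localization of observables -/

section Observables

variable {X : Type*} [NormedAddCommGroup X] [InnerProductSpace ℝ X] [FiniteDimensional ℝ X]
  [MeasurableSpace X] [BorelSpace X]

/-- Strong limits of bounded families multiply. Membership of the product is assumed; for
observables it comes from H φ * H ψ = H (φ * ψ). -/
lemma tau_mul (Y : Lines X) {S T : BL2 X} (hS : S ∈ quantumGrassmann X)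
    (hT : T ∈ quantumGrassmann X) (hST : S * T ∈ quantumGrassmann X) :
    tau Y.1 (S * T) = tau Y.1 S * tau Y.1 T := by
  ext1 f
  refine tendsto_nhds_unique ((localLimit_tau Y hST).tendsto_apply f) ?_
  have h1 := (localLimit_tau Y hT).tendsto_apply f
  have h2 := (localLimit_tau Y hS).tendsto_apply (tau Y.1 T f)
  have h3 : Tendsto (fun y => conjTranslation y S (conjTranslation y T f - tau Y.1 T f))
      (grassmannFilterOf Y.1) (𝓝 0) := by
    refine squeeze_zero_norm (a := fun y => ‖S‖ * ‖conjTranslation y T f - tau Y.1 T f‖)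
      (fun y => ?_) ?_
    · refine (ContinuousLinearMap.le_opNorm _ _).trans ?_
      gcongr
      exact norm_conjTranslation_le y S
    · simpa using (tendsto_iff_norm_sub_tendsto_zero.1 h1).const_mul ‖S‖
  have h4 := h3.add h2
  rw [zero_add] at h4
  refine h4.congr fun y => ?_
  rw [map_sub, sub_add_cancel, conjTranslation_mul]
  rfl

lemma tau_star (Y : Lines X) {T : BL2 X} (hT : T ∈ quantumGrassmann X) :
    tau Y.1 (star T) = star (tau Y.1 T) :=
  tau_eq (localLimit_tau Y hT).star

/-- The localization of an observable along a line. -/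
noncomputable def tauObservable (H : Observable (L2 X)) (hH : IsAffiliated H (quantumGrassmann X))
    (Y : Lines X) : Observable (L2 X) where
  toFun φ := tau Y.1 (H φ)
  map_smul' c φ := by
    rw [map_smul]
    exact tau_smul Y c (hH φ)
  map_zero' := by rw [map_zero, tau_zero]
  map_add' φ ψ := by rw [map_add, tau_add Y (hH φ) (hH ψ)]
  map_mul' φ ψ := by rw [map_mul, tau_mul Y (hH φ) (hH ψ) (by rw [← map_mul]; exact hH _)]
  map_star' φ := by rw [map_star, tau_star Y (hH φ)]

lemma norm_observable_apply_le {𝓗 : Type*} [NormedAddCommGroup 𝓗] [InnerProductSpace ℂ 𝓗]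
    [CompleteSpace 𝓗] (H : Observable 𝓗) (φ : C₀(ℝ, ℂ)) : ‖H φ‖ ≤ ‖φ‖ :=
  NonUnitalStarAlgHom.norm_apply_le H φ

end Observables

end QuantumGrassmann

namespace QuantumGrassmann

/-! ### Functions in C₀(ℝ) -/

section ContinuousFunctions

lemma exists_zeroAtInfty_eq {g : ℝ → ℝ} (hg : Continuous g) {t R : ℝ}
    (h : ∀ s, R < |s - t| → g s = 0) : ∃ φ : C₀(ℝ, ℂ), ∀ s, φ s = g s := by
  have hc : Continuous fun s => (g s : ℂ) := Complex.continuous_ofReal.comp hg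
  have hs : HasCompactSupport fun s => (g s : ℂ) := by
    refine HasCompactSupport.intro (isCompact_closedBall t R) fun s hs => ?_
    rw [Metric.mem_closedBall, Real.dist_eq, not_le] at hs
    rw [h s hs, Complex.ofReal_zero]
  exact ⟨⟨⟨_, hc⟩, hs.is_zero_at_infty⟩, fun s => rfl⟩

lemma norm_zeroAtInfty_le {φ : C₀(ℝ, ℂ)} {C : ℝ} (hC : 0 ≤ C) (h : ∀ s, ‖φ s‖ ≤ C) : ‖φ‖ ≤ C := by
  rw [← ZeroAtInftyContinuousMap.norm_toBCF_eq_norm]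
  exact (BoundedContinuousFunction.norm_le hC).2 h

lemma norm_apply_le_norm (φ : C₀(ℝ, ℂ)) (s : ℝ) : ‖φ s‖ ≤ ‖φ‖ := by
  rw [← ZeroAtInftyContinuousMap.norm_toBCF_eq_norm]
  exact φ.toBCF.norm_coe_le_norm s

/-- Outside a compact set |φ| < 1/2, and on a nonempty compact set the maximum is attained, so the
strict bound survives the supremum. -/
lemma norm_zeroAtInfty_lt_one {φ : C₀(ℝ, ℂ)} (h : ∀ s, ‖φ s‖ < 1) : ‖φ‖ < 1 := by
  have h1 : ∀ᶠ s in cocompact ℝ, ‖φ s‖ < 1 / 2 := by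
    simpa using Metric.tendsto_nhds.1 φ.zero_at_infty' (1 / 2) (by norm_num)
  obtain ⟨K, hK, hKc⟩ := mem_cocompact.1 h1
  rcases K.eq_empty_or_nonempty with rfl | hne
  · refine (norm_zeroAtInfty_le (by norm_num) fun s => ?_).trans_lt one_half_lt_one
    exact (hKc (by simp) : ‖φ s‖ < 1 / 2).le
  · obtain ⟨s₀, -, hs₀⟩ := hK.exists_isMaxOn hne φ.continuous.norm.continuousOn
    refine (norm_zeroAtInfty_le (C := max (1 / 2) ‖φ s₀‖) (by positivity) fun s => ?_).trans_lt
      (max_lt one_half_lt_one (h s₀))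
    by_cases hs : s ∈ K
    · exact (hs₀ hs).trans (le_max_right _ _)
    · exact (hKc hs : ‖φ s‖ < 1 / 2).le.trans (le_max_left _ _)

end ContinuousFunctions

/-! ### Peaking functions and spectra of observables -/

section ObservableSpectra

variable {𝓗 : Type*} [NormedAddCommGroup 𝓗] [InnerProductSpace ℂ 𝓗] [CompleteSpace 𝓗]

/-- A function in `C₀(ℝ)` peaking at `t` is smaller than one in the functional calculus of an
observable whose spectrum does not contain `t`. -/
lemma norm_observable_lt_one {H : Observable 𝓗} {t : ℝ} (ht : t ∉ obsSpectrum H) {p : ℝ → ℝ}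
    {φ : C₀(ℝ, ℂ)} (hφ : ∀ s, φ s = p s) (hp0 : ∀ s, 0 ≤ p s) (hp1 : ∀ s, p s ≤ 1)
    (hp : ∀ s, s ≠ t → p s < 1) : ‖H φ‖ < 1 := by
  simp only [obsSpectrum, Set.mem_ofPred_eq, not_forall, not_not] at ht
  obtain ⟨χ, hχt, hχ⟩ := ht
  set M : ℝ := ‖χ‖ ^ 2 with hM
  have hMpos : 0 < M := pow_pos ((norm_pos_iff.2 hχt).trans_le (norm_apply_le_norm χ t)) 2
  have hval : ∀ s, (φ - (M⁻¹ : ℂ) • (φ * (star χ * χ))) s =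
      ((p s * (1 - M⁻¹ * ‖χ s‖ ^ 2) : ℝ) : ℂ) := fun s => by
    have h1 : star (χ s) * χ s = ((‖χ s‖ ^ 2 : ℝ) : ℂ) := by
      rw [mul_comm]
      simpa using Complex.mul_conj' (χ s)
    change φ s - (M⁻¹ : ℂ) * (φ s * (star (χ s) * χ s)) = _
    rw [h1, hφ]
    push_cast
    ring
  -- As χ(H) = 0, this subtraction changes nothing in the calculus but pushes the function below 1
  -- at t. Dividing by M = ‖χ‖² keeps the factor in [0, 1].
  have h0 : H φ = H (φ - (M⁻¹ : ℂ) • (φ * (star χ * χ))) := by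
    rw [map_sub, map_smul, map_mul, map_mul, hχ, mul_zero, mul_zero, smul_zero, sub_zero]
  rw [h0]
  refine (norm_observable_apply_le H _).trans_lt (norm_zeroAtInfty_lt_one fun s => ?_)
  have h2 : M⁻¹ * ‖χ s‖ ^ 2 ≤ 1 := by
    rw [inv_mul_le_iff₀ hMpos, mul_one, hM]
    have := norm_apply_le_norm χ s
    gcongr
  have h3 : 0 ≤ M⁻¹ * ‖χ s‖ ^ 2 := by positivity
  rw [hval, Complex.norm_real, Real.norm_of_nonneg (mul_nonneg (hp0 s) (by linarith))]
  by_cases hs : s = t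
  · subst hs
    have h4 : 0 < M⁻¹ * ‖χ s‖ ^ 2 := by
      have := norm_pos_iff.2 hχt
      positivity
    nlinarith [hp0 s, hp1 s]
  · nlinarith [hp0 s, hp s hs]

/-- If `φ(H) - 1` has a left inverse modulo compact operators, where `φ` equals one at `t` only,
then `t` is outside the essential spectrum of `H`. -/
lemma notMem_obsEssSpectrum {H : Observable 𝓗} {t : ℝ} {p : ℝ → ℝ} (hp : Continuous p)
    (hpt : p t = 1) {φ : C₀(ℝ, ℂ)} (hφ : ∀ s, φ s = p s) {S : 𝓗 →L[ℂ] 𝓗}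
    (hS : IsCompactOperator (S * (H φ - 1) - 1 : 𝓗 →L[ℂ] 𝓗)) : t ∉ obsEssSpectrum H := by
  -- Near t the function φ − 1 is this small, so S times its localized version has norm below 1.
  have hε : 0 < (2 * (‖S‖ + 1))⁻¹ := by positivity
  obtain ⟨δ, hδ, hδp⟩ := Metric.continuousAt_iff.1 hp.continuousAt _ hε
  -- e equals 1 within δ / 4 of t and vanishes beyond δ / 2; e' below is supported within δ / 4, so
  -- e e' = e'.
  obtain ⟨e, he⟩ := exists_zeroAtInfty_eq (g := fun s => max 0 (min 1 (2 - 4 * |s - t| / δ)))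
    (t := t) (R := δ / 2) (by fun_prop) fun s hs => by
      refine max_eq_left ((min_le_right _ _).trans ?_)
      rw [sub_nonpos, le_div_iff₀ hδ]
      linarith
  obtain ⟨e', he'⟩ := exists_zeroAtInfty_eq (g := fun s => max 0 (1 - 4 * |s - t| / δ))
    (t := t) (R := δ / 4) (by fun_prop) fun s hs => by
      refine max_eq_left ?_
      rw [sub_nonpos, le_div_iff₀ hδ]
      linarith
  have hee' : e * e' = e' := by
    ext s
    change e s * e' s = e' s
    rw [he, he']
    rcases le_or_gt 1 (4 * |s - t| / δ) with h | h
    · rw [max_eq_left (a := (0 : ℝ)) (b := 1 - 4 * |s - t| / δ) (by linarith)]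
      simp
    · rw [min_eq_left (by linarith), max_eq_right zero_le_one]
      simp
  set B := S * H (φ * e - e) with hB
  have hBnorm : ‖B‖ < 1 := by
    have h1 : ‖φ * e - e‖ ≤ (2 * (‖S‖ + 1))⁻¹ := by
      refine norm_zeroAtInfty_le hε.le fun s => ?_
      have h2 : (φ * e - e) s = (((p s - 1) * max 0 (min 1 (2 - 4 * |s - t| / δ)) : ℝ) : ℂ) := by
        change φ s * e s - e s = _
        rw [hφ, he]
        push_cast
        ring
      have h0 : 0 ≤ max 0 (min 1 (2 - 4 * |s - t| / δ)) := le_max_left _ _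
      have h1 : max 0 (min 1 (2 - 4 * |s - t| / δ)) ≤ 1 := max_le zero_le_one (min_le_left _ _)
      rw [h2, Complex.norm_real, norm_mul, Real.norm_of_nonneg h0]
      rcases lt_or_ge |s - t| δ with h | h
      · have h3 := (hδp (x := s) (by rwa [Real.dist_eq])).le
        rw [hpt, dist_eq_norm] at h3
        exact (mul_le_of_le_one_right (norm_nonneg _) h1).trans h3
      · rw [max_eq_left, mul_zero]
        · exact hε.le
        · refine (min_le_right _ _).trans ?_
          rw [sub_nonpos, le_div_iff₀ hδ]
          linarith
    calc ‖B‖ ≤ ‖S‖ * ‖H (φ * e - e)‖ := norm_mul_le _ _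
      _ ≤ ‖S‖ * (2 * (‖S‖ + 1))⁻¹ := by
        gcongr
        exact (norm_observable_apply_le H _).trans h1
      _ < 1 := by
        rw [← div_eq_mul_inv, div_lt_one (by positivity)]
        linarith [norm_nonneg S]
  -- Against e'(H), the operator φ(H) − 1 may be replaced by its localized version. The right side
  -- is compact and 1 − B is invertible, so e'(H) is compact.
  have hkey : (1 - B) * H e' = -((S * (H φ - 1) - 1) * H e') := by
    have h1 : H (φ * e - e) * H e' = (H φ - 1) * H e' := by
      rw [← map_mul, sub_mul, mul_assoc, hee', map_sub, map_mul, sub_mul, one_mul]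
    have h2 : B * H e' = S * ((H φ - 1) * H e') := by rw [hB, mul_assoc, h1]
    rw [sub_mul, h2]
    noncomm_ring
  obtain ⟨v, hv⟩ := isUnit_one_sub_of_norm_lt_one hBnorm
  intro ht
  refine ht e' ?_ ?_
  · rw [he']
    simp
  · have h3 : H e' = ↑v⁻¹ * -((S * (H φ - 1) - 1) * H e') := by
      rw [← hkey, ← hv, ← mul_assoc, Units.inv_mul, one_mul]
    rw [h3]
    exact IsCompactOperator.mul_left' (IsCompactOperator.mul_right' hS _).neg _

end ObservableSpectra

/-! ### The essential spectrum of observables -/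

section ObservableLocalization

variable {X : Type*} [NormedAddCommGroup X] [InnerProductSpace ℝ X] [FiniteDimensional ℝ X]
  [MeasurableSpace X] [BorelSpace X]

/-- If t is in no localized spectrum, the tent function at t has norm < 1 in each localized
calculus. Then τ_Y(φ(H)) − 1 is invertible for all Y, and the parametrix at z = 1 removes t. The
other inclusion holds because τ_Y annihilates the compact operators in the algebra. -/
theorem obsEssSpectrum_eq (H : Observable (L2 X)) (hH : IsAffiliated H (quantumGrassmann X)) :
    obsEssSpectrum H = ⋃ Y : Lines X, obsSpectrum (tauObservable H hH Y) := by
  refine Set.Subset.antisymm (fun t ht => ?_) (Set.iUnion_subset fun Y t ht φ hφ hc => ?_)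
  · by_contra hcon
    rw [Set.mem_iUnion, not_exists] at hcon
    obtain ⟨φ, hφ⟩ := exists_zeroAtInfty_eq (g := fun s => max 0 (1 - |s - t|))
      (t := t) (R := 1) (by fun_prop) fun s hs => max_eq_left (by linarith)
    have hunit : ∀ Y : Lines X, IsUnit (tau Y.1 (H φ) - (1 : ℂ) • 1) := fun Y => by
      rw [one_smul, IsUnit.sub_iff]
      refine isUnit_one_sub_of_norm_lt_one ?_
      refine norm_observable_lt_one (H := tauObservable H hH Y) (hcon Y) hφ
        (fun s => le_max_left _ _) (fun s => max_le zero_le_one ?_) fun s hs =>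
          max_lt zero_lt_one ?_
      · linarith [abs_nonneg (s - t)]
      · linarith [abs_pos.2 (sub_ne_zero.2 hs)]
    obtain ⟨S, hS, -⟩ := exists_parametrix_of_forall_isUnit (hH φ) one_ne_zero hunit
    rw [one_smul] at hS
    exact notMem_obsEssSpectrum (by fun_prop) (by simp) hφ hS ht
  · exact ht φ hφ (tau_eq_zero_of_isCompactOperator Y (hH φ) hc)

end ObservableLocalization

end QuantumGrassmann

open QuantumGrassmann
theorem mainTheorem10 (X : Type*) [NormedAddCommGroup X] [InnerProductSpace ℝ X]
    [FiniteDimensional ℝ X] [MeasurableSpace X] [BorelSpace X] :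
    (∀ T ∈ quantumGrassmann X,
      (∀ Y : Lines X, IsTranslationLimit Y.1 T (tau Y.1 T) ∧ tau Y.1 T ∈ quantumGrassmann X) ∧
      IsCompact {S : BL2 X | ∃ Y : Lines X, S = tau Y.1 T} ∧
      essSpectrum T = ⋃ Y : Lines X, spectrum ℂ (tau Y.1 T)) ∧
    (∀ H : Observable (L2 X), IsAffiliated H (quantumGrassmann X) →
      ∃ tauH : Lines X → Observable (L2 X),
        (∀ Y : Lines X, IsAffiliated (tauH Y) (quantumGrassmann X) ∧
          ∀ φ : C₀(ℝ, ℂ), tauH Y φ = tau Y.1 (H φ)) ∧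
        obsEssSpectrum H = ⋃ Y : Lines X, obsSpectrum (tauH Y)) := by
  refine ⟨fun T hT => ⟨fun Y => ⟨localLimit_tau Y hT, tau_mem Y hT⟩, isCompact_setOf_tau hT,
    essSpectrum_eq hT⟩, fun H hH => ⟨tauObservable H hH, fun Y => ⟨fun φ => tau_mem Y (hH φ),
      fun φ => rfl⟩, obsEssSpectrum_eq H hH⟩⟩
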